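/- **Setting.** Identify the plane with $\mathbb C$, let the root be the origin, and fix a restricting angle $0<\alpha<\pi/2$. Through a point $p=Re^{i\phi}\neq 0$ there are two inward logarithmic spirals, the right and the left one, given in polar coordinates by $s\mapsto (Re^{-s},\ \phi\pm s\tan\alpha)$, $s\ge 0$; both tend to the root. A *spiral path* follows finitely many segments of right or left spirals inwards, possibly followed by one spiral all the way to the root. The *spiral region* $\mathcal R_p$ is the set of endpoints of spiral paths from $p$. A *spiral tree* for a finite set $S$ of terminals (all different from the root) is a finite tree of such arcs, directed towards the root: nodes are identified with their locations, every terminal is a node, and every node other than the root has exactly one outgoing arc, a spiral path to its parent, which is strictly closer to the root. The length $L(T)$ of a spiral tree $T$ is the sum of the arc lengths of its arcs, and $|\mathcal C\cap T|$ is the number of points of $T$ on a circle $\mathcal C$. An *optimal spiral tree* for $S$ is one of minimum length. A *join point* of two nodes $u,v$ is a point of $\mathcal R_u\cap\mathcal R_v$ farthest from the root. A *greedy spiral tree* is built as follows. Initially the terminals are the active nodes and there are no arcs. As long as there are at least two active nodes, choose two distinct active nodes $u,v$ whose join point $p$ is farthest from the root among all join points of pairs of active nodes (ties are broken arbitrarily);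 connect each of $u,v$ that differs from $p$ to $p$ by an arbitrary spiral path; then $u,v$ stop being active and $p$ is active. Finally connect the last active node to the root by an arbitrary spiral path. **Theorem.** Let $0<\alpha<\pi/2$ and let $S$ be a finite set of terminals different from the root. 1. Every greedy spiral tree $T'$ for $S$ is a spiral tree for $S$, and for every spiral tree $T$ for $S$ (in particular for an optimal one): - $|\mathcal C\cap T'|\le 2\,|\mathcal C\cap T|$ for every circle $\mathcal C$ of positive radius centered at the root; - $L(T')\le 2\,L(T)$. 2. A greedy spiral tree can be computed in $O(n\log n)$ time. That is, there are one program and a constant $c$ such that for every $0<\alpha<\pi/2$, every $n\ge 1$ and every list of $n$ distinct terminals different from the root, the program, given $\alpha$ and the Cartesian coordinates of the terminals, outputs the list of arcs of a greedy spiral tree for these terminals (each arc by its two endpoints and its spiral segments) after at most $c\,(n\log n+1)$ steps. Programs are written in a first-order language with recursive functions, pairs (hence lists and trees) and exact real numbers, in which each of the following is one step: reading a variable, binding a variable, a rational constant, forming or inspecting a pair, comparing two reals, calling a function, and one of the operations $+,-,\times,/$, $\exp$, $\log$, $\sin$ and $\cos$ on $[-\pi,\pi]$, and the polar angle of a point.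 -/

import Mathlib

/-!
The plane is `ℂ` and the root of every tree is the origin.  The restricting angle is `α`.
-/

open scoped NNReal ENNReal

noncomputable section

namespace SpiralTree

/-! ### Spirals and spiral paths -/

/-- The two logarithmic spirals through a point: the right one and the left one. -/
inductive Side where
  | right
  | left

/-- `+1` for the right spiral, `-1` for the left spiral. -/
def Side.sign : Side → ℝ
  | .right => 1
  | .left => -1

/-- The point with parameter `s` on the right or left spiral of `p`: if `p` has polar coordinates
`(R, φ)`, this point has polar coordinates `(R * exp (-s), φ ± tan α * s)`. -/
def spiral (α : ℝ) (d : Side) (p : ℂ) (s : ℝ) : ℂ :=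
  p * (Real.exp (-s) : ℂ) * Complex.exp ((d.sign * Real.tan α * s : ℝ) * Complex.I)

/-- A spiral segment that starts at a point which is given separately: which of the two spirals
is followed, and up to which value of its parameter. -/
abbrev Move : Type := Side × ℝ≥0

/-- The endpoint of a sequence of spiral segments that starts at a given point. -/
def movesEnd (α : ℝ) : ℂ → List Move → ℂ
  | p, [] => p
  | p, (d, s) :: l => movesEnd α (spiral α d p s) l

/-- The set of points on a sequence of spiral segments that starts at a given point. -/
def movesPoints (α : ℝ) : ℂ → List Move → Set ℂ
  | p, [] => {p}
  | p, (d, s) :: l =>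
      spiral α d p '' Set.Icc 0 (s : ℝ) ∪ movesPoints α (spiral α d p s) l

/-- The arc length of a sequence of spiral segments that starts at a given point. -/
def movesLength (α : ℝ) : ℂ → List Move → ℝ≥0∞
  | _, [] => 0
  | p, (d, s) :: l =>
      eVariationOn (spiral α d p) (Set.Icc 0 (s : ℝ)) + movesLength α (spiral α d p s) l

/-- A spiral path, directed towards the root: it starts at `start`, follows the finitely many
spiral segments in `moves`, one after the other, and then, if `last = some d`, the spiral on
side `d` all the way to the root (which that spiral reaches in the limit). -/
structure Arc where
  start : ℂ
  moves : List Move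
  last : Option Side

instance : DecidableEq Arc := Classical.decEq _

/-- The other endpoint of a spiral path. -/
def Arc.finish (α : ℝ) (a : Arc) : ℂ :=
  match a.last with
  | none => movesEnd α a.start a.moves
  | some _ => 0

/-- The set of points on a spiral path, both endpoints included. -/
def Arc.points (α : ℝ) (a : Arc) : Set ℂ :=
  movesPoints α a.start a.moves ∪
    match a.last with
    | none => ∅
    | some d => insert 0 (spiral α d (movesEnd α a.start a.moves) '' Set.Ici 0)

/-- The arc length of a spiral path. -/
def Arc.length (α : ℝ) (a : Arc) : ℝ≥0∞ :=
  movesLength α a.start a.moves +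
    match a.last with
    | none => 0
    | some d => eVariationOn (spiral α d (movesEnd α a.start a.moves)) (Set.Ici 0)

/-- The spiral region of `p`: all points that can be reached from `p`. -/
def region (α : ℝ) (p : ℂ) : Set ℂ :=
  {q | ∃ a : Arc, a.start = p ∧ a.finish α = q}

/-! ### Spiral trees -/

/-- `T` is (the set of arcs of) a spiral tree with root `0` and terminals `S`.  The nodes are
identified with their locations; every node other than the root has exactly one outgoing arc,
which leads to its parent.  Every arc ends strictly closer to the root than it starts, so that
following the arcs always leads to the root. -/
structure IsSpiralTree (α : ℝ) (S : Finset ℂ) (T : Finset Arc) : Prop where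
  nondegenerate : ∀ a ∈ T, a.finish α ≠ a.start
  start_injOn : Set.InjOn Arc.start (T : Set Arc)
  terminal : ∀ t ∈ S, ∃ a ∈ T, a.start = t
  parent : ∀ a ∈ T, a.finish α = 0 ∨ ∃ b ∈ T, b.start = a.finish α

/-- The set of points on a tree. -/
def treePoints (α : ℝ) (T : Finset Arc) : Set ℂ := ⋃ a ∈ T, a.points α

/-- The length of a tree. -/
def treeLength (α : ℝ) (T : Finset Arc) : ℝ≥0∞ := ∑ a ∈ T, a.length α

/-! ### The greedy spiral tree -/

/-- `p` is a join point of `u` and `v`: a farthest point from the root that can be reached both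
from `u` and from `v`. -/
def IsJoinPoint (α : ℝ) (u v p : ℂ) : Prop :=
  p ∈ region α u ∩ region α v ∧ ∀ q ∈ region α u ∩ region α v, ‖q‖ ≤ ‖p‖

/-- `F` consists of one arc from `u` to `p`, or of no arc if `u = p`. -/
def IsLink (α : ℝ) (u p : ℂ) (F : Finset Arc) : Prop :=
  (u = p ∧ F = ∅) ∨ (u ≠ p ∧ ∃ a : Arc, a.start = u ∧ a.finish α = p ∧ F = {a})

/-- `GreedyForest α S A E`: starting from the terminals `S` without arcs, the greedy algorithm
can reach the forest with arcs `E` and with active nodes (nodes without a parent) `A`.  In every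
step two active nodes whose join point is farthest from the root are connected to it; if the join
point is one of the two, only the other one gets an arc. -/
inductive GreedyForest (α : ℝ) (S : Finset ℂ) : Finset ℂ → Finset Arc → Prop
  | init : GreedyForest α S S ∅
  | join {A : Finset ℂ} {E F G : Finset Arc} {u v p : ℂ} (forest : GreedyForest α S A E)
      (hu : u ∈ A) (hv : v ∈ A) (huv : u ≠ v) (hp : IsJoinPoint α u v p)
      (farthest : ∀ u' ∈ A, ∀ v' ∈ A, u' ≠ v' → ∀ p', IsJoinPoint α u' v' p' → ‖p'‖ ≤ ‖p‖)
      (hF : IsLink α u p F) (hG : IsLink α v p G) :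
      GreedyForest α S (insert p ((A.erase u).erase v)) (E ∪ F ∪ G)

/-- `T` is a greedy spiral tree of the terminals `S`: nodes are joined until a single active node
is left, and this one is connected to the root. -/
def IsGreedyTree (α : ℝ) (S : Finset ℂ) (T : Finset Arc) : Prop :=
  ∃ (w : ℂ) (E F : Finset Arc), GreedyForest α S {w} E ∧ IsLink α w 0 F ∧ T = E ∪ F

/-! ### The model of computation

Exact real arithmetic at unit cost, in a first-order language with pairs and recursive functions.
A program is a fixed finite text, and every counted step is a constant amount of work (for that
program): reading a variable, allocating or inspecting a pair, comparing two reals, one operation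
on reals, or entering a function. -/

/-- Values: real numbers, and binary trees (in particular lists) of them. -/
inductive Value where
  | real (x : ℝ)
  | nil
  | pair (a b : Value)

/-- Operations on one real number. -/
inductive UnaryOp where
  | exp | log | sin | cos

/-- Operations on two real numbers. -/
inductive BinaryOp where
  | add | sub | mul | div | arg

/-- `sin` and `cos` are available on `[-π, π]` only (so they cannot be used to round). -/
def UnaryOp.apply : UnaryOp → ℝ → ℝ
  | .exp, x => Real.exp x
  | .log, x => Real.log x
  | .sin, x => if |x| ≤ Real.pi then Real.sin x else 0
  | .cos, x => if |x| ≤ Real.pi then Real.cos x else 0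

/-- `arg x y` is the polar angle, in `(-π, π]`, of the point with coordinates `(x, y)`. -/
def BinaryOp.apply : BinaryOp → ℝ → ℝ → ℝ
  | .add, x, y => x + y
  | .sub, x, y => x - y
  | .mul, x, y => x * y
  | .div, x, y => x / y
  | .arg, x, y => Complex.arg ⟨x, y⟩

/-- Program terms; variables are de Bruijn indices into the environment. -/
inductive Term where
  | var (i : ℕ)
  | const (q : ℚ)
  | unary (o : UnaryOp) (e : Term)
  | binary (o : BinaryOp) (e f : Term)
  | nil
  | pair (e f : Term)
  | bind (e body : Term)
  | ifLt (e f yes no : Term)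
  | cases (e onNil onPair : Term)
  | call (i : ℕ) (e : Term)

/-- A program: the bodies of finitely many, mutually recursive, functions of one argument. -/
abbrev Program : Type := List Term

/-- `Eval P env e v k`: in the environment `env`, the term `e` of the program `P` evaluates to
the value `v` in `k` steps. -/
inductive Eval (P : Program) : List Value → Term → Value → ℕ → Prop
  | var {env : List Value} {i : ℕ} {v : Value} (h : env[i]? = some v) :
      Eval P env (.var i) v 1
  | const {env : List Value} {q : ℚ} : Eval P env (.const q) (.real q) 1
  | unary {env : List Value} {o : UnaryOp} {e : Term} {x : ℝ} {k : ℕ}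
      (he : Eval P env e (.real x) k) : Eval P env (.unary o e) (.real (o.apply x)) (k + 1)
  | binary {env : List Value} {o : BinaryOp} {e f : Term} {x y : ℝ} {k l : ℕ}
      (he : Eval P env e (.real x) k) (hf : Eval P env f (.real y) l) :
      Eval P env (.binary o e f) (.real (o.apply x y)) (k + l + 1)
  | nil {env : List Value} : Eval P env .nil .nil 1
  | pair {env : List Value} {e f : Term} {v w : Value} {k l : ℕ}
      (he : Eval P env e v k) (hf : Eval P env f w l) :
      Eval P env (.pair e f) (.pair v w) (k + l + 1)
  | bind {env : List Value} {e body : Term} {v w : Value} {k l : ℕ}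
      (he : Eval P env e v k) (hb : Eval P (v :: env) body w l) :
      Eval P env (.bind e body) w (k + l + 1)
  | ifLt_yes {env : List Value} {e f yes no : Term} {x y : ℝ} {v : Value} {k l m : ℕ}
      (he : Eval P env e (.real x) k) (hf : Eval P env f (.real y) l) (h : x < y)
      (hv : Eval P env yes v m) : Eval P env (.ifLt e f yes no) v (k + l + m + 1)
  | ifLt_no {env : List Value} {e f yes no : Term} {x y : ℝ} {v : Value} {k l m : ℕ}
      (he : Eval P env e (.real x) k) (hf : Eval P env f (.real y) l) (h : ¬ x < y)
      (hv : Eval P env no v m) : Eval P env (.ifLt e f yes no) v (k + l + m + 1)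
  | cases_nil {env : List Value} {e onNil onPair : Term} {v : Value} {k l : ℕ}
      (he : Eval P env e .nil k) (hv : Eval P env onNil v l) :
      Eval P env (.cases e onNil onPair) v (k + l + 1)
  | cases_pair {env : List Value} {e onNil onPair : Term} {a b v : Value} {k l : ℕ}
      (he : Eval P env e (.pair a b) k) (hv : Eval P (a :: b :: env) onPair v l) :
      Eval P env (.cases e onNil onPair) v (k + l + 1)
  | call {env : List Value} {i : ℕ} {e body : Term} {v w : Value} {k l : ℕ}
      (he : Eval P env e v k) (hi : P[i]? = some body) (hb : Eval P [v] body w l) :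
      Eval P env (.call i e) w (k + l + 1)

/-- The program `P`, started (with its first function) on the input `x`, halts with the output
`y` after `k` steps. -/
def Program.Computes (P : Program) (x y : Value) (k : ℕ) : Prop :=
  ∃ body, P[0]? = some body ∧ Eval P [x] body y k

/-! ### Input and output formats -/

def encodeList {β : Type} (f : β → Value) : List β → Value
  | [] => .nil
  | b :: l => .pair (f b) (encodeList f l)

/-- A point of the plane is given by its two Cartesian coordinates. -/
def encodePoint (z : ℂ) : Value := .pair (.real z.re) (.real z.im)

def encodeSide (d : Side) : Value := .real d.sign

def encodeMove (m : Move) : Value := .pair (encodeSide m.1) (.real (m.2 : ℝ))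

/-- An arc is output as its two endpoints and the spiral segments that it follows. -/
def encodeArc (α : ℝ) (a : Arc) : Value :=
  .pair (.pair (encodePoint a.start) (encodePoint (a.finish α)))
    (.pair (encodeList encodeMove a.moves) (encodeList encodeSide a.last.toList))

/-- The input: the restricting angle and the list of terminals. -/
def encodeInput (α : ℝ) (l : List ℂ) : Value := .pair (.real α) (encodeList encodePoint l)

end SpiralTree

end

/-!
Write `κ = tan α`. The proof uses null coordinates `X`, `Y` (`pt`): `X - Y`, the level of a point,
is `-2 * κ` times the logarithm of its radius, and `(X + Y) / 2` is its polar angle, so that `X`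
and `Y` are determined up to a common shift by a multiple of `2 * π`. A right spiral increases `X`,
a left spiral decreases `Y`. Hence the spiral region of a point is a quadrant (`mem_region_pt`), and
the join of two points, for given lifts, has the coordinates `max X X'` and `min Y Y'`.

*Approximation.* By self-similarity the arc length of a spiral is proportional to its radial
extent. So the length of a tree is an integral over the number of arcs that cross a circle
(`treeLength_eq_lintegral`), and it suffices to count crossings. Fix a circle. The regions of the
nodes of the greedy tree whose arcs cross it meet the circle in intervals, and these are disjoint,
since otherwise two of the nodes would have been joined before (`crossing_disjoint`). Following left
spirals backwards from one node and right spirals backwards from another, one arrives either at a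
terminal, from which every spiral tree has a path that crosses the circle within the hull of the two
intervals, or at two nodes that should have been joined before (`exists_crossing_in_hull`). So at
most two crossings of the greedy tree have the same next crossing of the other tree
(`card_crossing_le`).

*Computation.* The program sweeps the plane inwards. The active nodes that have been reached are
kept in a search tree, ordered by their first null coordinate in `[0, 2 * π)`. The lowest join of
two of them is attained at cyclic neighbours (`Invariant.exists_joinPair`); the search tree stores the
best pair of neighbours in every subtree, so that a join, or the activation of a terminal, takes
`O(log n)` steps. It remains to reduce coordinates modulo `2 * π`, which is not immediate without
rounding. All null coordinates are taken relative to a common rotation `β`, whose reduced value is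
updated when the level increases by less than `20`. At a larger gap between the levels of
consecutive terminals the rotation starts anew. This is possible because the spread of the
coordinates of the active nodes is bounded: the next join occurs at most `2 * π` in level after the
last terminal (`Invariant.joinLev_le`), so that a single active node is left at the gap, and the
next terminal lies in its region (`jumpArc_valid`).
-/

namespace SpiralTree

/-! ### Null coordinates -/

/-- The point with null coordinates `X`, `Y`: in polar coordinates, `-log` of the radius is
`(X - Y) / (2 * κ)`, and the polar angle is `(X + Y) / 2`. -/
noncomputable def pt (κ X Y : ℝ) : ℂ :=
  Complex.exp ((-(X - Y) / (2 * κ) : ℝ) + ((X + Y) / 2 : ℝ) * Complex.I)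

theorem pt_ne_zero (κ X Y : ℝ) : pt κ X Y ≠ 0 := Complex.exp_ne_zero _

theorem norm_pt (κ X Y : ℝ) : ‖pt κ X Y‖ = Real.exp (-(X - Y) / (2 * κ)) := by
  rw [pt, Complex.norm_exp, Complex.add_re, Complex.ofReal_re, Complex.re_ofReal_mul,
    Complex.I_re, mul_zero, add_zero]

theorem norm_pt_le_norm_pt {κ : ℝ} (hκ : 0 < κ) {X Y X' Y' : ℝ} :
    ‖pt κ X Y‖ ≤ ‖pt κ X' Y'‖ ↔ X' - Y' ≤ X - Y := by
  rw [norm_pt, norm_pt, Real.exp_le_exp, div_le_div_iff_of_pos_right (by positivity), neg_le_neg_iff]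

theorem norm_pt_lt_norm_pt {κ : ℝ} (hκ : 0 < κ) {X Y X' Y' : ℝ} :
    ‖pt κ X Y‖ < ‖pt κ X' Y'‖ ↔ X' - Y' < X - Y := by
  rw [← not_le, norm_pt_le_norm_pt hκ, not_le]

theorem norm_pt_eq_norm_pt {κ : ℝ} (hκ : 0 < κ) {X Y X' Y' : ℝ} :
    ‖pt κ X Y‖ = ‖pt κ X' Y'‖ ↔ X - Y = X' - Y' := by
  rw [le_antisymm_iff, le_antisymm_iff, norm_pt_le_norm_pt hκ, norm_pt_le_norm_pt hκ, and_comm]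

theorem pt_eq_pt_iff {κ : ℝ} (hκ : 0 < κ) {X Y X' Y' : ℝ} :
    pt κ X Y = pt κ X' Y' ↔
      ∃ k : ℤ, X = X' + k * (2 * Real.pi) ∧ Y = Y' + k * (2 * Real.pi) := by
  rw [pt, pt, Complex.exp_eq_exp_iff_exists_int]
  refine exists_congr fun k => ?_
  rw [Complex.ext_iff]
  simp only [Complex.add_re, Complex.ofReal_re, Complex.re_ofReal_mul, Complex.I_re, mul_zero,
    add_zero, Complex.add_im, Complex.ofReal_im, Complex.im_ofReal_mul, Complex.I_im, mul_one,
    zero_add]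
  have hre : ((k : ℂ) * (2 * Real.pi * Complex.I)).re = 0 := by simp
  have him : ((k : ℂ) * (2 * Real.pi * Complex.I)).im = k * (2 * Real.pi) := by simp
  rw [hre, him, add_zero, div_left_inj' (by positivity)]
  constructor
  · rintro ⟨h1, h2⟩
    constructor <;> linarith
  · rintro ⟨h1, h2⟩
    constructor <;> linarith

theorem pt_add_int_mul {κ : ℝ} (hκ : 0 < κ) (X Y : ℝ) (k : ℤ) :
    pt κ (X + k * (2 * Real.pi)) (Y + k * (2 * Real.pi)) = pt κ X Y :=
  (pt_eq_pt_iff hκ).2 ⟨k, rfl, rfl⟩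

theorem eq_pt_arg {κ : ℝ} (hκ : 0 < κ) {p : ℂ} (hp : p ≠ 0) :
    p = pt κ (p.arg - κ * Real.log ‖p‖) (p.arg + κ * Real.log ‖p‖) := by
  rw [pt]
  have h1 : -(p.arg - κ * Real.log ‖p‖ - (p.arg + κ * Real.log ‖p‖)) / (2 * κ) =
      Real.log ‖p‖ := by
    field_simp
    ring
  have h2 : (p.arg - κ * Real.log ‖p‖ + (p.arg + κ * Real.log ‖p‖)) / 2 = p.arg := by ring
  rw [h1, h2, Complex.exp_add, ← Complex.ofReal_exp, Real.exp_log (norm_pos_iff.2 hp),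
    Complex.norm_mul_exp_arg_mul_I]

theorem exists_pt_eq {κ : ℝ} (hκ : 0 < κ) {p : ℂ} (hp : p ≠ 0) : ∃ X Y, p = pt κ X Y :=
  ⟨_, _, eq_pt_arg hκ hp⟩

section Geometry

variable {α : ℝ}

theorem spiral_right_pt (hα : 0 < Real.tan α) (X Y s : ℝ) :
    spiral α .right (pt (Real.tan α) X Y) s = pt (Real.tan α) (X + 2 * Real.tan α * s) Y := by
  rw [spiral, pt, pt, Complex.ofReal_exp, ← Complex.exp_add, ← Complex.exp_add]
  congr 1
  generalize Real.tan α = κ at *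
  apply Complex.ext
  · simp only [Complex.add_re, Complex.ofReal_re, Complex.re_ofReal_mul, Complex.I_re, mul_zero,
      add_zero]
    field_simp
    ring
  · simp only [Side.sign, Complex.add_im, Complex.ofReal_im, Complex.im_ofReal_mul, Complex.I_im,
      mul_one, zero_add]
    ring

theorem spiral_left_pt (hα : 0 < Real.tan α) (X Y s : ℝ) :
    spiral α .left (pt (Real.tan α) X Y) s = pt (Real.tan α) X (Y - 2 * Real.tan α * s) := by
  rw [spiral, pt, pt, Complex.ofReal_exp, ← Complex.exp_add, ← Complex.exp_add]
  congr 1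
  generalize Real.tan α = κ at *
  apply Complex.ext
  · simp only [Complex.add_re, Complex.ofReal_re, Complex.re_ofReal_mul, Complex.I_re, mul_zero,
      add_zero]
    field_simp
    ring
  · simp only [Side.sign, Complex.add_im, Complex.ofReal_im, Complex.im_ofReal_mul, Complex.I_im,
      mul_one, zero_add]
    ring

theorem norm_spiral (d : Side) (p : ℂ) (s : ℝ) : ‖spiral α d p s‖ = ‖p‖ * Real.exp (-s) := by
  rw [spiral, norm_mul, norm_mul, Complex.norm_exp_ofReal_mul_I, Complex.norm_real,
    Real.norm_of_nonneg (Real.exp_pos _).le, mul_one]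

theorem spiral_zero (d : Side) (p : ℂ) : spiral α d p 0 = p := by
  simp [spiral]

theorem zero_spiral (d : Side) (s : ℝ) : spiral α d 0 s = 0 := by
  simp [spiral]

theorem movesEnd_zero (l : List Move) : movesEnd α 0 l = 0 := by
  induction l with
  | nil => rfl
  | cons m l ih => obtain ⟨d, s⟩ := m; rw [movesEnd, zero_spiral, ih]

theorem movesEnd_pt (hα : 0 < Real.tan α) (l : List Move) (X Y : ℝ) :
    ∃ X' Y', X ≤ X' ∧ Y' ≤ Y ∧
      movesEnd α (pt (Real.tan α) X Y) l = pt (Real.tan α) X' Y' := by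
  induction l generalizing X Y with
  | nil => exact ⟨X, Y, le_rfl, le_rfl, rfl⟩
  | cons m l ih =>
    obtain ⟨d, s⟩ := m
    have hs : 0 ≤ 2 * Real.tan α * (s : ℝ) := by positivity
    cases d with
    | right =>
      obtain ⟨X', Y', h1, h2, h3⟩ := ih (X + 2 * Real.tan α * s) Y
      refine ⟨X', Y', by linarith, h2, ?_⟩
      rw [movesEnd, spiral_right_pt hα, h3]
    | left =>
      obtain ⟨X', Y', h1, h2, h3⟩ := ih X (Y - 2 * Real.tan α * s)
      refine ⟨X', Y', h1, by linarith, ?_⟩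
      rw [movesEnd, spiral_left_pt hα, h3]

/-- A right spiral followed by a left one, with the indicated increase and decrease of the two
null coordinates. -/
noncomputable def twoMoves (κ a b : ℝ) : List Move :=
  [(.right, (a / (2 * κ)).toNNReal), (.left, (b / (2 * κ)).toNNReal)]

theorem movesEnd_twoMoves (hα : 0 < Real.tan α) {X Y a b : ℝ} (ha : 0 ≤ a) (hb : 0 ≤ b) :
    movesEnd α (pt (Real.tan α) X Y) (twoMoves (Real.tan α) a b) =
      pt (Real.tan α) (X + a) (Y - b) := by
  have h : ∀ c : ℝ, 0 ≤ c → 2 * Real.tan α * ((c / (2 * Real.tan α)).toNNReal : ℝ) = c := by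
    intro c hc
    rw [Real.coe_toNNReal _ (by positivity)]
    field_simp
  rw [twoMoves, movesEnd, movesEnd, movesEnd, spiral_right_pt hα, spiral_left_pt hα, h a ha, h b hb]

theorem Arc.finish_none (p : ℂ) (l : List Move) : Arc.finish α ⟨p, l, none⟩ = movesEnd α p l := rfl

theorem Arc.finish_some (p : ℂ) (l : List Move) (d : Side) : Arc.finish α ⟨p, l, some d⟩ = 0 := rfl

theorem finish_mem_region (a : Arc) : a.finish α ∈ region α a.start := ⟨a, rfl, rfl⟩

theorem self_mem_region (p : ℂ) : p ∈ region α p := ⟨⟨p, [], none⟩, rfl, rfl⟩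

theorem zero_mem_region (p : ℂ) : (0 : ℂ) ∈ region α p := ⟨⟨p, [], some .right⟩, rfl, rfl⟩

/-- In null coordinates, a spiral region is a quadrant (together with the root). -/
theorem mem_region_pt (hα : 0 < Real.tan α) {X Y : ℝ} {q : ℂ} :
    q ∈ region α (pt (Real.tan α) X Y) ↔
      q = 0 ∨ ∃ X' Y', X ≤ X' ∧ Y' ≤ Y ∧ q = pt (Real.tan α) X' Y' := by
  constructor
  · rintro ⟨⟨p, l, o⟩, h1, h2⟩
    cases o with
    | none =>
      obtain rfl : p = _ := h1
      obtain ⟨X', Y', h3, h4, h5⟩ := movesEnd_pt hα l X Y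
      rw [Arc.finish_none] at h2
      exact Or.inr ⟨X', Y', h3, h4, by rw [← h2, h5]⟩
    | some d => exact Or.inl h2.symm
  · rintro (rfl | ⟨X', Y', h1, h2, rfl⟩)
    · exact zero_mem_region _
    · refine ⟨⟨pt (Real.tan α) X Y, twoMoves (Real.tan α) (X' - X) (Y - Y'), none⟩, rfl, ?_⟩
      rw [Arc.finish_none, movesEnd_twoMoves hα (by linarith) (by linarith)]
      congr 1 <;> ring

theorem region_zero : region α 0 = {0} := by
  ext q
  constructor
  · rintro ⟨⟨p, l, o⟩, h1, h2⟩
    obtain rfl : p = _ := h1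
    cases o with
    | none => rw [Arc.finish_none, movesEnd_zero] at h2; exact h2.symm
    | some d => exact h2.symm
  · rintro rfl
    exact zero_mem_region _

theorem region_trans (hα : 0 < Real.tan α) {p q r : ℂ} (hq : q ∈ region α p)
    (hr : r ∈ region α q) : r ∈ region α p := by
  rcases eq_or_ne p 0 with rfl | hp
  · rw [region_zero] at hq
    obtain rfl : q = 0 := hq
    exact hr
  obtain ⟨X, Y, rfl⟩ := exists_pt_eq hα hp
  rcases (mem_region_pt hα).1 hq with rfl | ⟨X', Y', h1, h2, rfl⟩
  · rw [region_zero] at hr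
    obtain rfl : r = 0 := hr
    exact zero_mem_region _
  rcases (mem_region_pt hα).1 hr with rfl | ⟨X'', Y'', h3, h4, rfl⟩
  · exact zero_mem_region _
  · exact (mem_region_pt hα).2 (Or.inr ⟨X'', Y'', h1.trans h3, h4.trans h2, rfl⟩)

theorem norm_le_of_mem_region (hα : 0 < Real.tan α) {p q : ℂ} (hq : q ∈ region α p) :
    ‖q‖ ≤ ‖p‖ := by
  rcases eq_or_ne p 0 with rfl | hp
  · rw [region_zero] at hq
    obtain rfl : q = 0 := hq
    exact le_rfl
  obtain ⟨X, Y, rfl⟩ := exists_pt_eq hα hp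
  rcases (mem_region_pt hα).1 hq with rfl | ⟨X', Y', h1, h2, rfl⟩
  · simp
  · rw [norm_pt_le_norm_pt hα]
    linarith

theorem eq_of_mem_region_of_norm_le (hα : 0 < Real.tan α) {p q : ℂ} (hq : q ∈ region α p)
    (h : ‖p‖ ≤ ‖q‖) : q = p := by
  rcases eq_or_ne p 0 with rfl | hp
  · rw [region_zero] at hq
    exact hq
  obtain ⟨X, Y, rfl⟩ := exists_pt_eq hα hp
  rcases (mem_region_pt hα).1 hq with rfl | ⟨X', Y', h1, h2, rfl⟩
  · exact absurd (norm_le_zero_iff.1 (by simpa using h)) hp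
  · rw [norm_pt_le_norm_pt hα] at h
    congr 1 <;> linarith

/-! ### Points on a spiral path -/

theorem start_mem_movesPoints (p : ℂ) (l : List Move) : p ∈ movesPoints α p l := by
  cases l with
  | nil => exact rfl
  | cons m l =>
    obtain ⟨d, s⟩ := m
    exact Or.inl ⟨0, ⟨le_rfl, s.2⟩, spiral_zero d p⟩

theorem norm_movesEnd_le (p : ℂ) (l : List Move) : ‖movesEnd α p l‖ ≤ ‖p‖ := by
  induction l generalizing p with
  | nil => exact le_rfl
  | cons m l ih =>
    obtain ⟨d, s⟩ := m
    refine (ih _).trans ?_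
    rw [norm_spiral]
    exact mul_le_of_le_one_right (norm_nonneg _) (Real.exp_le_one_iff.2 (by linarith [s.2]))

theorem norm_movesPoints {p q : ℂ} {l : List Move} (hq : q ∈ movesPoints α p l) :
    ‖movesEnd α p l‖ ≤ ‖q‖ ∧ ‖q‖ ≤ ‖p‖ := by
  induction l generalizing p with
  | nil => obtain rfl : q = p := hq; exact ⟨le_rfl, le_rfl⟩
  | cons m l ih =>
    obtain ⟨d, s⟩ := m
    have h0 := norm_movesEnd_le (α := α) (spiral α d p s) l
    rcases hq with ⟨t, ht, rfl⟩ | hq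
    · refine ⟨h0.trans ?_, ?_⟩
      · rw [norm_spiral, norm_spiral]
        gcongr
        exact ht.2
      · rw [norm_spiral]
        exact mul_le_of_le_one_right (norm_nonneg _) (Real.exp_le_one_iff.2 (by linarith [ht.1]))
    · refine ⟨(ih hq).1, (ih hq).2.trans ?_⟩
      rw [norm_spiral]
      exact mul_le_of_le_one_right (norm_nonneg _) (Real.exp_le_one_iff.2 (by linarith [s.2]))

theorem spiral_injOn_norm {p : ℂ} (hp : p ≠ 0) {d : Side} {s t : ℝ}
    (h : ‖spiral α d p s‖ = ‖spiral α d p t‖) : s = t := by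
  rw [norm_spiral, norm_spiral] at h
  have := Real.exp_injective (mul_left_cancel₀ (norm_ne_zero_iff.2 hp) h)
  linarith

theorem spiral_ne_zero {p : ℂ} (hp : p ≠ 0) (d : Side) (s : ℝ) : spiral α d p s ≠ 0 := by
  rw [← norm_ne_zero_iff, norm_spiral]
  have := norm_pos_iff.2 hp
  positivity

theorem movesEnd_ne_zero {p : ℂ} (hp : p ≠ 0) (l : List Move) : movesEnd α p l ≠ 0 := by
  induction l generalizing p with
  | nil => exact hp
  | cons m l ih => obtain ⟨d, s⟩ := m; exact ih (spiral_ne_zero hp d s)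

theorem movesPoints_norm_injOn {p : ℂ} (hp : p ≠ 0) {l : List Move} :
    Set.InjOn norm (movesPoints α p l) := by
  induction l generalizing p with
  | nil => exact Set.injOn_singleton norm p
  | cons m l ih =>
    obtain ⟨d, s⟩ := m
    have hs := spiral_ne_zero (α := α) hp d s
    -- a point of the first segment as far from the root as a later point is the joint
    have key : ∀ t ∈ Set.Icc (0 : ℝ) s, ∀ q ∈ movesPoints α (spiral α d p s) l,
        ‖spiral α d p t‖ = ‖q‖ → spiral α d p t = q := by
      intro t ht q hq h
      have h1 := (norm_movesPoints hq).2
      have h2 : ‖spiral α d p s‖ ≤ ‖spiral α d p t‖ := by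
        rw [norm_spiral, norm_spiral]
        gcongr
        exact ht.2
      have h3 : ‖spiral α d p t‖ = ‖spiral α d p s‖ := le_antisymm (h ▸ h1) h2
      rw [spiral_injOn_norm hp h3]
      exact ih hs (start_mem_movesPoints _ _) hq (h3.symm.trans h)
    rintro q (⟨t, ht, rfl⟩ | hq) q' (⟨t', ht', rfl⟩ | hq') h
    · rw [spiral_injOn_norm hp h]
    · exact key t ht q' hq' h
    · exact (key t' ht' q hq h.symm).symm
    · exact ih hs hq hq' h

theorem spiral_mem_region (d : Side) (p : ℂ) {s : ℝ} (hs : 0 ≤ s) :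
    spiral α d p s ∈ region α p :=
  ⟨⟨p, [(d, ⟨s, hs⟩)], none⟩, rfl, rfl⟩

theorem movesPoints_subset_region (hα : 0 < Real.tan α) (p : ℂ) (l : List Move) :
    movesPoints α p l ⊆ region α p := by
  induction l generalizing p with
  | nil => rintro q rfl; exact self_mem_region _
  | cons m l ih =>
    obtain ⟨d, s⟩ := m
    rintro q (⟨t, ht, rfl⟩ | hq)
    · exact spiral_mem_region d p ht.1
    · exact region_trans hα (spiral_mem_region d p s.2) (ih _ hq)

theorem exists_spiral_norm_eq {p : ℂ} (hp : p ≠ 0) (d : Side) {R : ℝ} (hR : 0 < R) (h : R ≤ ‖p‖) :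
    ∃ s, 0 ≤ s ∧ ‖spiral α d p s‖ = R := by
  have hp' := norm_pos_iff.2 hp
  refine ⟨-Real.log (R / ‖p‖), ?_, ?_⟩
  · rw [neg_nonneg]
    exact Real.log_nonpos (by positivity) ((div_le_one hp').2 h)
  · rw [norm_spiral, neg_neg, Real.exp_log (by positivity)]
    field_simp

theorem exists_movesPoints_norm_eq {p : ℂ} (hp : p ≠ 0) {l : List Move} {R : ℝ}
    (h : ‖movesEnd α p l‖ ≤ R) (h' : R ≤ ‖p‖) : ∃ q ∈ movesPoints α p l, ‖q‖ = R := by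
  induction l generalizing p with
  | nil => exact ⟨p, rfl, le_antisymm h h'⟩
  | cons m l ih =>
    obtain ⟨d, s⟩ := m
    rcases le_total R ‖spiral α d p s‖ with hs | hs
    · obtain ⟨q, hq, hqR⟩ := ih (spiral_ne_zero hp d s) h hs
      exact ⟨q, Or.inr hq, hqR⟩
    · have hR : 0 < R := (norm_pos_iff.2 (spiral_ne_zero (α := α) hp d s)).trans_le hs
      obtain ⟨t, ht, htR⟩ := exists_spiral_norm_eq (α := α) hp d hR h'
      refine ⟨_, Or.inl ⟨t, ⟨ht, ?_⟩, rfl⟩, htR⟩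
      rw [← htR, norm_spiral, norm_spiral, mul_le_mul_iff_right₀ (norm_pos_iff.2 hp),
        Real.exp_le_exp] at hs
      linarith

theorem Arc.norm_points {a : Arc} {q : ℂ} (hq : q ∈ a.points α) :
    ‖a.finish α‖ ≤ ‖q‖ ∧ ‖q‖ ≤ ‖a.start‖ := by
  obtain ⟨p, l, o⟩ := a
  rcases hq with hq | hq
  · refine ⟨?_, (norm_movesPoints hq).2⟩
    cases o with
    | none => exact (norm_movesPoints hq).1
    | some d => rw [Arc.finish_some]; simp
  · cases o with
    | none => exact hq.elim
    | some d =>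
      rw [Arc.finish_some]
      refine ⟨by simp, ?_⟩
      rcases hq with rfl | ⟨t, ht, rfl⟩
      · simp
      · rw [norm_spiral]
        exact (mul_le_of_le_one_right (norm_nonneg _)
          (Real.exp_le_one_iff.2 (by linarith [Set.mem_Ici.1 ht]))).trans
          (norm_movesEnd_le p l)

theorem movesEnd_mem_movesPoints (p : ℂ) (l : List Move) :
    movesEnd α p l ∈ movesPoints α p l := by
  induction l generalizing p with
  | nil => exact rfl
  | cons m l ih => obtain ⟨d, s⟩ := m; exact Or.inr (ih _)

/-- A spiral path meets every circle about the root at most once. -/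
theorem Arc.points_norm_injOn {a : Arc} (ha : a.start ≠ 0) :
    Set.InjOn norm (a.points α) := by
  obtain ⟨p, l, o⟩ := a
  have hp : p ≠ 0 := ha
  cases o with
  | none =>
    have : Arc.points α ⟨p, l, none⟩ = movesPoints α p l := by simp [Arc.points]
    rw [this]
    exact movesPoints_norm_injOn hp
  | some d =>
    have he := movesEnd_ne_zero (α := α) hp l
    have key : ∀ q ∈ movesPoints α p l, ∀ t ∈ Set.Ici (0 : ℝ),
        ‖q‖ = ‖spiral α d (movesEnd α p l) t‖ → q = spiral α d (movesEnd α p l) t := by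
      intro q hq t ht h
      have h1 := (norm_movesPoints hq).1
      have h0 : ‖spiral α d (movesEnd α p l) 0‖ = ‖spiral α d (movesEnd α p l) t‖ := by
        apply le_antisymm
        · rw [spiral_zero, ← h]; exact h1
        · rw [norm_spiral, norm_spiral]
          gcongr
          exact ht
      have h2 := spiral_injOn_norm he h0
      subst h2
      rw [spiral_zero] at h ⊢
      exact movesPoints_norm_injOn hp hq (movesEnd_mem_movesPoints p l) h
    have key0 : ∀ q ∈ movesPoints α p l, ‖q‖ ≠ 0 := fun q hq =>
      ((norm_pos_iff.2 he).trans_le (norm_movesPoints hq).1).ne'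
    rintro q (hq | rfl | ⟨t, ht, rfl⟩) q' (hq' | rfl | ⟨t', ht', rfl⟩) h
    · exact movesPoints_norm_injOn hp hq hq' h
    · exact absurd (h.trans norm_zero) (key0 q hq)
    · exact key q hq t' ht' h
    · exact absurd (h.symm.trans norm_zero) (key0 q' hq')
    · rfl
    · exact absurd (h.symm.trans norm_zero) (norm_ne_zero_iff.2 (spiral_ne_zero he d t'))
    · exact (key q' hq' t ht h.symm).symm
    · exact absurd (h.trans norm_zero) (norm_ne_zero_iff.2 (spiral_ne_zero he d t))
    · rw [spiral_injOn_norm he h]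

theorem Arc.exists_point {a : Arc} (hα : 0 < Real.tan α) (ha : a.start ≠ 0) {R : ℝ} (hR : 0 < R)
    (h : ‖a.finish α‖ ≤ R) (h' : R ≤ ‖a.start‖) :
    ∃ q ∈ a.points α, ‖q‖ = R ∧ q ∈ region α a.start := by
  obtain ⟨p, l, o⟩ := a
  have hp : p ≠ 0 := ha
  rcases le_total ‖movesEnd α p l‖ R with he | he
  · obtain ⟨q, hq, hqR⟩ := exists_movesPoints_norm_eq hp he h'
    exact ⟨q, Or.inl hq, hqR, movesPoints_subset_region hα p l hq⟩
  · cases o with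
    | none =>
      obtain ⟨q, hq, hqR⟩ := exists_movesPoints_norm_eq (α := α) hp (l := l) h h'
      exact ⟨q, Or.inl hq, hqR, movesPoints_subset_region hα p l hq⟩
    | some d =>
      obtain ⟨s, hs, hsR⟩ := exists_spiral_norm_eq (α := α) (movesEnd_ne_zero hp l) d hR he
      exact ⟨_, Or.inr (Or.inr ⟨s, hs, rfl⟩), hsR, region_trans hα
        (movesPoints_subset_region hα p l (movesEnd_mem_movesPoints p l)) (spiral_mem_region _ _ hs)⟩

theorem Arc.finish_mem_points (a : Arc) : a.finish α ∈ a.points α := by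
  obtain ⟨p, l, o⟩ := a
  cases o with
  | none => exact Or.inl (movesEnd_mem_movesPoints p l)
  | some d => exact Or.inr (Or.inl rfl)

theorem Arc.norm_finish_le (a : Arc) : ‖a.finish α‖ ≤ ‖a.start‖ :=
  (Arc.norm_points a.finish_mem_points).2

/-! ### Arc lengths -/

/-- The right spiral that starts at `1`. -/
noncomputable def unitSpiral (α s : ℝ) : ℂ := Complex.exp ((-1 + Real.tan α * Complex.I) * s)

theorem spiral_right_eq (p : ℂ) : spiral α .right p = fun s => p * unitSpiral α s := by
  funext s
  rw [spiral, unitSpiral, mul_assoc, Complex.ofReal_exp, ← Complex.exp_add]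
  congr 2
  simp [Side.sign]
  ring

theorem spiral_left_eq (p : ℂ) :
    spiral α .left p = fun s => p * (starRingEnd ℂ) (unitSpiral α s) := by
  funext s
  rw [spiral, unitSpiral, mul_assoc, Complex.ofReal_exp, ← Complex.exp_add, ← Complex.exp_conj]
  generalize Real.tan α = κ
  congr 2
  simp [Side.sign]
  ring

theorem unitSpiral_add (s t : ℝ) : unitSpiral α (s + t) = unitSpiral α s * unitSpiral α t := by
  rw [unitSpiral, unitSpiral, unitSpiral, ← Complex.exp_add]
  congr 1
  push_cast
  ring

theorem eVariationOn_const_mul (c : ℂ) (f : ℝ → ℂ) (s : Set ℝ) :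
    eVariationOn (fun x => c * f x) s = ‖c‖ₑ * eVariationOn f s := by
  simp only [eVariationOn, ENNReal.mul_iSup, Finset.mul_sum, edist_eq_enorm_sub, ← mul_sub, enorm_mul]

theorem eVariationOn_conj (f : ℝ → ℂ) (s : Set ℝ) :
    eVariationOn (fun x => (starRingEnd ℂ) (f x)) s = eVariationOn f s := by
  simp only [eVariationOn, edist_eq_enorm_sub, ← map_sub]
  simp only [← ofReal_norm, Complex.norm_conj]

theorem eVariationOn_spiral (d : Side) (p : ℂ) (s : Set ℝ) :
    eVariationOn (spiral α d p) s = ‖p‖ₑ * eVariationOn (unitSpiral α) s := by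
  cases d with
  | right => rw [spiral_right_eq, eVariationOn_const_mul]
  | left => rw [spiral_left_eq, eVariationOn_const_mul, eVariationOn_conj]

theorem enorm_unitSpiral (s : ℝ) : ‖unitSpiral α s‖ₑ = ENNReal.ofReal (Real.exp (-s)) := by
  rw [← ofReal_norm, unitSpiral, Complex.norm_exp]
  simp

theorem eVariationOn_unitSpiral_add {s t : ℝ} (hs : 0 ≤ s) (ht : 0 ≤ t) :
    eVariationOn (unitSpiral α) (Set.Icc 0 (s + t)) =
      eVariationOn (unitSpiral α) (Set.Icc 0 s) +
        ENNReal.ofReal (Real.exp (-s)) * eVariationOn (unitSpiral α) (Set.Icc 0 t) := by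
  have h1 := eVariationOn.Icc_add_Icc (unitSpiral α) (s := Set.univ) (a := 0) (b := s) (c := s + t)
    hs (by linarith) trivial
  simp only [Set.univ_inter] at h1
  rw [← h1, ← enorm_unitSpiral, ← eVariationOn_const_mul]
  congr 1
  have h2 := eVariationOn.comp_eq_of_monotoneOn (unitSpiral α) (t := Set.Icc 0 t) (fun x => s + x)
    (fun x _ y _ h => by simpa using h)
  rw [Set.image_const_add_Icc, add_zero] at h2
  rw [← h2]
  congr 1
  funext x
  exact unitSpiral_add s x

theorem eVariationOn_unitSpiral_ne_top (s : ℝ) :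
    eVariationOn (unitSpiral α) (Set.Icc 0 s) ≠ ⊤ := by
  set c : ℂ := -1 + Real.tan α * Complex.I with hc
  have hder : ∀ x : ℝ, HasDerivAt (unitSpiral α) (Complex.exp (c * x) * c) x := by
    intro x
    have h1 : HasDerivAt (fun x : ℝ => c * (x : ℂ)) c x := by
      simpa using (Complex.ofRealCLM.hasDerivAt (x := x)).const_mul c
    exact h1.cexp
  have hL : LipschitzOnWith ‖c‖₊ (unitSpiral α) (Set.Icc 0 s) := by
    refine (convex_Icc 0 s).lipschitzOnWith_of_nnnorm_hasDerivWithin_le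
      (fun x _ => (hder x).hasDerivWithinAt) fun x hx => ?_
    rw [nnnorm_mul]
    refine mul_le_of_le_one_left zero_le ?_
    rw [← NNReal.coe_le_coe, coe_nnnorm, Complex.norm_exp]
    simpa [hc] using hx.1
  have := hL.comp_eVariationOn_le (g := id) (s := Set.Icc 0 s) (fun x hx => hx)
  rw [eVariationOn_id_Icc] at this
  exact ne_top_of_le_ne_top (by finiteness) this

/-- The ratio between the arc length and the radial extent of a spiral segment. -/
noncomputable def stretch (α : ℝ) : ℝ :=
  (eVariationOn (unitSpiral α) (Set.Icc 0 1)).toReal / (1 - Real.exp (-1))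

theorem stretch_nonneg : 0 ≤ stretch α :=
  div_nonneg ENNReal.toReal_nonneg (by simp)

/-- By self-similarity, the arc length is proportional to the radial extent: the length `f s` of
the spiral up to the parameter `s` satisfies `f (s + t) = f s + exp (-s) * f t`, and exchanging
`s` and `t` determines `f` up to a factor. -/
theorem eVariationOn_unitSpiral {s : ℝ} (hs : 0 ≤ s) :
    eVariationOn (unitSpiral α) (Set.Icc 0 s) =
      ENNReal.ofReal (stretch α * (1 - Real.exp (-s))) := by
  have h1 := eVariationOn_unitSpiral_add (α := α) hs zero_le_one
  have h2 := eVariationOn_unitSpiral_add (α := α) zero_le_one hs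
  rw [add_comm 1 s, h1] at h2
  have ha := eVariationOn_unitSpiral_ne_top (α := α) s
  have hb := eVariationOn_unitSpiral_ne_top (α := α) 1
  rw [← ENNReal.ofReal_toReal ha, ← ENNReal.ofReal_toReal hb,
    ← ENNReal.ofReal_mul (Real.exp_pos _).le, ← ENNReal.ofReal_mul (Real.exp_pos _).le,
    ← ENNReal.ofReal_add (by positivity) (by positivity),
    ← ENNReal.ofReal_add (by positivity) (by positivity),
    ENNReal.ofReal_eq_ofReal_iff (by positivity) (by positivity)] at h2
  rw [← ENNReal.ofReal_toReal ha]
  congr 1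
  have h3 : (1 : ℝ) - Real.exp (-1) ≠ 0 := by
    have : Real.exp (-1) < 1 := by simp
    linarith
  rw [stretch]
  field_simp
  linarith

theorem eVariationOn_unitSpiral_Ici :
    eVariationOn (unitSpiral α) (Set.Ici 0) = ENNReal.ofReal (stretch α) := by
  have hfin : eVariationOn (unitSpiral α) (Set.Ici 0) ≤ ENNReal.ofReal (stretch α) := by
    rw [eVariationOn.eq_biSup_inter_Icc]
    refine iSup₂_le fun x hx => ?_
    refine (eVariationOn.mono (s := Set.Icc 0 x.2) _ fun y hy => ?_).trans ?_
    · exact ⟨hy.1, hy.2.2⟩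
    rw [eVariationOn_unitSpiral (hx.2.1)]
    refine ENNReal.ofReal_le_ofReal (mul_le_of_le_one_right stretch_nonneg ?_)
    linarith [Real.exp_pos (-x.2)]
  refine le_antisymm hfin ?_
  have h : ∀ s : ℝ, 0 ≤ s → ENNReal.ofReal (stretch α * (1 - Real.exp (-s))) ≤
      eVariationOn (unitSpiral α) (Set.Ici 0) := fun s hs => by
    rw [← eVariationOn_unitSpiral hs]
    exact eVariationOn.mono _ Set.Icc_subset_Ici_self
  have ht : Filter.Tendsto (fun s : ℝ => ENNReal.ofReal (stretch α * (1 - Real.exp (-s))))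
      Filter.atTop (nhds (ENNReal.ofReal (stretch α * (1 - 0)))) := by
    refine ENNReal.tendsto_ofReal ((tendsto_const_nhds.sub ?_).const_mul _)
    exact Real.tendsto_exp_atBot.comp Filter.tendsto_neg_atTop_atBot
  rw [sub_zero, mul_one] at ht
  exact le_of_tendsto ht (Filter.eventually_atTop.2 ⟨0, fun s hs => h s hs⟩)

theorem movesLength_eq (p : ℂ) (l : List Move) :
    movesLength α p l = ENNReal.ofReal (stretch α * (‖p‖ - ‖movesEnd α p l‖)) := by
  induction l generalizing p with
  | nil => simp [movesLength, movesEnd]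
  | cons m l ih =>
    obtain ⟨d, s⟩ := m
    have h1 : ‖movesEnd α (spiral α d p s) l‖ ≤ ‖spiral α d p s‖ :=
      norm_movesEnd_le _ _
    have h2 : ‖spiral α d p s‖ = ‖p‖ * Real.exp (-s) := norm_spiral d p s
    have h3 : (0 : ℝ) ≤ 1 - Real.exp (-s) := by simp
    have h4 := stretch_nonneg (α := α)
    rw [movesLength, ih, eVariationOn_spiral, eVariationOn_unitSpiral (NNReal.coe_nonneg s), ← ofReal_norm,
      ← ENNReal.ofReal_mul (norm_nonneg _), ← ENNReal.ofReal_add (by positivity)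
        (mul_nonneg h4 (by linarith)), movesEnd]
    congr 1
    rw [h2]
    ring

theorem Arc.length_eq (a : Arc) :
    a.length α = ENNReal.ofReal (stretch α * (‖a.start‖ - ‖a.finish α‖)) := by
  obtain ⟨p, l, o⟩ := a
  rw [Arc.length, movesLength_eq]
  cases o with
  | none => simp [Arc.finish_none]
  | some d =>
    have h1 : ‖movesEnd α p l‖ ≤ ‖p‖ := norm_movesEnd_le _ _
    simp only [Arc.finish_some]
    rw [eVariationOn_spiral, eVariationOn_unitSpiral_Ici, ← ofReal_norm,
      ← ENNReal.ofReal_mul (norm_nonneg _), ← ENNReal.ofReal_add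
        (mul_nonneg stretch_nonneg (by linarith)) (mul_nonneg (norm_nonneg _) stretch_nonneg)]
    congr 1
    simp
    ring

end Geometry

/-! ### Crossings of a circle -/

section Crossings

variable {α : ℝ}

/-- The arcs of `T` that reach from the circle of radius `R` (or from outside) to its interior. -/
noncomputable def crossing (α R : ℝ) (T : Finset Arc) : Finset Arc :=
  T.filter fun a => ‖a.finish α‖ < R ∧ R ≤ ‖a.start‖

/-- Induction over a finite set in the order of decreasing values of a function. -/
theorem finset_strong_induction {β : Type*} (T : Finset β) (f : β → ℝ) (P : β → Prop)
    (h : ∀ a ∈ T, (∀ b ∈ T, f a < f b → P b) → P a) : ∀ a ∈ T, P a := by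
  classical
  by_contra! hc
  obtain ⟨a, ha, hPa⟩ := hc
  obtain ⟨m, hm, hmax⟩ := Finset.exists_max_image (T.filter fun b => ¬ P b) f
    ⟨a, Finset.mem_filter.2 ⟨ha, hPa⟩⟩
  rw [Finset.mem_filter] at hm
  refine hm.2 (h m hm.1 fun b hb hlt => ?_)
  by_contra hPb
  exact absurd (hmax b (Finset.mem_filter.2 ⟨hb, hPb⟩)) (not_le.2 hlt)

theorem IsSpiralTree.start_ne_zero {S : Finset ℂ} {T : Finset Arc} (hT : IsSpiralTree α S T)
    {a : Arc} (ha : a ∈ T) : a.start ≠ 0 := by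
  intro h
  have h1 := finish_mem_region (α := α) a
  rw [h, region_zero] at h1
  exact hT.nondegenerate a ha (h1.trans h.symm)

theorem IsSpiralTree.norm_finish_lt (hα : 0 < Real.tan α) {S : Finset ℂ} {T : Finset Arc}
    (hT : IsSpiralTree α S T) {a : Arc} (ha : a ∈ T) : ‖a.finish α‖ < ‖a.start‖ := by
  by_contra h
  exact hT.nondegenerate a ha (eq_of_mem_region_of_norm_le hα (finish_mem_region a) (not_lt.1 h))

theorem encard_sphere_inter_treePoints_le (hα : 0 < Real.tan α) {S : Finset ℂ} {T : Finset Arc}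
    (hT : IsSpiralTree α S T) {R : ℝ} (hR : 0 < R) :
    (Metric.sphere (0 : ℂ) R ∩ treePoints α T).encard ≤ (crossing α R T).card := by
  classical
  have hsub : Metric.sphere (0 : ℂ) R ∩ treePoints α T ⊆
      ⋃ a ∈ crossing α R T, (Metric.sphere (0 : ℂ) R ∩ a.points α) := by
    rintro q ⟨hqR, hq⟩
    have hqn : ‖q‖ = R := by simpa using hqR
    simp only [treePoints, Set.mem_iUnion] at hq
    obtain ⟨a, ha, hqa⟩ := hq
    have h1 := Arc.norm_points hqa
    simp only [Set.mem_iUnion]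
    rcases h1.1.lt_or_eq with h2 | h2
    · exact ⟨a, Finset.mem_filter.2 ⟨ha, hqn ▸ h2, hqn ▸ h1.2⟩, hqR, hqa⟩
    · -- a point at the end of its arc is the start of another arc
      have h3 : q = a.finish α :=
        Arc.points_norm_injOn (hT.start_ne_zero ha) hqa a.finish_mem_points h2.symm
      rcases hT.parent a ha with h4 | ⟨b, hb, hba⟩
      · rw [← h3] at h4
        rw [h4, norm_zero] at hqn
        exact absurd hqn hR.ne
      · have h5 := hT.norm_finish_lt hα hb
        rw [← h3] at hba
        rw [hba, hqn] at h5
        refine ⟨b, Finset.mem_filter.2 ⟨hb, h5, by rw [hba, hqn]⟩, hqR, ?_⟩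
        rw [← hba]
        exact Or.inl (start_mem_movesPoints _ _)
  refine (Set.encard_le_encard hsub).trans ?_
  have hone : ∀ a ∈ crossing α R T, (Metric.sphere (0 : ℂ) R ∩ a.points α).encard ≤ 1 := by
    intro a ha
    rw [Set.encard_le_one_iff]
    rintro x y ⟨hx, hx'⟩ ⟨hy, hy'⟩
    refine Arc.points_norm_injOn (hT.start_ne_zero (Finset.mem_filter.1 ha).1) hx' hy' ?_
    rw [mem_sphere_zero_iff_norm.1 hx, mem_sphere_zero_iff_norm.1 hy]
  have : ∀ W : Finset Arc, (∀ a ∈ W, (Metric.sphere (0 : ℂ) R ∩ a.points α).encard ≤ 1) →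
      (⋃ a ∈ W, (Metric.sphere (0 : ℂ) R ∩ a.points α)).encard ≤ W.card := by
    intro W
    induction W using Finset.induction_on with
    | empty => simp
    | insert a W ha ih =>
      intro h
      rw [Finset.set_biUnion_insert, Finset.card_insert_of_notMem ha, Nat.cast_add, add_comm]
      refine (Set.encard_union_le _ _).trans (add_le_add (by simpa using h a (by simp)) ?_)
      exact ih fun b hb => h b (by simp [hb])
  exact this _ hone

/-- In a spiral tree, the path from a node to the root meets every smaller circle. -/
theorem IsSpiralTree.exists_point (hα : 0 < Real.tan α) {S : Finset ℂ} {T : Finset Arc}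
    (hT : IsSpiralTree α S T) {R : ℝ} (hR : 0 < R) {t : ℂ} (ht : t ∈ S) (htR : R ≤ ‖t‖) :
    ∃ q ∈ Metric.sphere (0 : ℂ) R ∩ treePoints α T, q ∈ region α t := by
  obtain ⟨a, ha, rfl⟩ := hT.terminal t ht
  refine finset_strong_induction T (fun a => -‖a.start‖) (fun a => R ≤ ‖a.start‖ →
    ∃ q ∈ Metric.sphere (0 : ℂ) R ∩ treePoints α T, q ∈ region α a.start) ?_ a ha htR
  intro a ha ih haR
  rcases le_or_gt ‖a.finish α‖ R with h | h
  · obtain ⟨q, hq, hqR, hqa⟩ := Arc.exists_point hα (hT.start_ne_zero ha) hR h haR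
    exact ⟨q, ⟨by simpa using hqR, Set.mem_biUnion ha hq⟩, hqa⟩
  · rcases hT.parent a ha with h0 | ⟨b, hb, hba⟩
    · rw [h0, norm_zero] at h
      exact absurd h (not_lt.2 hR.le)
    · have hlt := hT.norm_finish_lt hα ha
      obtain ⟨q, hq, hqb⟩ := ih b hb (by simpa [hba] using hlt) (by rw [hba]; exact h.le)
      rw [hba] at hqb
      exact ⟨q, hq, region_trans hα (finish_mem_region a) hqb⟩

/-- Every arc crosses the circles between its endpoints, so the length of a tree is an integral
over the radii of the number of crossing arcs. -/
theorem treeLength_eq_lintegral (T : Finset Arc) :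
    treeLength α T = ENNReal.ofReal (stretch α) *
      ∫⁻ R in Set.Ioi (0 : ℝ), ((crossing α R T).card : ℝ≥0∞) := by
  classical
  have h1 : ∀ a : Arc, a.length α = ENNReal.ofReal (stretch α) *
      ∫⁻ R in Set.Ioi (0 : ℝ), (Set.Ioc ‖a.finish α‖ ‖a.start‖).indicator 1 R := by
    intro a
    rw [Arc.length_eq, MeasureTheory.lintegral_indicator_one measurableSet_Ioc,
      MeasureTheory.Measure.restrict_apply measurableSet_Ioc,
      Set.inter_eq_left.2 (Set.Ioc_subset_Ioi_self.trans (Set.Ioi_subset_Ioi (norm_nonneg _))),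
      Real.volume_Ioc, ENNReal.ofReal_mul stretch_nonneg]
  have h2 : ∀ R : ℝ, ((crossing α R T).card : ℝ≥0∞) =
      ∑ a ∈ T, (Set.Ioc ‖a.finish α‖ ‖a.start‖).indicator (1 : ℝ → ℝ≥0∞) R := by
    intro R
    rw [crossing, Finset.card_filter]
    push_cast
    refine Finset.sum_congr rfl fun a _ => ?_
    simp [Set.indicator_apply]
  simp_rw [treeLength, h1, h2]
  rw [MeasureTheory.lintegral_finsetSum _ fun a _ => measurable_one.indicator measurableSet_Ioc,
    Finset.mul_sum]

end Crossings

/-! ### Properties of greedy trees -/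

section Greedy

variable {α : ℝ} {S : Finset ℂ}

theorem exists_common_point (hα : 0 < Real.tan α) {u v : ℂ} (hu : u ≠ 0) (hv : v ≠ 0) :
    ∃ q, q ≠ 0 ∧ q ∈ region α u ∩ region α v := by
  obtain ⟨X, Y, rfl⟩ := exists_pt_eq hα hu
  obtain ⟨X', Y', rfl⟩ := exists_pt_eq hα hv
  exact ⟨pt _ (max X X') (min Y Y'), pt_ne_zero _ _ _,
    (mem_region_pt hα).2 (Or.inr ⟨_, _, le_max_left _ _, min_le_left _ _, rfl⟩),
    (mem_region_pt hα).2 (Or.inr ⟨_, _, le_max_right _ _, min_le_right _ _, rfl⟩)⟩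

theorem IsJoinPoint.ne_zero (hα : 0 < Real.tan α) {u v p : ℂ} (hu : u ≠ 0) (hv : v ≠ 0)
    (hp : IsJoinPoint α u v p) : p ≠ 0 := by
  obtain ⟨q, hq0, hq⟩ := exists_common_point hα hu hv
  have h1 := hp.2 q hq
  rintro rfl
  exact hq0 (norm_le_zero_iff.1 (by simpa using h1))

theorem mem_region_inter_region_iff (hα : 0 < Real.tan α) {X Y X' Y' : ℝ} {q : ℂ} :
    q ∈ region α (pt (Real.tan α) X Y) ∩ region α (pt (Real.tan α) X' Y') ↔
      q = 0 ∨ ∃ (k : ℤ) (X₁ Y₁ : ℝ), max X (X' + k * (2 * Real.pi)) ≤ X₁ ∧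
        Y₁ ≤ min Y (Y' + k * (2 * Real.pi)) ∧ q = pt (Real.tan α) X₁ Y₁ := by
  constructor
  · rintro ⟨h1, h2⟩
    rcases (mem_region_pt hα).1 h1 with h | ⟨X₁, Y₁, h3, h4, rfl⟩
    · exact Or.inl h
    rcases (mem_region_pt hα).1 h2 with h | ⟨X₂, Y₂, h5, h6, h7⟩
    · exact Or.inl h
    obtain ⟨k, rfl, rfl⟩ := (pt_eq_pt_iff hα).1 h7
    exact Or.inr ⟨k, _, _, max_le h3 (by linarith), le_min h4 (by linarith), rfl⟩
  · rintro (rfl | ⟨k, X₁, Y₁, h1, h2, rfl⟩)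
    · exact ⟨zero_mem_region _, zero_mem_region _⟩
    · refine ⟨(mem_region_pt hα).2 (Or.inr ⟨X₁, Y₁, (le_max_left _ _).trans h1,
        h2.trans (min_le_left _ _), rfl⟩), ?_⟩
      rw [← pt_add_int_mul hα X' Y' k]
      exact (mem_region_pt hα).2 (Or.inr ⟨X₁, Y₁, (le_max_right _ _).trans h1,
        h2.trans (min_le_right _ _), rfl⟩)

theorem exists_isJoinPoint (hα : 0 < Real.tan α) {u v : ℂ} (hu : u ≠ 0) (hv : v ≠ 0) :
    ∃ p, IsJoinPoint α u v p := by
  obtain ⟨X, Y, rfl⟩ := exists_pt_eq hα hu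
  obtain ⟨X', Y', rfl⟩ := exists_pt_eq hα hv
  set f : ℤ → ℝ := fun k =>
    max X (X' + k * (2 * Real.pi)) - min Y (Y' + k * (2 * Real.pi)) with hf
  have hpi := Real.pi_pos
  have h1 : Filter.Tendsto f Filter.cofinite Filter.atTop := by
    rw [Int.cofinite_eq]
    refine Filter.Tendsto.sup ?_ ?_
    · have h2 : Filter.Tendsto (fun k : ℤ => (X - Y') + -(k : ℝ) * (2 * Real.pi))
          Filter.atBot Filter.atTop :=
        Filter.tendsto_atTop_add_const_left _ _ (Filter.Tendsto.atTop_mul_const (by positivity)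
          (Filter.tendsto_neg_atBot_atTop.comp (tendsto_intCast_atBot_iff.2 Filter.tendsto_id)))
      refine Filter.tendsto_atTop_mono (fun k => ?_) h2
      have := le_max_left X (X' + k * (2 * Real.pi))
      have := min_le_right Y (Y' + k * (2 * Real.pi))
      simp only [hf]
      linarith
    · have h2 : Filter.Tendsto (fun k : ℤ => (X' - Y) + (k : ℝ) * (2 * Real.pi))
          Filter.atTop Filter.atTop :=
        Filter.tendsto_atTop_add_const_left _ _ (Filter.Tendsto.atTop_mul_const (by positivity)
          tendsto_intCast_atTop_atTop)
      refine Filter.tendsto_atTop_mono (fun k => ?_) h2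
      have := le_max_right X (X' + k * (2 * Real.pi))
      have := min_le_left Y (Y' + k * (2 * Real.pi))
      simp only [hf]
      linarith
  obtain ⟨k, hk⟩ := h1.exists_forall_le
  refine ⟨pt _ (max X (X' + k * (2 * Real.pi))) (min Y (Y' + k * (2 * Real.pi))),
    (mem_region_inter_region_iff hα).2 (Or.inr ⟨k, _, _, le_rfl, le_rfl, rfl⟩), fun q hq => ?_⟩
  rcases (mem_region_inter_region_iff hα).1 hq with rfl | ⟨j, X₁, Y₁, h3, h4, rfl⟩
  · simp
  · rw [norm_pt_le_norm_pt hα]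
    have := hk j
    simp only [hf] at this
    linarith

/-- A join point other than the two nodes lies on the right spiral of one of them and on the left
spiral of the other. -/
theorem IsJoinPoint.exists_spirals (hα : 0 < Real.tan α) {u v p : ℂ} (hu : u ≠ 0) (hv : v ≠ 0)
    (hp : IsJoinPoint α u v p) (hpu : u ≠ p) (hpv : v ≠ p) :
    ∃ s t : ℝ, (spiral α .right u s = p ∧ spiral α .left v t = p) ∨
      (spiral α .right v s = p ∧ spiral α .left u t = p) := by
  have hp0 := hp.ne_zero hα hu hv
  have h2κ : (2 : ℝ) * Real.tan α ≠ 0 := by positivity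
  obtain ⟨Xu, Yu, rfl⟩ := exists_pt_eq hα hu
  obtain ⟨Xv, Yv, rfl⟩ := exists_pt_eq hα hv
  rcases (mem_region_pt hα).1 hp.1.1 with h | ⟨X, Y, h1, h2, rfl⟩
  · exact absurd h hp0
  rcases (mem_region_pt hα).1 hp.1.2 with h | ⟨X', Y', h3, h4, h5⟩
  · exact absurd h hp0
  obtain ⟨k, rfl, rfl⟩ := (pt_eq_pt_iff hα).1 h5
  rw [← pt_add_int_mul hα Xv Yv k] at hp hpv ⊢
  set V := Xv + k * (2 * Real.pi)
  set V' := Yv + k * (2 * Real.pi)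
  set X := X' + k * (2 * Real.pi)
  set Y := Y' + k * (2 * Real.pi)
  have h3 : V ≤ X := by simp only [V, X]; linarith
  have h4 : Y ≤ V' := by simp only [V', Y]; linarith
  have hmax := hp.2 (pt _ (max Xu V) (min Yu V'))
    ⟨(mem_region_pt hα).2 (Or.inr ⟨_, _, le_max_left _ _, min_le_left _ _, rfl⟩),
      (mem_region_pt hα).2 (Or.inr ⟨_, _, le_max_right _ _, min_le_right _ _, rfl⟩)⟩
  rw [norm_pt_le_norm_pt hα] at hmax
  have hX : X = max Xu V := by
    have := max_le h1 h3
    have := le_min h2 h4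
    linarith
  have hY : Y = min Yu V' := by
    have := max_le h1 h3
    have := le_min h2 h4
    linarith
  have hr : ∀ a b c : ℝ, spiral α .right (pt (Real.tan α) a b) ((c - a) / (2 * Real.tan α)) =
      pt (Real.tan α) c b := fun a b c => by
    rw [spiral_right_pt hα, mul_div_cancel₀ _ h2κ, add_sub_cancel]
  have hl : ∀ a b c : ℝ, spiral α .left (pt (Real.tan α) a b) ((b - c) / (2 * Real.tan α)) =
      pt (Real.tan α) a c := fun a b c => by
    rw [spiral_left_pt hα, mul_div_cancel₀ _ h2κ, sub_sub_cancel]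
  rcases le_total Xu V with hx | hx <;> rcases le_total Yu V' with hy | hy
  · rw [max_eq_right hx] at hX
    rw [min_eq_left hy] at hY
    exact ⟨_, _, Or.inl ⟨by rw [hX, hY]; exact hr Xu Yu V, by rw [hX, hY]; exact hl V V' Yu⟩⟩
  · rw [max_eq_right hx] at hX
    rw [min_eq_right hy] at hY
    exact absurd (by rw [hX, hY]) hpv
  · rw [max_eq_left hx] at hX
    rw [min_eq_left hy] at hY
    exact absurd (by rw [hX, hY]) hpu
  · rw [max_eq_left hx] at hX
    rw [min_eq_right hy] at hY
    exact ⟨_, _, Or.inr ⟨by rw [hX, hY]; exact hr V V' Xu, by rw [hX, hY]; exact hl Xu Yu V'⟩⟩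

/-- The node `p` is a terminal, or two arcs of `E` lead to it from points on whose right and left
spirals it lies. -/
def IsTip (α : ℝ) (S : Finset ℂ) (E : Finset Arc) (p : ℂ) : Prop :=
  p ∈ S ∨ ((∃ b ∈ E, b.finish α = p ∧ ∃ s, spiral α .right b.start s = p) ∧
    ∃ b ∈ E, b.finish α = p ∧ ∃ s, spiral α .left b.start s = p)

theorem IsTip.mono {E F : Finset Arc} (h : E ⊆ F) {p : ℂ} (hp : IsTip α S E p) :
    IsTip α S F p := by
  rcases hp with hp | ⟨⟨b, hb, hb'⟩, c, hc, hc'⟩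
  · exact Or.inl hp
  · exact Or.inr ⟨⟨b, h hb, hb'⟩, c, h hc, hc'⟩

/-- The properties of the forests of the greedy algorithm. The last two say that joins are made in
the order of their distances from the root: two regions of nodes with arcs do not meet outside the
circle through the farther one of the two endpoints, and the region of a node with an arc and that
of an active node do not meet outside the circle through the endpoint of the arc. -/
structure ForestInv (α : ℝ) (S A : Finset ℂ) (E : Finset Arc) : Prop where
  ne_zero : ∀ u ∈ A, u ≠ 0
  start_ne_zero : ∀ a ∈ E, a.start ≠ 0
  nondegenerate : ∀ a ∈ E, a.finish α ≠ a.start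
  start_injOn : Set.InjOn Arc.start (E : Set Arc)
  start_notMem : ∀ a ∈ E, a.start ∉ A
  terminal : ∀ t ∈ S, t ∈ A ∨ ∃ a ∈ E, a.start = t
  parent : ∀ a ∈ E, a.finish α ∈ A ∨ ∃ b ∈ E, b.start = a.finish α
  tip_active : ∀ u ∈ A, IsTip α S E u
  tip_start : ∀ a ∈ E, IsTip α S E a.start
  norm_le : ∀ a ∈ E, ∀ b ∈ E, a ≠ b → ∀ q ∈ region α a.start ∩ region α b.start,
    ‖q‖ ≤ max ‖a.finish α‖ ‖b.finish α‖
  norm_le_active : ∀ a ∈ E, ∀ u ∈ A, ∀ q ∈ region α a.start ∩ region α u, ‖q‖ ≤ ‖a.finish α‖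

theorem mem_of_isLink {u p : ℂ} {F : Finset Arc} (hF : IsLink α u p F) {a : Arc} (ha : a ∈ F) :
    a.start = u ∧ a.finish α = p ∧ u ≠ p ∧ F = {a} := by
  rcases hF with ⟨_, rfl⟩ | ⟨hup, b, h1, h2, rfl⟩
  · simp at ha
  · obtain rfl := Finset.mem_singleton.1 ha
    exact ⟨h1, h2, hup, rfl⟩

theorem exists_of_isLink {u p : ℂ} {F : Finset Arc} (hF : IsLink α u p F) (h : u ≠ p) :
    ∃ a ∈ F, a.start = u ∧ a.finish α = p := by
  rcases hF with ⟨h', _⟩ | ⟨_, b, h1, h2, rfl⟩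
  · exact absurd h' h
  · exact ⟨b, Finset.mem_singleton_self _, h1, h2⟩

theorem GreedyForest.inv (hα : 0 < Real.tan α) (hS : (0 : ℂ) ∉ S) {A : Finset ℂ} {E : Finset Arc}
    (h : GreedyForest α S A E) : ForestInv α S A E := by
  classical
  induction h with
  | init =>
    refine ⟨fun u hu h0 => hS (h0 ▸ hu), ?_, ?_, ?_, ?_, fun t ht => Or.inl ht, ?_,
      fun u hu => Or.inl hu, ?_, ?_, ?_⟩ <;> simp
  | @join A E F G u v p _ hu hv huv hp farthest hF hG ih =>
    have hu0 := ih.ne_zero u hu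
    have hv0 := ih.ne_zero v hv
    have hp0 := hp.ne_zero hα hu0 hv0
    -- the new arcs
    have hnew : ∀ a ∈ F ∪ G, (a.start = u ∨ a.start = v) ∧ a.finish α = p ∧ a.start ≠ p := by
      intro a ha
      rcases Finset.mem_union.1 ha with ha | ha
      · obtain ⟨h1, h2, h3, _⟩ := mem_of_isLink hF ha
        exact ⟨Or.inl h1, h2, h1 ▸ h3⟩
      · obtain ⟨h1, h2, h3, _⟩ := mem_of_isLink hG ha
        exact ⟨Or.inr h1, h2, h1 ▸ h3⟩
    have hnewA : ∀ a ∈ F ∪ G, a.start ∈ A := by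
      intro a ha
      rcases (hnew a ha).1 with h | h <;> rw [h] <;> assumption
    have hcases : ∀ a ∈ E ∪ F ∪ G, a ∈ E ∨ a ∈ F ∪ G := by
      intro a ha
      rw [Finset.union_assoc] at ha
      exact Finset.mem_union.1 ha
    have hA' : ∀ w ∈ insert p ((A.erase u).erase v), w = p ∨ (w ∈ A ∧ w ≠ u ∧ w ≠ v) := by
      intro w hw
      simp only [Finset.mem_insert, Finset.mem_erase] at hw
      tauto
    -- no two regions of active nodes meet outside the circle through `p`
    have hjoinle : ∀ w ∈ A, ∀ w' ∈ A, w ≠ w' → ∀ q ∈ region α w ∩ region α w', ‖q‖ ≤ ‖p‖ := by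
      intro w hw w' hw' hne q hq
      by_contra hlt
      rw [not_le] at hlt
      have hw0 := ih.ne_zero w hw
      have hw0' := ih.ne_zero w' hw'
      obtain ⟨r, hr⟩ := exists_isJoinPoint hα hw0 hw0'
      exact absurd ((hr.2 q hq).trans (farthest w hw w' hw' hne r hr)) (not_le.2 hlt)
    -- an arc that starts at `p` would end on its own starting circle
    have hpE : ∀ a ∈ E, a.start ≠ p := by
      intro a ha h
      have h1 := ih.norm_le_active a ha u hu p ⟨h ▸ self_mem_region _, hp.1.1⟩
      rw [← h] at h1
      exact ih.nondegenerate a ha (eq_of_mem_region_of_norm_le hα (finish_mem_region a) h1)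
    have hinjnew : ∀ a ∈ F ∪ G, ∀ b ∈ F ∪ G, a.start = b.start → a = b := by
      intro a ha b hb hab
      rcases Finset.mem_union.1 ha with ha | ha <;> rcases Finset.mem_union.1 hb with hb | hb <;>
        obtain ⟨h1, _, _, h2⟩ := mem_of_isLink ‹_› ha <;>
        obtain ⟨h3, _, _, h4⟩ := mem_of_isLink ‹_› hb
      · rw [h2] at hb; exact (Finset.mem_singleton.1 hb).symm
      · exact absurd (h1.symm.trans (hab.trans h3)) huv
      · exact absurd (h3.symm.trans (hab.symm.trans h1)) huv
      · rw [h2] at hb; exact (Finset.mem_singleton.1 hb).symm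
    -- a node that was active still is, or has an arc now
    have hleft : ∀ w ∈ A, w ∈ insert p ((A.erase u).erase v) ∨
        ∃ a ∈ E ∪ F ∪ G, a.start = w := by
      intro w hw
      by_cases hwp : w = p
      · exact Or.inl (by simp [hwp])
      by_cases hwu : w = u
      · obtain ⟨a, ha, h1, _⟩ := exists_of_isLink hF (hwu ▸ hwp)
        exact Or.inr ⟨a, by simp [ha], h1.trans hwu.symm⟩
      by_cases hwv : w = v
      · obtain ⟨a, ha, h1, _⟩ := exists_of_isLink hG (hwv ▸ hwp)
        exact Or.inr ⟨a, by simp [ha], h1.trans hwv.symm⟩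
      exact Or.inl (by simp [hw, hwu, hwv])
    have hsub : E ⊆ E ∪ F ∪ G := fun a ha => by simp [ha]
    have htip : ∀ w ∈ A, IsTip α S (E ∪ F ∪ G) w := fun w hw => (ih.tip_active w hw).mono hsub
    have htipp : IsTip α S (E ∪ F ∪ G) p := by
      by_cases hup : u = p
      · exact hup ▸ htip u hu
      by_cases hvp : v = p
      · exact hvp ▸ htip v hv
      obtain ⟨a, ha, ha1, ha2⟩ := exists_of_isLink hF hup
      obtain ⟨b, hb, hb1, hb2⟩ := exists_of_isLink hG hvp
      have haE : a ∈ E ∪ F ∪ G := by simp [ha]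
      have hbE : b ∈ E ∪ F ∪ G := by simp [hb]
      obtain ⟨s, t, ⟨h1, h2⟩ | ⟨h1, h2⟩⟩ := hp.exists_spirals hα hu0 hv0 hup hvp
      · exact Or.inr ⟨⟨a, haE, ha2, s, by rw [ha1, h1]⟩, b, hbE, hb2, t, by rw [hb1, h2]⟩
      · exact Or.inr ⟨⟨b, hbE, hb2, s, by rw [hb1, h1]⟩, a, haE, ha2, t, by rw [ha1, h2]⟩
    refine ⟨?_, ?_, ?_, ?_, ?_, ?_, ?_, ?_, ?_, ?_, ?_⟩
    · intro w hw
      rcases hA' w hw with rfl | h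
      · exact hp0
      · exact ih.ne_zero w h.1
    · intro a ha
      rcases hcases a ha with ha | ha
      · exact ih.start_ne_zero a ha
      · exact ih.ne_zero _ (hnewA a ha)
    · intro a ha
      rcases hcases a ha with ha | ha
      · exact ih.nondegenerate a ha
      · rw [(hnew a ha).2.1]; exact (hnew a ha).2.2.symm
    · intro a ha b hb hab
      rcases hcases a ha with ha | ha <;> rcases hcases b hb with hb | hb
      · exact ih.start_injOn ha hb hab
      · exact absurd (hnewA b hb) (hab ▸ ih.start_notMem a ha)
      · exact absurd (hnewA a ha) (hab ▸ ih.start_notMem b hb)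
      · exact hinjnew a ha b hb hab
    · intro a ha hmem
      rcases hcases a ha with ha | ha
      · rcases hA' _ hmem with h | h
        · exact hpE a ha h
        · exact ih.start_notMem a ha h.1
      · rcases hA' _ hmem with h | h
        · exact (hnew a ha).2.2 h
        · exact (hnew a ha).1.elim h.2.1 h.2.2
    · intro t ht
      rcases ih.terminal t ht with h | ⟨a, ha, hat⟩
      · exact hleft t h
      · exact Or.inr ⟨a, hsub ha, hat⟩
    · intro a ha
      rcases hcases a ha with ha | ha
      · rcases ih.parent a ha with h | ⟨b, hb, hba⟩
        · exact hleft _ h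
        · exact Or.inr ⟨b, hsub hb, hba⟩
      · exact Or.inl (by rw [(hnew a ha).2.1]; simp)
    · intro w hw
      rcases hA' w hw with rfl | h
      · exact htipp
      · exact htip w h.1
    · intro a ha
      rcases hcases a ha with ha | ha
      · exact (ih.tip_start a ha).mono hsub
      · exact htip _ (hnewA a ha)
    · intro a ha b hb hab q hq
      rcases hcases a ha with ha | ha <;> rcases hcases b hb with hb | hb
      · exact ih.norm_le a ha b hb hab q hq
      · exact (ih.norm_le_active a ha _ (hnewA b hb) q hq).trans (le_max_left _ _)
      · exact (ih.norm_le_active b hb _ (hnewA a ha) q hq.symm).trans (le_max_right _ _)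
      · rw [(hnew a ha).2.1, (hnew b hb).2.1, max_self]
        exact hjoinle _ (hnewA a ha) _ (hnewA b hb) (fun h => hab (hinjnew a ha b hb h)) q hq
    · intro a ha w hw q hq
      rcases hcases a ha with ha | ha
      · rcases hA' w hw with rfl | h
        · exact ih.norm_le_active a ha u hu q ⟨hq.1, region_trans hα hp.1.1 hq.2⟩
        · exact ih.norm_le_active a ha w h.1 q hq
      · rw [(hnew a ha).2.1]
        rcases hA' w hw with rfl | h
        · exact norm_le_of_mem_region hα hq.2
        · refine hjoinle _ (hnewA a ha) w h.1 ?_ q hq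
          rcases (hnew a ha).1 with h' | h' <;> rw [h']
          · exact h.2.1.symm
          · exact h.2.2.symm

end Greedy

/-! ### The number of crossings of a greedy tree -/

section Counting

variable {α : ℝ} {S : Finset ℂ} {T T' : Finset Arc}

/-- `b` is the arc that continues `a` towards the root. -/
def Follows (α : ℝ) (T : Finset Arc) (a b : Arc) : Prop :=
  a ∈ T ∧ b ∈ T ∧ a.finish α = b.start

/-- The path from a node to the root crosses a circle at most once. -/
theorem eq_of_crossing_of_reflTransGen (hT : IsSpiralTree α S T) {R : ℝ}
    {a v w : Arc} (hv : v ∈ crossing α R T) (hw : w ∈ crossing α R T)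
    (hav : Relation.ReflTransGen (Follows α T) a v)
    (haw : Relation.ReflTransGen (Follows α T) a w) : v = w := by
  have key : ∀ v ∈ crossing α R T, ∀ w ∈ crossing α R T,
      Relation.ReflTransGen (Follows α T) v w → v = w := by
    intro v hv w hw h
    rcases Relation.ReflTransGen.cases_head h with h | ⟨b, hvb, hbw⟩
    · exact h
    · have h1 : ∀ c, Relation.ReflTransGen (Follows α T) b c → ‖c.start‖ ≤ ‖b.start‖ := by
        intro c hc
        induction hc with
        | refl => exact le_rfl
        | tail _ h ih => rw [← h.2.2]; exact (Arc.norm_finish_le _).trans ih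
      have h2 := h1 w hbw
      rw [← hvb.2.2] at h2
      have h3 := (Finset.mem_filter.1 hv).2.1
      have h4 := (Finset.mem_filter.1 hw).2.2
      linarith
  have huniq : Relator.RightUnique (Follows α T) := fun a b c hb hc =>
    hT.start_injOn hb.2.1 hc.2.1 (hb.2.2.symm.trans hc.2.2)
  rcases Relation.ReflTransGen.total_of_right_unique huniq hav haw with h | h
  · exact key v hv w hw h
  · exact (key w hw v hv h).symm

/-- Following left spirals backwards from a node leaves the first null coordinate unchanged. One
gets to a terminal, or passes a given value of the second coordinate. -/
theorem left_chain (hα : 0 < Real.tan α) (hT : IsSpiralTree α S T)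
    (htip : ∀ a ∈ T, IsTip α S T a.start) {X Y₀ : ℝ} {w : Arc} (hw : w ∈ T) {Y : ℝ} (hY : Y < Y₀)
    (hwp : w.start = pt (Real.tan α) X Y) :
    (∃ t ∈ S, ∃ Y', Y ≤ Y' ∧ Y' < Y₀ ∧ t = pt (Real.tan α) X Y') ∨
      ∃ a ∈ T, Relation.ReflTransGen (Follows α T) a w ∧ ∃ Y₁ Y₂, Y₀ ≤ Y₁ ∧ Y₂ < Y₀ ∧
        a.start = pt (Real.tan α) X Y₁ ∧ a.finish α = pt (Real.tan α) X Y₂ := by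
  revert Y
  refine finset_strong_induction T (fun a => ‖a.start‖) (fun w => ∀ {Y : ℝ}, Y < Y₀ →
    w.start = pt (Real.tan α) X Y →
    (∃ t ∈ S, ∃ Y', Y ≤ Y' ∧ Y' < Y₀ ∧ t = pt (Real.tan α) X Y') ∨
      ∃ a ∈ T, Relation.ReflTransGen (Follows α T) a w ∧ ∃ Y₁ Y₂, Y₀ ≤ Y₁ ∧ Y₂ < Y₀ ∧
        a.start = pt (Real.tan α) X Y₁ ∧ a.finish α = pt (Real.tan α) X Y₂) ?_ w hw
  intro w hw ih Y hY hwp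
  rcases htip w hw with h | ⟨_, b, hb, hbw, s, hs⟩
  · exact Or.inl ⟨_, h, Y, le_rfl, hY, hwp⟩
  have hlt := hT.norm_finish_lt hα hb
  rw [hbw] at hlt
  obtain ⟨X', Y', hb'⟩ := exists_pt_eq hα (hT.start_ne_zero hb)
  rw [hb', spiral_left_pt hα, hwp] at hs
  obtain ⟨k, h1, h2⟩ := (pt_eq_pt_iff hα).1 hs
  rw [← pt_add_int_mul hα X' Y' (-k)] at hb'
  push_cast at hb'
  have hX : X' + -(k : ℝ) * (2 * Real.pi) = X := by linarith
  rw [hX] at hb'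
  set Y₁ := Y' + -(k : ℝ) * (2 * Real.pi)
  have hfollow : Relation.ReflTransGen (Follows α T) b w :=
    Relation.ReflTransGen.single ⟨hb, hw, hbw⟩
  have hYY : Y ≤ Y₁ := by
    rw [hb', hwp, norm_pt_lt_norm_pt hα] at hlt
    linarith
  rcases lt_or_ge Y₁ Y₀ with hlt' | hge
  · rcases ih b hb hlt hlt' hb' with ⟨t, ht, Y₂, h3, h4⟩ | ⟨a, ha, hab, h3⟩
    · exact Or.inl ⟨t, ht, Y₂, hYY.trans h3, h4⟩
    · exact Or.inr ⟨a, ha, hab.trans hfollow, h3⟩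
  · exact Or.inr ⟨b, hb, hfollow, Y₁, Y, hge, hY, hb', hbw.trans hwp⟩

/-- The mirror image of `left_chain`. -/
theorem right_chain (hα : 0 < Real.tan α) (hT : IsSpiralTree α S T)
    (htip : ∀ a ∈ T, IsTip α S T a.start) {X₀ Y : ℝ} {w : Arc} (hw : w ∈ T) {X : ℝ} (hX : X₀ < X)
    (hwp : w.start = pt (Real.tan α) X Y) :
    (∃ t ∈ S, ∃ X', X' ≤ X ∧ X₀ < X' ∧ t = pt (Real.tan α) X' Y) ∨
      ∃ a ∈ T, Relation.ReflTransGen (Follows α T) a w ∧ ∃ X₁ X₂, X₁ ≤ X₀ ∧ X₀ < X₂ ∧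
        a.start = pt (Real.tan α) X₁ Y ∧ a.finish α = pt (Real.tan α) X₂ Y := by
  revert X
  refine finset_strong_induction T (fun a => ‖a.start‖) (fun w => ∀ {X : ℝ}, X₀ < X →
    w.start = pt (Real.tan α) X Y →
    (∃ t ∈ S, ∃ X', X' ≤ X ∧ X₀ < X' ∧ t = pt (Real.tan α) X' Y) ∨
      ∃ a ∈ T, Relation.ReflTransGen (Follows α T) a w ∧ ∃ X₁ X₂, X₁ ≤ X₀ ∧ X₀ < X₂ ∧
        a.start = pt (Real.tan α) X₁ Y ∧ a.finish α = pt (Real.tan α) X₂ Y) ?_ w hw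
  intro w hw ih X hX hwp
  rcases htip w hw with h | ⟨⟨b, hb, hbw, s, hs⟩, _⟩
  · exact Or.inl ⟨_, h, X, le_rfl, hX, hwp⟩
  have hlt := hT.norm_finish_lt hα hb
  rw [hbw] at hlt
  obtain ⟨X', Y', hb'⟩ := exists_pt_eq hα (hT.start_ne_zero hb)
  rw [hb', spiral_right_pt hα, hwp] at hs
  obtain ⟨k, h1, h2⟩ := (pt_eq_pt_iff hα).1 hs
  rw [← pt_add_int_mul hα X' Y' (-k)] at hb'
  push_cast at hb'
  have hY : Y' + -(k : ℝ) * (2 * Real.pi) = Y := by linarith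
  rw [hY] at hb'
  set X₁ := X' + -(k : ℝ) * (2 * Real.pi)
  have hfollow : Relation.ReflTransGen (Follows α T) b w :=
    Relation.ReflTransGen.single ⟨hb, hw, hbw⟩
  have hXX : X₁ ≤ X := by
    rw [hb', hwp, norm_pt_lt_norm_pt hα] at hlt
    linarith
  rcases lt_or_ge X₀ X₁ with hlt' | hge
  · rcases ih b hb hlt hlt' hb' with ⟨t, ht, Y₂, h3, h4⟩ | ⟨a, ha, hab, h3⟩
    · exact Or.inl ⟨t, ht, Y₂, h3.trans hXX, h4⟩
    · exact Or.inr ⟨a, ha, hab.trans hfollow, h3⟩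
  · exact Or.inr ⟨b, hb, hfollow, X₁, X, hge, hX, hb', hbw.trans hwp⟩

theorem exists_terminal_above (hα : 0 < Real.tan α) (hT : IsSpiralTree α S T)
    (htip : ∀ a ∈ T, IsTip α S T a.start) {w : Arc} (hw : w ∈ T) :
    ∃ t ∈ S, ‖w.start‖ ≤ ‖t‖ := by
  refine finset_strong_induction T (fun a => ‖a.start‖) (fun w => ∃ t ∈ S, ‖w.start‖ ≤ ‖t‖)
    ?_ w hw
  intro w hw ih
  rcases htip w hw with h | ⟨⟨b, hb, hbw, _⟩, _⟩
  · exact ⟨_, h, le_rfl⟩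
  · have hlt := hT.norm_finish_lt hα hb
    rw [hbw] at hlt
    obtain ⟨t, ht, hbt⟩ := ih b hb hlt
    exact ⟨t, ht, hlt.le.trans hbt⟩

/-- Two crossing nodes of a greedy tree have disjoint intervals on the circle. The circle is the set
of the points of level `c`, on which the region of `pt κ X Y` is the interval from `X` to `c + Y` of
the first coordinate. -/
theorem crossing_disjoint (hα : 0 < Real.tan α)
    (hle : ∀ a ∈ T, ∀ b ∈ T, a ≠ b → ∀ q ∈ region α a.start ∩ region α b.start,
      ‖q‖ ≤ max ‖a.finish α‖ ‖b.finish α‖) {c : ℝ} {v w : Arc}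
    (hv : v ∈ crossing α ‖pt (Real.tan α) c 0‖ T) (hw : w ∈ crossing α ‖pt (Real.tan α) c 0‖ T)
    (hvw : v ≠ w) {X₁ Y₁ X₂ Y₂ : ℝ} (h1 : v.start = pt (Real.tan α) X₁ Y₁)
    (h2 : w.start = pt (Real.tan α) X₂ Y₂) (hX : X₁ ≤ X₂) : c + Y₁ < X₂ := by
  simp only [crossing, Finset.mem_filter, h1, h2] at hv hw
  by_contra! hlt
  have hw' := hw.2.2
  rw [norm_pt_le_norm_pt hα] at hw'
  have hq := hle v hv.1 w hw.1 hvw (pt (Real.tan α) X₂ (min Y₁ Y₂)) (by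
    rw [h1, h2]
    exact ⟨(mem_region_pt hα).2 (Or.inr ⟨_, _, hX, min_le_left _ _, rfl⟩),
      (mem_region_pt hα).2 (Or.inr ⟨_, _, le_rfl, min_le_right _ _, rfl⟩)⟩)
  have hq' := hq.trans_lt (max_lt hv.2.1 hw.2.1)
  rw [norm_pt_lt_norm_pt hα] at hq'
  rcases min_choice Y₁ Y₂ with h | h <;> rw [h] at hq' <;> linarith

/-- The hull of the intervals of two crossing nodes `v` and `w` of a greedy tree contains a
crossing of any other tree: otherwise, two nodes in the subtrees of `v` and `w` have a join point
which is farther from the root than the joins that involve them. -/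
theorem exists_crossing_in_hull (hα : 0 < Real.tan α) (hT' : IsSpiralTree α S T')
    (htip : ∀ a ∈ T', IsTip α S T' a.start)
    (hle : ∀ a ∈ T', ∀ b ∈ T', a ≠ b → ∀ q ∈ region α a.start ∩ region α b.start,
      ‖q‖ ≤ max ‖a.finish α‖ ‖b.finish α‖) (hT : IsSpiralTree α S T) {c : ℝ} {v w : Arc}
    (hv : v ∈ crossing α ‖pt (Real.tan α) c 0‖ T') (hw : w ∈ crossing α ‖pt (Real.tan α) c 0‖ T')
    (hvw : v ≠ w) {X₁ Y₁ X₂ Y₂ : ℝ} (h1 : v.start = pt (Real.tan α) X₁ Y₁)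
    (h2 : w.start = pt (Real.tan α) X₂ Y₂) (hX : X₁ ≤ X₂) :
    ∃ q ∈ Metric.sphere (0 : ℂ) ‖pt (Real.tan α) c 0‖ ∩ treePoints α T, ∃ X Y,
      q = pt (Real.tan α) X Y ∧ X₁ ≤ X ∧ X ≤ c + Y₂ := by
  have hdisj := crossing_disjoint hα hle hv hw hvw h1 h2 hX
  have hv' := hv
  have hw' := hw
  simp only [crossing, Finset.mem_filter, h1, h2, norm_pt_le_norm_pt hα] at hv' hw'
  have hR : 0 < ‖pt (Real.tan α) c 0‖ := norm_pos_iff.2 (pt_ne_zero _ _ _)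
  -- every tree has a path from a terminal to the circle, within the region of the terminal
  have hterm : ∀ X Y : ℝ, pt (Real.tan α) X Y ∈ S → X - Y ≤ c → X₁ ≤ X → Y ≤ Y₂ →
      ∃ q ∈ Metric.sphere (0 : ℂ) ‖pt (Real.tan α) c 0‖ ∩ treePoints α T, ∃ X Y,
        q = pt (Real.tan α) X Y ∧ X₁ ≤ X ∧ X ≤ c + Y₂ := by
    intro X Y hS hc h3 h4
    obtain ⟨q, hq, hqt⟩ := hT.exists_point hα hR hS ((norm_pt_le_norm_pt hα).2 (by linarith))
    refine ⟨q, hq, ?_⟩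
    have hqn := mem_sphere_zero_iff_norm.1 hq.1
    rcases (mem_region_pt hα).1 hqt with rfl | ⟨X', Y', h5, h6, rfl⟩
    · rw [norm_zero] at hqn
      exact absurd hqn hR.ne
    · rw [norm_pt_eq_norm_pt hα] at hqn
      exact ⟨X', Y', rfl, h3.trans h5, by linarith⟩
  have hY : Y₁ < Y₂ := by linarith
  have hX' : X₁ < X₂ := by linarith
  rcases left_chain hα hT' htip hv'.1 hY h1 with ⟨t, ht, Y', h3, h4, rfl⟩ |
    ⟨a, ha, hav, Ya, Ya', h3, h4, h5, h6⟩
  · exact hterm X₁ Y' ht (by linarith) le_rfl h4.le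
  rcases right_chain hα hT' htip hw'.1 hX' h2 with ⟨t, ht, X', h7, h8, rfl⟩ |
    ⟨b, hb, hbw, Xb, Xb', h7, h8, h9, h10⟩
  · exact hterm X' Y₂ ht (by linarith) h8.le le_rfl
  -- otherwise, the quadrants of the starts of the arcs `a` and `b` meet outside both of their ends
  exfalso
  have hab : a ≠ b := by
    rintro rfl
    exact hvw (eq_of_crossing_of_reflTransGen hT' hv hw hav hbw)
  have hq := hle a ha b hb hab (pt (Real.tan α) X₁ Y₂) (by
    rw [h5, h9]
    exact ⟨(mem_region_pt hα).2 (Or.inr ⟨_, _, le_rfl, h3, rfl⟩),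
      (mem_region_pt hα).2 (Or.inr ⟨_, _, h7, le_rfl, rfl⟩)⟩)
  rw [h6, h10, le_max_iff, norm_pt_le_norm_pt hα, norm_pt_le_norm_pt hα] at hq
  rcases hq with hq | hq <;> linarith

/-- Going around the circle from a given point, there is a first point of a given finite set. -/
theorem exists_next {κ : ℝ} (hκ : 0 < κ) {Q : Finset ℂ} (hQ : Q.Nonempty) {c : ℝ}
    (hQc : ∀ q ∈ Q, ‖q‖ = ‖pt κ c 0‖) (X : ℝ) :
    ∃ q ∈ Q, ∃ X' Y', q = pt κ X' Y' ∧ X ≤ X' ∧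
      ∀ q' ∈ Q, ∀ X'' Y'', q' = pt κ X'' Y'' → X ≤ X'' → X' ≤ X'' := by
  have hp : (0 : ℝ) < 2 * Real.pi := by positivity
  have hlift : ∀ q ∈ Q, ∃ x, q = pt κ x (x - c) := by
    intro q hq
    have hq0 : q ≠ 0 := by
      rw [← norm_ne_zero_iff, hQc q hq]
      exact norm_ne_zero_iff.2 (pt_ne_zero _ _ _)
    obtain ⟨x, y, rfl⟩ := exists_pt_eq hκ hq0
    have := (norm_pt_eq_norm_pt hκ).1 (hQc _ hq)
    exact ⟨x, by congr 1; linarith⟩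
  choose! x hx using hlift
  obtain ⟨q, hq, hmin⟩ := Finset.exists_min_image Q (fun q => toIcoMod hp X (x q)) hQ
  refine ⟨q, hq, toIcoMod hp X (x q), toIcoMod hp X (x q) - c, ?_, left_le_toIcoMod _ _ _, ?_⟩
  · conv_lhs => rw [hx q hq]
    refine (pt_eq_pt_iff hκ).2 ⟨toIcoDiv hp X (x q), ?_, ?_⟩ <;>
    · have := toIcoMod_add_toIcoDiv_zsmul hp X (x q)
      rw [zsmul_eq_mul] at this
      linarith
  · intro q' hq' X'' Y'' h hX
    refine (hmin q' hq').trans ?_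
    have h' := hx q' hq'
    rw [h] at h'
    obtain ⟨k, h1, _⟩ := (pt_eq_pt_iff hκ).1 h'
    have h2 : toIcoMod hp X (x q') = toIcoMod hp X X'' := by
      rw [h]
      conv_rhs => rw [h1]
      rw [← zsmul_eq_mul, toIcoMod_add_zsmul]
    rw [h2]
    have h3 := toIcoMod_add_toIcoDiv_zsmul hp X X''
    rw [zsmul_eq_mul] at h3
    have h4 : 0 ≤ toIcoDiv hp X X'' := by
      by_contra! hneg
      have h5 : ((toIcoDiv hp X X'' : ℤ) : ℝ) ≤ -1 := by exact_mod_cast Int.le_sub_one_of_lt hneg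
      have h6 := toIcoMod_lt_right hp X X''
      nlinarith
    have h5 : (0 : ℝ) ≤ ((toIcoDiv hp X X'' : ℤ) : ℝ) := by exact_mod_cast h4
    nlinarith

/-- Every crossing node of the greedy tree is mapped to the next crossing of the other tree.
Three nodes with the same image would leave the hull of the first two without a crossing. -/
theorem card_crossing_le (hα : 0 < Real.tan α) (hT' : IsSpiralTree α S T')
    (htip : ∀ a ∈ T', IsTip α S T' a.start)
    (hle : ∀ a ∈ T', ∀ b ∈ T', a ≠ b → ∀ q ∈ region α a.start ∩ region α b.start,
      ‖q‖ ≤ max ‖a.finish α‖ ‖b.finish α‖) (hT : IsSpiralTree α S T) {R : ℝ} (hR : 0 < R) :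
    ((crossing α R T').card : ℕ∞) ≤
      2 * (Metric.sphere (0 : ℂ) R ∩ treePoints α T).encard := by
  classical
  obtain ⟨c, hc⟩ : ∃ c, R = ‖pt (Real.tan α) c 0‖ := by
    refine ⟨-(2 * Real.tan α * Real.log R), ?_⟩
    rw [norm_pt, sub_zero, neg_neg, mul_div_cancel_left₀ _ (by positivity), Real.exp_log hR]
  rcases Set.finite_or_infinite (Metric.sphere (0 : ℂ) R ∩ treePoints α T) with hfin | hinf
  swap
  · rw [hinf.encard_eq]
    simp
  set Q := hfin.toFinset with hQ
  have hmemQ : ∀ q, q ∈ Q ↔ q ∈ Metric.sphere (0 : ℂ) R ∩ treePoints α T := fun q => by simp [hQ]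
  have hQc : ∀ q ∈ Q, ‖q‖ = ‖pt (Real.tan α) c 0‖ := fun q hq => by
    rw [← hc]; exact mem_sphere_zero_iff_norm.1 ((hmemQ q).1 hq).1
  rw [hfin.encard_eq_coe_toFinset_card]
  have hnat : (crossing α R T').card ≤ 2 * Q.card := by
    have hlift : ∀ w ∈ crossing α R T', ∃ q ∈ Q, ∃ X Y X' Y', w.start = pt (Real.tan α) X Y ∧
        q = pt (Real.tan α) X' Y' ∧ X ≤ X' ∧
        ∀ q' ∈ Q, ∀ X'' Y'', q' = pt (Real.tan α) X'' Y'' → X ≤ X'' → X' ≤ X'' := by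
      intro w hw
      have hwT := (Finset.mem_filter.1 hw).1
      obtain ⟨X, Y, hXY⟩ := exists_pt_eq hα (hT'.start_ne_zero hwT)
      have hne : Q.Nonempty := by
        obtain ⟨t, ht, htw⟩ := exists_terminal_above hα hT' htip hwT
        obtain ⟨q, hq, _⟩ := hT.exists_point hα hR ht ((Finset.mem_filter.1 hw).2.2.trans htw)
        exact ⟨q, (hmemQ q).2 hq⟩
      obtain ⟨q, hq, X', Y', h1, h2, h3⟩ := exists_next hα hne hQc X
      exact ⟨q, hq, X, Y, X', Y', hXY, h1, h2, h3⟩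
    choose! f hfQ hf using hlift
    refine Finset.card_le_mul_card_image_of_maps_to (f := f) hfQ 2 fun q hq => ?_
    by_contra! hcard
    obtain ⟨u, v, w, hu, hv, hw, huv, huw, hvw⟩ := Finset.two_lt_card_iff.1 hcard
    rw [Finset.mem_filter] at hu hv hw
    -- lifts of the three nodes with respect to the same lift of `q`
    obtain ⟨x, y, hxy⟩ := exists_pt_eq hα (p := q) (by
      rw [← norm_ne_zero_iff, hQc q hq]
      exact norm_ne_zero_iff.2 (pt_ne_zero _ _ _))
    have hnorm : ∀ w ∈ crossing α R T', f w = q → ∃ X Y, w.start = pt (Real.tan α) X Y ∧ X ≤ x ∧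
        ∀ q' ∈ Q, ∀ X'' Y'', q' = pt (Real.tan α) X'' Y'' → X ≤ X'' → x ≤ X'' := by
      intro w hw hwq
      obtain ⟨X, Y, X', Y', h1, h2, h3, h4⟩ := hf w hw
      rw [hwq, hxy] at h2
      obtain ⟨k, h5, h6⟩ := (pt_eq_pt_iff hα).1 h2
      refine ⟨X + k * (2 * Real.pi), Y + k * (2 * Real.pi), by rw [pt_add_int_mul hα, h1],
        by linarith, fun q' hq' X'' Y'' h7 h8 => ?_⟩
      have := h4 q' hq' (X'' + ((-k : ℤ) : ℝ) * (2 * Real.pi)) (Y'' + ((-k : ℤ) : ℝ) * (2 * Real.pi))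
        (by rw [pt_add_int_mul hα, h7]) (by push_cast; linarith)
      push_cast at this
      linarith
    obtain ⟨X₁, Y₁, hu1, hu2, hu3⟩ := hnorm u hu.1 hu.2
    obtain ⟨X₂, Y₂, hv1, hv2, hv3⟩ := hnorm v hv.1 hv.2
    obtain ⟨X₃, Y₃, hw1, hw2, hw3⟩ := hnorm w hw.1 hw.2
    subst hc
    -- the hull of the intervals of the first two of three consecutive nodes contains a crossing,
    -- which lies before the third interval and thus before `q`
    have key : ∀ {u v w : Arc} {X₁ Y₁ X₂ Y₂ X₃ Y₃ : ℝ},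
        u ∈ crossing α ‖pt (Real.tan α) c 0‖ T' → v ∈ crossing α ‖pt (Real.tan α) c 0‖ T' →
        w ∈ crossing α ‖pt (Real.tan α) c 0‖ T' → u ≠ v → v ≠ w →
        u.start = pt (Real.tan α) X₁ Y₁ → v.start = pt (Real.tan α) X₂ Y₂ →
        w.start = pt (Real.tan α) X₃ Y₃ → X₃ ≤ x →
        (∀ q' ∈ Q, ∀ X'' Y'', q' = pt (Real.tan α) X'' Y'' → X₁ ≤ X'' → x ≤ X'') →
        X₁ ≤ X₂ → X₂ ≤ X₃ → False := by
      intro u v w X₁ Y₁ X₂ Y₂ X₃ Y₃ hu hv hw huv hvw h1 h2 h3 h4 h5 h6 h7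
      obtain ⟨q', hq', X, Y, h8, h9, h10⟩ :=
        exists_crossing_in_hull hα hT' htip hle hT hu hv huv h1 h2 h6
      have h11 := h5 q' ((hmemQ q').2 hq') X Y h8 h9
      have h12 := crossing_disjoint hα hle hv hw hvw h2 h3 h7
      linarith
    rcases le_total X₁ X₂ with h12 | h12 <;> rcases le_total X₂ X₃ with h23 | h23 <;>
      rcases le_total X₁ X₃ with h13 | h13
    · exact key hu.1 hv.1 hw.1 huv hvw hu1 hv1 hw1 hw2 hu3 h12 h23
    · exact key hu.1 hv.1 hw.1 huv hvw hu1 hv1 hw1 hw2 hu3 h12 h23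
    · exact key hu.1 hw.1 hv.1 huw hvw.symm hu1 hw1 hv1 hv2 hu3 h13 h23
    · exact key hw.1 hu.1 hv.1 huw.symm huv hw1 hu1 hv1 hv2 hw3 h13 h12
    · exact key hv.1 hu.1 hw.1 huv.symm huw hv1 hu1 hw1 hw2 hv3 h12 h13
    · exact key hv.1 hw.1 hu.1 hvw huw.symm hv1 hw1 hu1 hu2 hv3 h23 h13
    · exact key hw.1 hv.1 hu.1 hvw.symm huv.symm hw1 hv1 hu1 hu2 hw3 h23 h12
    · exact key hw.1 hv.1 hu.1 hvw.symm huv.symm hw1 hv1 hu1 hu2 hw3 h23 h12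
  exact_mod_cast hnat

/-- The invariant of the greedy algorithm for the finished tree. -/
theorem isGreedyTree_props (hα : 0 < Real.tan α) (hS : (0 : ℂ) ∉ S) (hT : IsGreedyTree α S T) :
    IsSpiralTree α S T ∧ (∀ a ∈ T, IsTip α S T a.start) ∧
      ∀ a ∈ T, ∀ b ∈ T, a ≠ b → ∀ q ∈ region α a.start ∩ region α b.start,
        ‖q‖ ≤ max ‖a.finish α‖ ‖b.finish α‖ := by
  obtain ⟨w, E, F, hE, hF, rfl⟩ := hT
  have inv := hE.inv hα hS
  have hw0 := inv.ne_zero w (by simp)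
  rcases hF with ⟨h, _⟩ | ⟨_, r, hrs, hrf, rfl⟩
  · exact absurd h hw0
  have hcases : ∀ a ∈ E ∪ {r}, a ∈ E ∨ a = r := fun a ha => by
    simpa only [Finset.mem_union, Finset.mem_singleton] using ha
  have hnot : ∀ a ∈ E, a.start ≠ w := fun a ha h => inv.start_notMem a ha (by simp [h])
  refine ⟨⟨?_, ?_, ?_, ?_⟩, ?_, ?_⟩
  · intro a ha
    rcases hcases a ha with ha | rfl
    · exact inv.nondegenerate a ha
    · rw [hrf, hrs]; exact hw0.symm
  · intro a ha b hb hab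
    rcases hcases a ha with ha' | rfl <;> rcases hcases b hb with hb' | rfl
    · exact inv.start_injOn ha' hb' hab
    · exact absurd (hab.trans hrs) (hnot a ha')
    · exact absurd (hab.symm.trans hrs) (hnot b hb')
    · rfl
  · intro t ht
    rcases inv.terminal t ht with h | ⟨a, ha, hat⟩
    · exact ⟨r, by simp, hrs.trans (Finset.mem_singleton.1 h).symm⟩
    · exact ⟨a, by simp [ha], hat⟩
  · intro a ha
    rcases hcases a ha with ha | rfl
    · rcases inv.parent a ha with h | ⟨b, hb, hba⟩
      · exact Or.inr ⟨r, by simp, hrs.trans (Finset.mem_singleton.1 h).symm⟩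
      · exact Or.inr ⟨b, by simp [hb], hba⟩
    · exact Or.inl hrf
  · intro a ha
    rcases hcases a ha with ha | rfl
    · exact (inv.tip_start a ha).mono Finset.subset_union_left
    · rw [hrs]; exact (inv.tip_active w (by simp)).mono Finset.subset_union_left
  · intro a ha b hb hab q hq
    rcases hcases a ha with ha' | rfl <;> rcases hcases b hb with hb' | rfl
    · exact inv.norm_le a ha' b hb' hab q hq
    · rw [hrs] at hq
      exact (inv.norm_le_active a ha' w (by simp) q hq).trans (le_max_left _ _)
    · rw [hrs] at hq
      exact (inv.norm_le_active b hb' w (by simp) q hq.symm).trans (le_max_right _ _)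
    · exact absurd rfl hab

/-- A greedy spiral tree has at most twice as many points on every circle as any other spiral tree
for the same terminals, and integration over all circles compares the lengths. -/
theorem greedy_approximation (hα : 0 < Real.tan α) (hS : (0 : ℂ) ∉ S) (hT' : IsGreedyTree α S T') :
    IsSpiralTree α S T' ∧ ∀ T : Finset Arc, IsSpiralTree α S T →
      (∀ R : ℝ, 0 < R → (Metric.sphere (0 : ℂ) R ∩ treePoints α T').encard ≤
        2 * (Metric.sphere (0 : ℂ) R ∩ treePoints α T).encard) ∧
      treeLength α T' ≤ 2 * treeLength α T := by
  obtain ⟨h1, h2, h3⟩ := isGreedyTree_props hα hS hT'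
  refine ⟨h1, fun T hT => ⟨fun R hR => (encard_sphere_inter_treePoints_le hα h1 hR).trans
    (card_crossing_le hα h1 h2 h3 hT hR), ?_⟩⟩
  rw [treeLength_eq_lintegral, treeLength_eq_lintegral, mul_left_comm]
  gcongr
  rw [← MeasureTheory.lintegral_const_mul' _ _ (by simp)]
  refine MeasureTheory.setLIntegral_mono' measurableSet_Ioi fun R hR => ?_
  have h4 := (card_crossing_le hα h1 h2 h3 hT hR).trans
    (mul_le_mul_right (encard_sphere_inter_treePoints_le hα hT hR) 2)
  have h5 : (crossing α R T').card ≤ 2 * (crossing α R T).card := by exact_mod_cast h4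
  exact_mod_cast h5

end Counting

/-! ### Evaluation of terms within a step bound -/

/-- The first component of a pair. -/
def tFst (e : Term) : Term := .cases e .nil (.var 0)

/-- The second component of a pair. -/
def tSnd (e : Term) : Term := .cases e .nil (.var 1)

/-- Evaluation in at most `K` steps. -/
def Ev (P : Program) (env : List Value) (e : Term) (v : Value) (K : ℕ) : Prop :=
  ∃ k ≤ K, Eval P env e v k

namespace Ev

variable {P : Program} {env : List Value} {e f yes no body onNil onPair : Term}
  {u v w a b : Value} {x y : ℝ} {k l m n : ℕ}

theorem mono (h : Ev P env e v k) (hkl : k ≤ l) : Ev P env e v l :=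
  let ⟨i, hi, h⟩ := h
  ⟨i, hi.trans hkl, h⟩

theorem var {i : ℕ} (h : env[i]? = some v) : Ev P env (.var i) v 1 := ⟨1, le_rfl, .var h⟩

theorem zero : Ev P env (.const 0) (.real 0) 1 := ⟨1, le_rfl, by simpa using Eval.const (q := 0)⟩

theorem one : Ev P env (.const 1) (.real 1) 1 := ⟨1, le_rfl, by simpa using Eval.const (q := 1)⟩

theorem neg_one : Ev P env (.const (-1)) (.real (-1)) 1 :=
  ⟨1, le_rfl, by simpa using Eval.const (q := -1)⟩

theorem two : Ev P env (.const 2) (.real 2) 1 := ⟨1, le_rfl, by simpa using Eval.const (q := 2)⟩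

theorem twenty : Ev P env (.const 20) (.real 20) 1 :=
  ⟨1, le_rfl, by simpa using Eval.const (q := 20)⟩

theorem nil : Ev P env .nil .nil 1 := ⟨1, le_rfl, .nil⟩

theorem exp (he : Ev P env e (.real x) k) :
    Ev P env (.unary .exp e) (.real (Real.exp x)) (k + 1) :=
  let ⟨_, hi, h⟩ := he
  ⟨_, Nat.add_le_add_right hi 1, .unary h⟩

theorem log (he : Ev P env e (.real x) k) :
    Ev P env (.unary .log e) (.real (Real.log x)) (k + 1) :=
  let ⟨_, hi, h⟩ := he
  ⟨_, Nat.add_le_add_right hi 1, .unary h⟩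

theorem sin (hx : |x| ≤ Real.pi) (he : Ev P env e (.real x) k) :
    Ev P env (.unary .sin e) (.real (Real.sin x)) (k + 1) := by
  obtain ⟨i, hi, h⟩ := he
  refine ⟨_, Nat.add_le_add_right hi 1, ?_⟩
  have h' := Eval.unary (o := .sin) h
  rwa [UnaryOp.apply, if_pos hx] at h'

theorem cos (hx : |x| ≤ Real.pi) (he : Ev P env e (.real x) k) :
    Ev P env (.unary .cos e) (.real (Real.cos x)) (k + 1) := by
  obtain ⟨i, hi, h⟩ := he
  refine ⟨_, Nat.add_le_add_right hi 1, ?_⟩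
  have h' := Eval.unary (o := .cos) h
  rwa [UnaryOp.apply, if_pos hx] at h'

theorem binary (o : BinaryOp) (he : Ev P env e (.real x) k) (hf : Ev P env f (.real y) l) :
    Ev P env (.binary o e f) (.real (o.apply x y)) (k + l + 1) :=
  let ⟨_, hi, h⟩ := he
  let ⟨_, hj, h'⟩ := hf
  ⟨_, by omega, .binary h h'⟩

theorem add (he : Ev P env e (.real x) k) (hf : Ev P env f (.real y) l) :
    Ev P env (.binary .add e f) (.real (x + y)) (k + l + 1) := binary .add he hf

theorem sub (he : Ev P env e (.real x) k) (hf : Ev P env f (.real y) l) :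
    Ev P env (.binary .sub e f) (.real (x - y)) (k + l + 1) := binary .sub he hf

theorem mul (he : Ev P env e (.real x) k) (hf : Ev P env f (.real y) l) :
    Ev P env (.binary .mul e f) (.real (x * y)) (k + l + 1) := binary .mul he hf

theorem div (he : Ev P env e (.real x) k) (hf : Ev P env f (.real y) l) :
    Ev P env (.binary .div e f) (.real (x / y)) (k + l + 1) := binary .div he hf

theorem arg (he : Ev P env e (.real x) k) (hf : Ev P env f (.real y) l) :
    Ev P env (.binary .arg e f) (.real (Complex.arg ⟨x, y⟩)) (k + l + 1) := binary .arg he hf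

theorem pair (he : Ev P env e v k) (hf : Ev P env f w l) :
    Ev P env (.pair e f) (.pair v w) (k + l + 1) :=
  let ⟨_, hi, h⟩ := he
  let ⟨_, hj, h'⟩ := hf
  ⟨_, by omega, .pair h h'⟩

theorem bind (he : Ev P env e v k) (hb : Ev P (v :: env) body w l) :
    Ev P env (.bind e body) w (k + l + 1) :=
  let ⟨_, hi, h⟩ := he
  let ⟨_, hj, h'⟩ := hb
  ⟨_, by omega, .bind h h'⟩

theorem cases_nil (he : Ev P env e .nil k) (hv : Ev P env onNil v l) :
    Ev P env (.cases e onNil onPair) v (k + l + 1) :=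
  let ⟨_, hi, h⟩ := he
  let ⟨_, hj, h'⟩ := hv
  ⟨_, by omega, .cases_nil h h'⟩

theorem cases_pair (he : Ev P env e (.pair a b) k) (hv : Ev P (a :: b :: env) onPair v l) :
    Ev P env (.cases e onNil onPair) v (k + l + 1) :=
  let ⟨_, hi, h⟩ := he
  let ⟨_, hj, h'⟩ := hv
  ⟨_, by omega, .cases_pair h h'⟩

theorem tfst (he : Ev P env e (.pair a b) k) : Ev P env (tFst e) a (k + 2) :=
  (cases_pair he (var rfl)).mono (by omega)

theorem tsnd (he : Ev P env e (.pair a b) k) : Ev P env (tSnd e) b (k + 2) :=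
  (cases_pair he (var rfl)).mono (by omega)

theorem call {i : ℕ} (he : Ev P env e v k) (hi : P[i]? = some body) (hb : Ev P [v] body w l) :
    Ev P env (.call i e) w (k + l + 1) :=
  let ⟨_, hi', h⟩ := he
  let ⟨_, hj, h'⟩ := hb
  ⟨_, by omega, .call h hi h'⟩

theorem ifLt (he : Ev P env e (.real x) k) (hf : Ev P env f (.real y) l)
    (hy : x < y → Ev P env yes v m) (hn : ¬ x < y → Ev P env no v n) :
    Ev P env (.ifLt e f yes no) v (k + l + (m + n) + 1) := by
  obtain ⟨i, hi, h⟩ := he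
  obtain ⟨j, hj, h'⟩ := hf
  by_cases hxy : x < y
  · obtain ⟨r, hr, h''⟩ := hy hxy
    exact ⟨_, by omega, .ifLt_yes h h' hxy h''⟩
  · obtain ⟨r, hr, h''⟩ := hn hxy
    exact ⟨_, by omega, .ifLt_no h h' hxy h''⟩

end Ev

/-! ### The program -/

/-- Subtraction of terms. -/
def tSub (e f : Term) : Term := .binary .sub e f

/-- Addition of terms. -/
def tAdd (e f : Term) : Term := .binary .add e f

/-- Multiplication of terms. -/
def tMul (e f : Term) : Term := .binary .mul e f

/-- Division of terms. -/
def tDiv (e f : Term) : Term := .binary .div e f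

/-- `(p, q) ↦` whether `p` is lexicographically smaller than `q`. A truth value is `nil` (false) or
a pair (true). Here and in the following function bodies, the argument of the function is the
variable with the largest index, and `cases` puts the components of a pair at the indices `0`
and `1`. -/
def lexBody : Term :=
  .ifLt (tFst (tFst (.var 0))) (tFst (tSnd (.var 0))) (.pair .nil .nil)
    (.ifLt (tFst (tSnd (.var 0))) (tFst (tFst (.var 0))) .nil
      (.ifLt (tSnd (tFst (.var 0))) (tSnd (tSnd (.var 0))) (.pair .nil .nil) .nil))

/-- Merges two sorted lists of items; the first component of an item is its key. -/
def mergeBody : Term :=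
  .cases (tFst (.var 0)) (tSnd (.var 0)) <|
    .cases (tSnd (.var 2)) (tFst (.var 2)) <|
      .cases (.call 1 (.pair (tFst (.var 0)) (tFst (.var 2))))
        (.pair (.var 2) (.call 2 (.pair (.var 3) (tSnd (.var 4)))))
        (.pair (.var 2) (.call 2 (.pair (tFst (.var 6)) (.var 3))))

/-- `(d, l) ↦ (l₁, l₂)`, where `l₁` consists of the first `2 ^ d` elements of `l`, sorted. -/
def sortBody : Term :=
  .cases (tFst (.var 0))
    (.cases (tSnd (.var 0)) (.pair .nil .nil) (.pair (.pair (.var 0) .nil) (.var 1))) <|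
    .bind (.call 3 (.pair (.var 1) (tSnd (.var 2)))) <|
      .bind (.call 3 (.pair (.var 2) (tSnd (.var 0)))) <|
        .pair (.call 2 (.pair (tFst (.var 1)) (tFst (.var 0)))) (tSnd (.var 0))

/-- Every second element of a list. -/
def halveBody : Term :=
  .cases (.var 0) .nil (.cases (.var 1) (.pair (.var 0) .nil) (.pair (.var 2) (.call 4 (.var 1))))

/-- The number of halvings after which at most one element of a list remains, in unary. -/
def depthBody : Term :=
  .cases (.var 0) .nil (.cases (.var 1) .nil (.pair .nil (.call 5 (.call 4 (.var 4)))))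

/-- `(κ, l) ↦` the list of the items `((lev, φ), z)` for the points `z` of `l`. -/
def itemsBody : Term :=
  .cases (tSnd (.var 0)) .nil <|
    .pair
      (.pair
        (.pair
          (tSub (.const 0) (tMul (tFst (.var 2))
            (.unary .log (tAdd (tMul (tFst (.var 0)) (tFst (.var 0)))
              (tMul (tSnd (.var 0)) (tSnd (.var 0)))))))
          (.binary .arg (tFst (.var 0)) (tSnd (.var 0))))
        (.var 0))
      (.call 6 (.pair (tFst (.var 2)) (.var 1)))

/-- `(p, u) ↦ u` if `u < p`, and `u - p` otherwise. -/
def reduceBody : Term :=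
  .ifLt (tSnd (.var 0)) (tFst (.var 0)) (.var 0 |> tSnd) (tSub (tSnd (.var 0)) (tFst (.var 0)))

/-- `(2π, items, lev, ρ) ↦` the list of the nodes for the items; `lev` is the level of the item
before, and `ρ` the reduced rotation that belongs to it. -/
def nodesBody : Term :=
  .cases (tFst (tSnd (.var 0))) .nil <|
    -- the new rotation
    .bind
      (.ifLt (tSub (tFst (tFst (.var 0))) (tFst (tSnd (tSnd (.var 2))))) (.const 20)
        (.call 7 (.pair (tFst (.var 2)) (.call 7 (.pair (tFst (.var 2))
          (tAdd (tSnd (tSnd (tSnd (.var 2))))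
            (tDiv (tSub (tFst (tFst (.var 0))) (tFst (tSnd (tSnd (.var 2))))) (.const 2)))))))
        (.const 0)) <|
      -- the first null coordinate
      .bind
        (.ifLt (tAdd (tSnd (tFst (.var 1))) (.var 0)) (.const 0)
          (tAdd (tAdd (tSnd (tFst (.var 1))) (.var 0)) (tFst (.var 3)))
          (.call 7 (.pair (tFst (.var 3)) (tAdd (tSnd (tFst (.var 1))) (.var 0))))) <|
        .bind (tSub (.var 0) (tFst (tFst (.var 2)))) <|
          .pair
            (.pair (.pair (.var 1) (.var 0)) (.pair (.pair (.var 1) (.var 0)) (tSnd (.var 3))))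
            (.call 8 (.pair (tFst (.var 5)) (.pair (.var 4)
              (.pair (tFst (tFst (.var 3))) (.var 2)))))

/-- `(c, o) ↦` the candidate with the smaller level, where `o` is `nil` or a candidate. -/
def betterBody : Term :=
  .cases (tSnd (.var 0)) (tFst (.var 0))
    (.ifLt (.var 1) (tSnd (tFst (.var 2))) (tSnd (.var 2)) (tFst (.var 2)))

/-- The first null coordinate of a node. -/
def tX (e : Term) : Term := tFst (tFst (tSnd e))

/-- The second null coordinate of a node. -/
def tY (e : Term) : Term := tSnd (tFst (tSnd e))

/-- The location of a node. -/
def tZ (e : Term) : Term := tSnd (tSnd e)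

/-- `(a, b) ↦ ((a, b), level of their join)`. -/
def candBody : Term :=
  .ifLt (tY (tFst (.var 0))) (tY (tSnd (.var 0)))
    (.pair (.var 0) (tSub (tX (tSnd (.var 0))) (tY (tFst (.var 0)))))
    (.pair (.var 0) (tSub (tX (tSnd (.var 0))) (tY (tSnd (.var 0)))))

/-- The summary of the concatenation of two sequences of nodes. -/
def combineBody : Term :=
  .cases (tFst (.var 0)) (tSnd (.var 0)) <|
    .cases (tSnd (.var 2)) (tFst (.var 2)) <|
      .pair (.pair (tFst (.var 2)) (tSnd (.var 0)))
        (.call 9 (.pair (.call 9 (.pair (.call 10 (.pair (tSnd (.var 2)) (tFst (.var 0))))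
          (.var 3))) (.var 1)))

/-- Builds a node of the search tree from a split key and two subtrees. -/
def mkBody : Term :=
  .pair (.call 11 (.pair (tFst (tFst (tSnd (.var 0)))) (tFst (tSnd (tSnd (.var 0)))))) (.var 0)

/-- `(d, l) ↦ (t, l')`, where `t` is a search tree with empty slots for the first `2 ^ d` elements
of the sorted list `l`, and `l'` is the rest of `l`. -/
def buildBody : Term :=
  .cases (tFst (.var 0))
    (.cases (tSnd (.var 0)) .nil (.pair (.pair .nil .nil) (.var 1))) <|
    .bind (.call 13 (.pair (.var 1) (tSnd (.var 2)))) <|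
      .cases (tSnd (.var 0)) (.var 0) <|
        .bind (.call 13 (.pair (.var 4) (tSnd (.var 2)))) <|
          .pair (.call 12 (.pair (tFst (.var 1)) (.pair (tFst (.var 3)) (tFst (.var 0)))))
            (tSnd (.var 0))

/-- `(t, key, s) ↦` the search tree `t` with the summary `s` in the slot of the key. -/
def updateBody : Term :=
  .cases (tSnd (tFst (.var 0))) (.pair (tSnd (tSnd (.var 0))) .nil) <|
    .cases (.call 1 (.pair (tFst (tSnd (.var 2))) (.var 0)))
      (.call 12 (.pair (.var 0) (.pair (tFst (.var 1))
        (.call 14 (.pair (tSnd (.var 1)) (tSnd (.var 2)))))))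
      (.call 12 (.pair (.var 2) (.pair (.call 14 (.pair (tFst (.var 3)) (tSnd (.var 4))))
        (tSnd (.var 3)))))

/-- `((z, z'), (s, t), l) ↦` the list `l` with an arc from `z` to `z'` in front, which follows the
right spiral up to the parameter `s` and then the left one up to the parameter `t`. -/
def consArcBody : Term :=
  .pair
    (.pair (tFst (.var 0))
      (.pair (.pair (.pair (.const 1) (tFst (tFst (tSnd (.var 0)))))
        (.pair (.pair (.const (-1)) (tSnd (tFst (tSnd (.var 0))))) .nil)) .nil))
    (tSnd (tSnd (.var 0)))

/-- `(2κ, (u, p), l) ↦` the list `l` with an arc from `u` to `p` in front, unless `u` and `p`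
are equal. -/
def linkBody : Term :=
  .bind
    (.pair (.pair (tZ (tFst (tFst (tSnd (.var 0))))) (tZ (tSnd (tFst (tSnd (.var 0))))))
      (.pair
        (.pair
          (tDiv (tSub (tX (tSnd (tFst (tSnd (.var 0))))) (tX (tFst (tFst (tSnd (.var 0))))))
            (tFst (.var 0)))
          (tDiv (tSub (tY (tFst (tFst (tSnd (.var 0))))) (tY (tSnd (tFst (tSnd (.var 0))))))
            (tFst (.var 0))))
        (tSnd (tSnd (.var 0))))) <|
    .ifLt (tX (tFst (tFst (tSnd (.var 1))))) (tX (tSnd (tFst (tSnd (.var 1))))) (.call 15 (.var 0))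
      (.ifLt (tY (tSnd (tFst (tSnd (.var 1))))) (tY (tFst (tFst (tSnd (.var 1)))))
        (.call 15 (.var 0)) (tSnd (tSnd (.var 1))))

/-- `(2κ, (a, b)) ↦` the join node of `a` and `b`. -/
def tipBody : Term :=
  .ifLt (tY (tFst (tSnd (.var 0)))) (tY (tSnd (tSnd (.var 0))))
    (.bind (tSub (tX (tSnd (tSnd (.var 0)))) (tX (tFst (tSnd (.var 0))))) <|
      .bind (.unary .exp (tSub (.const 0) (tDiv (.var 0) (tFst (.var 1))))) <|
        .bind (tMul (.var 0) (.unary .cos (tDiv (.var 1) (.const 2)))) <|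
          .bind (tMul (.var 1) (.unary .sin (tDiv (.var 2) (.const 2)))) <|
            .bind (tZ (tFst (tSnd (.var 4)))) <|
              .pair (tFst (tSnd (tSnd (.var 5))))
                (.pair (.pair (tX (tSnd (tSnd (.var 5)))) (tY (tFst (tSnd (.var 5)))))
                  (.pair (tSub (tMul (tFst (.var 0)) (.var 2)) (tMul (tSnd (.var 0)) (.var 1)))
                    (tAdd (tMul (tFst (.var 0)) (.var 1)) (tMul (tSnd (.var 0)) (.var 2))))))
    (tSnd (tSnd (.var 0)))

/-- `(t, ts, state) ↦` the result of the loop after the activation of the terminal `t`; the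
terminals `ts` remain. A state consists of `(2κ, 2π)`, the search tree, the remaining terminals and
the arcs. -/
def insertBody : Term :=
  .call 20 (.pair (tFst (tSnd (tSnd (.var 0))))
    (.pair
      (.call 14 (.pair (tFst (tSnd (tSnd (tSnd (.var 0)))))
        (.pair (tFst (tFst (.var 0))) (.pair (.pair (tFst (.var 0)) (tFst (.var 0))) .nil))))
      (.pair (tFst (tSnd (.var 0))) (tSnd (tSnd (tSnd (tSnd (tSnd (.var 0)))))))))

/-- `((a, b), state) ↦` the result of the loop after the join of the nodes `a` and `b`. -/
def joinBody : Term :=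
  .bind (.call 17 (.pair (tFst (tFst (tSnd (.var 0)))) (tFst (.var 0)))) <|
    .call 20 (.pair (tFst (tSnd (.var 1)))
      (.pair
        (.call 14 (.pair
          (.call 14 (.pair (tFst (tSnd (tSnd (.var 1)))) (.pair (tFst (tFst (tFst (.var 1)))) .nil)))
          (.pair (tFst (tSnd (tFst (.var 1)))) (.pair (.pair (.var 0) (.var 0)) .nil))))
        (.pair (tFst (tSnd (tSnd (tSnd (.var 1)))))
          (.call 16 (.pair (tFst (tFst (tSnd (.var 1)))) (.pair
            (.pair (tFst (tFst (.var 1))) (.var 0))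
            (.call 16 (.pair (tFst (tFst (tSnd (.var 1)))) (.pair
              (.pair (tSnd (tFst (.var 1))) (.var 0))
              (tSnd (tSnd (tSnd (tSnd (.var 1))))))))))))))

/-- `(t, f, ts, state) ↦` the result of the loop if `f` is the only active node, and a spiral path
leads from `f` to the terminal `t`, which is deep inside the spiral region of `f`. -/
def jumpBody : Term :=
  .bind (tFst (.var 0)) <|
  .bind (tFst (tSnd (.var 1))) <|
  .bind (tSnd (tSnd (tSnd (.var 2)))) <|
  .bind (tDiv (tSub (tSub (tX (.var 2)) (tY (.var 2))) (tSub (tX (.var 1)) (tY (.var 1))))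
    (.const 2)) <|
  .bind (tSub (.binary .arg (tFst (tZ (.var 3))) (tSnd (tZ (.var 3))))
    (.binary .arg (tFst (tZ (.var 2))) (tSnd (tZ (.var 2))))) <|
  .call 18 (.pair (.var 4) (.pair (tFst (tSnd (tSnd (.var 5))))
    (.pair (tFst (.var 2))
      (.pair (.call 14 (.pair (tFst (tSnd (.var 2))) (.pair (tFst (.var 3)) .nil)))
        (.pair .nil
          (.call 15 (.pair (.pair (tZ (.var 3)) (tZ (.var 4)))
            (.pair (.pair (tDiv (tAdd (.var 1) (.var 0)) (tFst (tFst (.var 2))))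
              (tDiv (tSub (.var 1) (.var 0)) (tFst (tFst (.var 2)))))
              (tSnd (tSnd (tSnd (.var 2))))))))))))

/-- The loop: the terminals are activated in the order of their levels, and in between the best
pair of active nodes is joined. -/
def loopBody : Term :=
  .cases (tFst (tFst (tSnd (.var 0)))) .nil <|
    .cases (.var 1)
      (.cases (tFst (tSnd (tSnd (.var 2))))
        -- a single node is left: the last arc
        (.pair
          (.pair (.pair (tZ (tFst (.var 0))) (.pair (.const 0) (.const 0)))
            (.pair .nil (.pair (.const 1) .nil)))
          (tSnd (tSnd (tSnd (.var 2)))))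
        (.ifLt
          (tSub (tSub (tX (.var 0)) (tY (.var 0)))
            (tSub (tX (tFst (.var 2))) (tY (tFst (.var 2)))))
          (tAdd (tSnd (tFst (.var 4))) (tSnd (tFst (.var 4))))
          (.call 18 (.pair (.var 0) (.pair (.var 1) (.var 4))))
          (.call 21 (.pair (.var 0) (.pair (tFst (.var 2)) (.pair (.var 1) (.var 4)))))))
      -- the last and the first node are neighbours, too
      (.bind
        (.call 9 (.pair
          (.call 10 (.pair
            (.pair (tFst (tSnd (.var 2)))
              (.pair (.pair (tSub (tX (tSnd (.var 2))) (tSnd (tFst (.var 4))))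
                (tSub (tY (tSnd (.var 2))) (tSnd (tFst (.var 4))))) (tZ (tSnd (.var 2)))))
            (tFst (.var 2))))
          (.var 3))) <|
        .cases (tFst (tSnd (tSnd (.var 5))))
          (.call 19 (.pair (tFst (.var 0)) (.var 5)))
          (.ifLt (tSub (tX (.var 0)) (tY (.var 0))) (tSnd (.var 2))
            (.call 18 (.pair (.var 0) (.pair (.var 1) (.var 7))))
            (.call 19 (.pair (tFst (.var 2)) (.var 7)))))

/-- `(α, l) ↦` the arcs of a greedy spiral tree for the terminals `l`. -/
def mainBody : Term :=
  .bind (tDiv (.unary .sin (tFst (.var 0))) (.unary .cos (tFst (.var 0)))) <|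
  .bind (tAdd (.binary .arg (.const (-1)) (.const 0)) (.binary .arg (.const (-1)) (.const 0))) <|
  .bind (.call 5 (tSnd (.var 2))) <|
  .bind (tFst (.call 3 (.pair (.var 0) (.call 6 (.pair (.var 2) (tSnd (.var 3))))))) <|
  .bind (.cases (.var 0) .nil
    (.call 8 (.pair (.var 4) (.pair (.var 2) (.pair (tFst (tFst (.var 0))) (.const 0)))))) <|
  .bind (tFst (.call 13 (.pair (.var 2) (tFst (.call 3 (.pair (.var 2) (.var 0))))))) <|
  .cases (.var 1) .nil
    (.call 18 (.pair (.var 0) (.pair (.var 1)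
      (.pair (.pair (tAdd (.var 7) (.var 7)) (.var 6)) (.pair (.var 2) (.pair .nil .nil))))))

/-- The program that computes greedy spiral trees. -/
def greedyProgram : Program :=
  [mainBody, lexBody, mergeBody, sortBody, halveBody, depthBody, itemsBody, reduceBody, nodesBody,
    betterBody, candBody, combineBody, mkBody, buildBody, updateBody, consArcBody, linkBody,
    tipBody, insertBody, joinBody, loopBody, jumpBody]

/-! ### The functions that the program computes -/

/-- A node of the tree under construction: the key of its slot in the search tree, its null
coordinates (relative to the current rotation), and its location. -/
structure Rec where
  key : ℝ × ℝ
  x : ℝ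
  y : ℝ
  z : ℂ

/-- The level of a node. -/
def Rec.lev (r : Rec) : ℝ := r.x - r.y

/-- A pair of nodes with the level of their join. -/
abbrev Cand : Type := Rec × Rec × ℝ

/-- The first node, the last node, and (if there are at least two nodes) the best pair of
neighbours. -/
abbrev Summary : Type := Option (Rec × Rec × Option Cand)

noncomputable section

/-- The lexicographic order of keys. -/
def LexLt (p q : ℝ × ℝ) : Prop := p.1 < q.1 ∨ (p.1 = q.1 ∧ p.2 < q.2)

open Classical in
/-- The lexicographic order of keys, as a truth value. -/
def lexLt (p q : ℝ × ℝ) : Bool := decide (LexLt p q)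

theorem lexLt_iff {p q : ℝ × ℝ} : lexLt p q = true ↔ LexLt p q := by
  simp [lexLt]

theorem lexLt_eq_false {p q : ℝ × ℝ} (h : ¬ LexLt p q) : lexLt p q = false := by
  simp [lexLt, h]

/-- Merges two sorted lists. -/
def mergeBy {β : Type} (key : β → ℝ × ℝ) : List β → List β → List β
  | [], l => l
  | l, [] => l
  | a :: l, b :: l' =>
    if lexLt (key b) (key a) then b :: mergeBy key (a :: l) l' else a :: mergeBy key l (b :: l')
termination_by l l' => l.length + l'.length

/-- The first `2 ^ d` elements of a list, sorted, and the remaining elements. -/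
def sortBy {β : Type} (key : β → ℝ × ℝ) : ℕ → List β → List β × List β
  | 0, [] => ([], [])
  | 0, a :: l => ([a], l)
  | d + 1, l =>
    let r := sortBy key d l
    let r' := sortBy key d r.2
    (mergeBy key r.1 r'.1, r'.2)

/-- Every second element of a list. -/
def halve {β : Type} : List β → List β
  | [] => []
  | [a] => [a]
  | a :: _ :: l => a :: halve l

theorem length_halve {β : Type} : ∀ l : List β, (halve l).length = (l.length + 1) / 2
  | [] => by simp [halve]
  | [_] => by simp [halve]
  | _ :: _ :: l => by simp [halve, length_halve l]; omega

/-- The number of halvings after which at most one element of a list remains. -/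
def depth {β : Type} : List β → ℕ
  | [] => 0
  | [_] => 0
  | a :: b :: l => depth (halve (a :: b :: l)) + 1
termination_by l => l.length
decreasing_by rw [length_halve]; simp; omega

/-- A point with its level and its polar angle. -/
def item (κ : ℝ) (z : ℂ) : (ℝ × ℝ) × ℂ :=
  ((0 - κ * Real.log (z.re * z.re + z.im * z.im), Complex.arg ⟨z.re, z.im⟩), z)

/-- One step of the reduction modulo `p`. -/
def reduce (p u : ℝ) : ℝ := if u < p then u else u - p

/-- The reduced rotation, if the level increases from `lev` to `lev'`. After a large increase, the
rotation starts anew. -/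
def nextRot (tp lev ρ lev' : ℝ) : ℝ :=
  if lev' - lev < 20 then reduce tp (reduce tp (ρ + (lev' - lev) / 2)) else 0

/-- The first null coordinate of a point with polar angle `φ`, reduced to `[0, 2π)`. -/
def coordX (tp φ ρ : ℝ) : ℝ := if φ + ρ < 0 then φ + ρ + tp else reduce tp (φ + ρ)

/-- The nodes for a list of items that is sorted by level. -/
def nodes (tp : ℝ) : List ((ℝ × ℝ) × ℂ) → ℝ → ℝ → List Rec
  | [], _, _ => []
  | i :: l, lev, ρ =>
    let ρ' := nextRot tp lev ρ i.1.1
    let x := coordX tp i.1.2 ρ'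
    ⟨(x, x - i.1.1), x, x - i.1.1, i.2⟩ :: nodes tp l i.1.1 ρ'

/-- The level of the join of two nodes, the second of which has the larger first coordinate. -/
def joinLev (a b : Rec) : ℝ := if a.y < b.y then b.x - a.y else b.x - b.y

/-- The candidate for two neighbours. -/
def cand (a b : Rec) : Cand := (a, b, joinLev a b)

/-- The better one of two candidates. -/
def better (c : Cand) : Option Cand → Cand
  | none => c
  | some d => if d.2.2 < c.2.2 then d else c

/-- The summary of the concatenation of two sequences of nodes. -/
def combine : Summary → Summary → Summary
  | none, s => s
  | s, none => s
  | some (f, l, b), some (f', l', b') => some (f, l', some (better (better (cand l f') b) b'))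

/-- The summary of a single node. -/
def single (r : Rec) : Summary := some (r, r, none)

/-- Search trees, with a slot for a node in each leaf. -/
inductive Tree where
  | leaf (key : ℝ × ℝ) (o : Option Rec)
  | node (split : ℝ × ℝ) (l r : Tree)

/-- The summary of the nodes in a search tree. -/
def Tree.summary : Tree → Summary
  | .leaf _ o => o.bind single
  | .node _ l r => combine l.summary r.summary

/-- The height of a search tree. -/
def Tree.height : Tree → ℕ
  | .leaf _ _ => 0
  | .node _ l r => max l.height r.height + 1

/-- Changes the slot with a given key. -/
def Tree.update : Tree → ℝ × ℝ → Option Rec → Tree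
  | .leaf k _, _, o => .leaf k o
  | .node s l r, k, o =>
    if lexLt k s then .node s (l.update k o) r else .node s l (r.update k o)

/-- A search tree with empty slots for the first `2 ^ d` elements of a sorted list, and the
remaining elements. -/
def build : ℕ → List Rec → Tree × List Rec
  | 0, [] => (.leaf (0, 0) none, [])
  | 0, a :: l => (.leaf a.key none, l)
  | d + 1, l =>
    let r := build d l
    match r.2 with
    | [] => (r.1, [])
    | h :: t => let r' := build d (h :: t)
      (.node h.key r.1 r'.1, r'.2)

/-- An arc that follows first the right and then the left spiral: its endpoints and the two
parameters. -/
structure RawArc where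
  start : ℂ
  finish : ℂ
  s : ℝ
  t : ℝ

/-- Adds an arc from `u` to `p`, unless these nodes are equal. -/
def link (κ2 : ℝ) (u p : Rec) (l : List RawArc) : List RawArc :=
  if u.x < p.x ∨ p.y < u.y then ⟨u.z, p.z, (p.x - u.x) / κ2, (u.y - p.y) / κ2⟩ :: l else l

/-- The join node of `a` and `b`, in the slot of `b`. -/
def tip (κ2 : ℝ) (a b : Rec) : Rec :=
  if a.y < b.y then
    let w := b.x - a.x
    let c := Real.exp (0 - w / κ2) * Real.cos (w / 2)
    let d := Real.exp (0 - w / κ2) * Real.sin (w / 2)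
    ⟨b.key, b.x, a.y, ⟨a.z.re * c - a.z.im * d, a.z.re * d + a.z.im * c⟩⟩
  else b

/-- The state of the loop: the search tree with the active nodes that have been reached, the
remaining terminals, and the arcs. -/
structure State where
  tree : Tree
  pending : List Rec
  arcs : List RawArc

/-- Activates a terminal. -/
def State.insert (st : State) (t : Rec) (ts : List Rec) : State :=
  ⟨st.tree.update t.key (some t), ts, st.arcs⟩

/-- Joins two active nodes. -/
def State.join (κ2 : ℝ) (st : State) (a b : Rec) : State :=
  ⟨(st.tree.update a.key none).update b.key (some (tip κ2 a b)), st.pending,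
    link κ2 a (tip κ2 a b) (link κ2 b (tip κ2 a b) st.arcs)⟩

/-- The arc from an active node to a terminal deep inside its spiral region. -/
def jumpArc (κ2 : ℝ) (f t : Rec) : RawArc :=
  let g := (t.x - t.y - (f.x - f.y)) / 2
  let δ := Complex.arg ⟨t.z.re, t.z.im⟩ - Complex.arg ⟨f.z.re, f.z.im⟩
  ⟨f.z, t.z, (g + δ) / κ2, (g - δ) / κ2⟩

/-- Connects the only active node `f` with the terminal `t`. -/
def State.jump (κ2 : ℝ) (st : State) (f t : Rec) (ts : List Rec) : State :=
  State.insert ⟨st.tree.update f.key none, [], jumpArc κ2 f t :: st.arcs⟩ t ts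

/-- The node that is one turn before `r`. -/
def Rec.back (tp : ℝ) (r : Rec) : Rec := ⟨r.key, r.x - tp, r.y - tp, r.z⟩

/-- One step of the loop; there is none when a single active node is left. -/
def State.step (κ2 tp : ℝ) (st : State) : Option State :=
  match st.tree.summary with
  | none => none
  | some (f, l, b) =>
    match b with
    | none =>
      match st.pending with
      | [] => none
      | t :: ts =>
        if t.lev - f.lev < tp + tp then some (st.insert t ts) else some (st.jump κ2 f t ts)
    | some b =>
      let c := better (cand (l.back tp) f) (some b)
      match st.pending with
      | [] => some (st.join κ2 c.1 c.2.1)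
      | t :: ts => if t.lev < c.2.2 then some (st.insert t ts) else some (st.join κ2 c.1 c.2.1)

/-! ### Evaluation of the functions of the program -/

/-- The encoding of keys. -/
def encKey (p : ℝ × ℝ) : Value := .pair (.real p.1) (.real p.2)

/-- The encoding of truth values. -/
def encBool : Bool → Value
  | true => .pair .nil .nil
  | false => .nil

/-- The unary encoding of natural numbers. -/
def encNat : ℕ → Value
  | 0 => .nil
  | n + 1 => .pair .nil (encNat n)

/-- The encoding of items. -/
def encItem (i : (ℝ × ℝ) × ℂ) : Value := .pair (encKey i.1) (encodePoint i.2)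

/-- The encoding of nodes. -/
def encRec (r : Rec) : Value :=
  .pair (encKey r.key) (.pair (.pair (.real r.x) (.real r.y)) (encodePoint r.z))

/-- The encoding of candidates. -/
def encCand (c : Cand) : Value := .pair (.pair (encRec c.1) (encRec c.2.1)) (.real c.2.2)

/-- The encoding of optional candidates. -/
def encBest : Option Cand → Value
  | none => .nil
  | some c => encCand c

/-- The encoding of summaries. -/
def encSummary : Summary → Value
  | none => .nil
  | some s => .pair (.pair (encRec s.1) (encRec s.2.1)) (encBest s.2.2)

/-- The encoding of search trees: the summaries are stored. -/
def encTree : Tree → Value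
  | .leaf k o => .pair (encSummary (Tree.leaf k o).summary) .nil
  | .node s l r => .pair (encSummary (Tree.node s l r).summary)
      (.pair (encKey s) (.pair (encTree l) (encTree r)))

/-- The encoding of arcs, in the output format. -/
def encRaw (a : RawArc) : Value :=
  .pair (.pair (encodePoint a.start) (encodePoint a.finish))
    (.pair (.pair (.pair (.real 1) (.real a.s)) (.pair (.pair (.real (-1)) (.real a.t)) .nil)) .nil)

/-- The encoding of the state of the loop. -/
def encState (κ2 tp : ℝ) (st : State) : Value :=
  .pair (.pair (.real κ2) (.real tp))
    (.pair (encTree st.tree) (.pair (encodeList encRec st.pending) (encodeList encRaw st.arcs)))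

/-! The step bounds in the following lemmas are generous: only their order of growth matters. -/

theorem ev_lex (p q : ℝ × ℝ) :
    Ev greedyProgram [.pair (encKey p) (encKey q)] lexBody (encBool (lexLt p q)) 60 := by
  refine Ev.mono (Ev.ifLt (x := p.1) (y := q.1) (Ev.tfst (Ev.tfst (.var rfl)))
    (Ev.tfst (Ev.tsnd (.var rfl))) (m := 3) (n := 27) (fun h => ?_) (fun h => ?_)) (by norm_num)
  · rw [lexLt_iff.2 (Or.inl h)]
    exact .pair .nil .nil
  · refine Ev.ifLt (x := q.1) (y := p.1) (Ev.tfst (Ev.tsnd (.var rfl)))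
      (Ev.tfst (Ev.tfst (.var rfl))) (m := 1) (n := 15) (fun h' => ?_) (fun h' => ?_)
    · rw [lexLt_eq_false (by rintro (h | h) <;> linarith)]
      exact .nil
    · have he : p.1 = q.1 := by linarith
      refine Ev.ifLt (x := p.2) (y := q.2) (Ev.tsnd (Ev.tfst (.var rfl)))
        (Ev.tsnd (Ev.tsnd (.var rfl))) (m := 3) (n := 1) (fun h'' => ?_) (fun h'' => ?_)
      · rw [lexLt_iff.2 (Or.inr ⟨he, h''⟩)]
        exact .pair .nil .nil
      · rw [lexLt_eq_false (by rintro (h | h); exacts [by linarith, h'' h.2])]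
        exact .nil

theorem ev_merge {β : Type} (key : β → ℝ × ℝ) (enc : β → Value)
    (henc : ∀ b, ∃ v, enc b = .pair (encKey (key b)) v) (l l' : List β) :
    Ev greedyProgram [.pair (encodeList enc l) (encodeList enc l')] mergeBody
      (encodeList enc (mergeBy key l l')) (200 * (l.length + l'.length) + 20) := by
  induction h : l.length + l'.length generalizing l l' with
  | zero =>
    obtain ⟨rfl, rfl⟩ : l = [] ∧ l' = [] := by
      constructor <;> apply List.eq_nil_of_length_eq_zero <;> omega
    rw [mergeBy]
    refine Ev.mono (Ev.cases_nil (Ev.tfst (.var rfl)) (Ev.tsnd (.var rfl))) (by norm_num)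
  | succ n ih =>
    cases l with
    | nil =>
      rw [mergeBy]
      refine Ev.mono (Ev.cases_nil (Ev.tfst (.var rfl)) (Ev.tsnd (.var rfl))) (by omega)
    | cons a l =>
      cases l' with
      | nil =>
        rw [mergeBy]
        · refine Ev.mono (Ev.cases_pair (Ev.tfst (.var rfl))
            (Ev.cases_nil (Ev.tsnd (.var rfl)) (Ev.tfst (.var rfl)))) (by omega)
        · simp
      | cons b l' =>
        obtain ⟨v, hv⟩ := henc a
        obtain ⟨w, hw⟩ := henc b
        have hlex := ev_lex (key b) (key a)
        rw [mergeBy]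
        cases hb : lexLt (key b) (key a) with
        | true =>
          have ih' := ih (a :: l) l' (by simp only [List.length_cons] at h ⊢; omega)
          rw [hb] at hlex
          simp only [if_true]
          simp only [encodeList, hv, hw] at ih' ⊢
          refine Ev.mono (Ev.cases_pair (Ev.tfst (.var rfl)) (Ev.cases_pair (Ev.tsnd (.var rfl))
            (Ev.cases_pair (Ev.call (Ev.pair (Ev.tfst (.var rfl)) (Ev.tfst (.var rfl))) rfl hlex)
            (Ev.pair (.var rfl) (Ev.call (Ev.pair (Ev.tfst (.var rfl)) (.var rfl)) rfl ih'))))) ?_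
          omega
        | false =>
          have ih' := ih l (b :: l') (by simp only [List.length_cons] at h ⊢; omega)
          rw [hb] at hlex
          simp only [Bool.false_eq_true, if_false]
          simp only [encodeList, hv, hw] at ih' ⊢
          refine Ev.mono (Ev.cases_pair (Ev.tfst (.var rfl)) (Ev.cases_pair (Ev.tsnd (.var rfl))
            (Ev.cases_nil (Ev.call (Ev.pair (Ev.tfst (.var rfl)) (Ev.tfst (.var rfl))) rfl hlex)
            (Ev.pair (.var rfl) (Ev.call (Ev.pair (.var rfl) (Ev.tsnd (.var rfl))) rfl ih'))))) ?_
          omega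

theorem length_mergeBy {β : Type} (key : β → ℝ × ℝ) (l l' : List β) :
    (mergeBy key l l').length = l.length + l'.length := by
  fun_induction mergeBy key l l' <;> simp_all <;> omega

theorem length_sortBy_fst_le {β : Type} (key : β → ℝ × ℝ) (d : ℕ) (l : List β) :
    (sortBy key d l).1.length ≤ 2 ^ d := by
  induction d generalizing l with
  | zero => cases l <;> simp [sortBy]
  | succ d ih =>
    rw [sortBy, length_mergeBy, pow_succ, mul_two]
    exact Nat.add_le_add (ih _) (ih _)

theorem ev_sort {β : Type} (key : β → ℝ × ℝ) (enc : β → Value)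
    (henc : ∀ b, ∃ v, enc b = .pair (encKey (key b)) v) (d : ℕ) (l : List β) :
    Ev greedyProgram [.pair (encNat d) (encodeList enc l)] sortBody
      (.pair (encodeList enc (sortBy key d l).1) (encodeList enc (sortBy key d l).2))
      ((300 * d + 100) * 2 ^ d) := by
  induction d generalizing l with
  | zero =>
    cases l with
    | nil =>
      refine Ev.mono (Ev.cases_nil (Ev.tfst (.var rfl)) (Ev.cases_nil (Ev.tsnd (.var rfl))
        (Ev.pair .nil .nil))) (by norm_num)
    | cons a l =>
      refine Ev.mono (Ev.cases_nil (Ev.tfst (.var rfl)) (Ev.cases_pair (Ev.tsnd (.var rfl))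
        (Ev.pair (Ev.pair (.var rfl) .nil) (.var rfl)))) (by norm_num)
  | succ d ih =>
    have h1 := ih l
    have h2 := ih (sortBy key d l).2
    have h3 := ev_merge key enc henc (sortBy key d l).1 (sortBy key d (sortBy key d l).2).1
    refine Ev.mono (Ev.cases_pair (Ev.tfst (.var rfl))
      (Ev.bind (Ev.call (Ev.pair (.var rfl) (Ev.tsnd (.var rfl))) rfl h1)
      (Ev.bind (Ev.call (Ev.pair (.var rfl) (Ev.tsnd (.var rfl))) rfl h2)
      (Ev.pair (Ev.call (Ev.pair (Ev.tfst (.var rfl)) (Ev.tfst (.var rfl))) rfl h3)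
        (Ev.tsnd (.var rfl)))))) ?_
    have h4 := length_sortBy_fst_le key d l
    have h5 := length_sortBy_fst_le key d (sortBy key d l).2
    have h6 : 1 ≤ 2 ^ d := Nat.one_le_two_pow
    rw [pow_succ]
    nlinarith

theorem ev_halve {β : Type} (enc : β → Value) :
    ∀ l : List β, Ev greedyProgram [encodeList enc l] halveBody (encodeList enc (halve l))
      (20 * l.length + 20)
  | [] => (Ev.cases_nil (.var rfl) .nil).mono (by simp)
  | [_] => (Ev.cases_pair (.var rfl) (Ev.cases_nil (.var rfl) (Ev.pair (.var rfl) .nil))).mono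
      (by simp)
  | _ :: _ :: l => (Ev.cases_pair (.var rfl) (Ev.cases_pair (.var rfl)
      (Ev.pair (.var rfl) (Ev.call (.var rfl) rfl (ev_halve enc l))))).mono
      (by simp only [List.length_cons]; omega)

theorem ev_depth {β : Type} (enc : β → Value) (l : List β) :
    Ev greedyProgram [encodeList enc l] depthBody (encNat (depth l)) (200 * l.length + 10) := by
  induction h : l.length using Nat.strong_induction_on generalizing l with
  | _ n ih =>
    match l, h with
    | [], h => rw [depth]; exact (Ev.cases_nil (.var rfl) .nil).mono (by omega)
    | [a], h =>
      rw [depth]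
      exact (Ev.cases_pair (.var rfl) (Ev.cases_nil (.var rfl) .nil)).mono (by omega)
    | a :: b :: l, h =>
      rw [depth]
      have h1 := ev_halve enc (a :: b :: l)
      have hlen := length_halve (a :: b :: l)
      rw [h] at hlen h1
      have h2 : 2 ≤ n := by rw [← h]; simp
      have h3 := ih _ (by omega) (halve (a :: b :: l)) hlen
      refine Ev.mono (Ev.cases_pair (.var rfl) (Ev.cases_pair (.var rfl)
        (Ev.pair .nil (Ev.call (Ev.call (.var rfl) rfl h1) rfl h3)))) ?_
      omega

theorem ev_items (κ : ℝ) : ∀ l : List ℂ,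
    Ev greedyProgram [.pair (.real κ) (encodeList encodePoint l)] itemsBody
      (encodeList encItem (l.map (item κ))) (100 * l.length + 20)
  | [] => (Ev.cases_nil (Ev.tsnd (.var rfl)) .nil).mono (by simp)
  | z :: l => by
    refine Ev.mono (Ev.cases_pair (Ev.tsnd (.var rfl)) (Ev.pair (Ev.pair (Ev.pair
      (Ev.sub .zero (Ev.mul (Ev.tfst (.var rfl)) (Ev.log (Ev.add
        (Ev.mul (Ev.tfst (.var rfl)) (Ev.tfst (.var rfl)))
        (Ev.mul (Ev.tsnd (.var rfl)) (Ev.tsnd (.var rfl)))))))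
      (Ev.arg (Ev.tfst (.var rfl)) (Ev.tsnd (.var rfl)))) (.var rfl))
      (Ev.call (Ev.pair (Ev.tfst (.var rfl)) (.var rfl)) rfl (ev_items κ l)))) ?_
    simp only [List.length_cons]
    omega

theorem ev_reduce (p u : ℝ) :
    Ev greedyProgram [.pair (.real p) (.real u)] reduceBody (.real (reduce p u)) 30 := by
  refine Ev.mono (Ev.ifLt (Ev.tsnd (.var rfl)) (Ev.tfst (.var rfl)) (m := 3) (n := 7)
    (fun h => ?_) (fun h => ?_)) (by norm_num)
  · rw [reduce, if_pos h]
    exact Ev.tsnd (.var rfl)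
  · rw [reduce, if_neg h]
    exact Ev.sub (Ev.tsnd (.var rfl)) (Ev.tfst (.var rfl))

theorem ev_nodes (tp : ℝ) (l : List ((ℝ × ℝ) × ℂ)) (lev ρ : ℝ) :
    Ev greedyProgram [.pair (.real tp) (.pair (encodeList encItem l)
      (.pair (.real lev) (.real ρ)))] nodesBody (encodeList encRec (nodes tp l lev ρ))
      (500 * l.length + 20) := by
  induction l generalizing lev ρ with
  | nil => exact (Ev.cases_nil (Ev.tfst (Ev.tsnd (.var rfl))) .nil).mono (by simp)
  | cons i l ih =>
    refine Ev.mono (Ev.cases_pair (Ev.tfst (Ev.tsnd (.var rfl)))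
      (Ev.bind (v := .real (nextRot tp lev ρ i.1.1)) (k := 200) ?_
      (Ev.bind (v := .real (coordX tp i.1.2 (nextRot tp lev ρ i.1.1))) (k := 100) ?_
      (Ev.bind (Ev.sub (.var rfl) (Ev.tfst (Ev.tfst (.var rfl))))
      (Ev.pair (Ev.pair (Ev.pair (.var rfl) (.var rfl)) (Ev.pair (Ev.pair (.var rfl) (.var rfl))
        (Ev.tsnd (.var rfl))))
      (Ev.call (Ev.pair (Ev.tfst (.var rfl)) (Ev.pair (.var rfl)
        (Ev.pair (Ev.tfst (Ev.tfst (.var rfl))) (.var rfl)))) rfl (ih _ _))))))) ?_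
    · refine Ev.mono (Ev.ifLt (Ev.sub (Ev.tfst (Ev.tfst (.var rfl)))
        (Ev.tfst (Ev.tsnd (Ev.tsnd (.var rfl))))) .twenty (m := 120) (n := 1)
        (fun h => ?_) (fun h => ?_)) (by norm_num)
      · rw [nextRot, if_pos h]
        refine Ev.mono (Ev.call (Ev.pair (Ev.tfst (.var rfl)) (Ev.call (Ev.pair (Ev.tfst (.var rfl))
          (Ev.add (Ev.tsnd (Ev.tsnd (Ev.tsnd (.var rfl)))) (Ev.div
          (Ev.sub (Ev.tfst (Ev.tfst (.var rfl))) (Ev.tfst (Ev.tsnd (Ev.tsnd (.var rfl))))) .two)))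
          rfl (ev_reduce _ _))) rfl (ev_reduce _ _)) (by norm_num)
      · rw [nextRot, if_neg h]
        exact .zero
    · refine Ev.mono (Ev.ifLt (Ev.add (Ev.tsnd (Ev.tfst (.var rfl))) (.var rfl)) .zero
        (m := 11) (n := 50) (fun h => ?_) (fun h => ?_)) (by norm_num)
      · rw [coordX, if_pos h]
        exact Ev.mono (Ev.add (Ev.add (Ev.tsnd (Ev.tfst (.var rfl))) (.var rfl))
          (Ev.tfst (.var rfl))) (by norm_num)
      · rw [coordX, if_neg h]
        exact Ev.mono (Ev.call (Ev.pair (Ev.tfst (.var rfl)) (Ev.add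
          (Ev.tsnd (Ev.tfst (.var rfl))) (.var rfl))) rfl (ev_reduce _ _)) (by norm_num)
    · simp only [List.length_cons]
      omega

theorem ev_better (c : Cand) (o : Option Cand) :
    Ev greedyProgram [.pair (encCand c) (encBest o)] betterBody (encCand (better c o)) 30 := by
  cases o with
  | none => exact (Ev.cases_nil (Ev.tsnd (.var rfl)) (Ev.tfst (.var rfl))).mono (by norm_num)
  | some d =>
    refine Ev.mono (Ev.cases_pair (Ev.tsnd (.var rfl)) (Ev.ifLt (.var rfl)
      (Ev.tsnd (Ev.tfst (.var rfl))) (m := 3) (n := 3) (fun h => ?_) (fun h => ?_))) (by norm_num)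
    · rw [better, if_pos h]
      exact Ev.tsnd (.var rfl)
    · rw [better, if_neg h]
      exact Ev.tfst (.var rfl)

theorem ev_cand (a b : Rec) :
    Ev greedyProgram [.pair (encRec a) (encRec b)] candBody (encCand (cand a b)) 80 := by
  refine Ev.mono (Ev.ifLt (x := a.y) (y := b.y)
    (Ev.tsnd (Ev.tfst (Ev.tsnd (Ev.tfst (.var rfl)))))
    (Ev.tsnd (Ev.tfst (Ev.tsnd (Ev.tsnd (.var rfl))))) (m := 21) (n := 21)
    (fun h => ?_) (fun h => ?_)) (by norm_num)
  · rw [cand, joinLev, if_pos h]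
    exact Ev.mono (Ev.pair (.var rfl) (Ev.sub (Ev.tfst (Ev.tfst (Ev.tsnd (Ev.tsnd (.var rfl)))))
      (Ev.tsnd (Ev.tfst (Ev.tsnd (Ev.tfst (.var rfl))))))) (by norm_num)
  · rw [cand, joinLev, if_neg h]
    exact Ev.mono (Ev.pair (.var rfl) (Ev.sub (Ev.tfst (Ev.tfst (Ev.tsnd (Ev.tsnd (.var rfl)))))
      (Ev.tsnd (Ev.tfst (Ev.tsnd (Ev.tsnd (.var rfl))))))) (by norm_num)

theorem ev_combine (s s' : Summary) :
    Ev greedyProgram [.pair (encSummary s) (encSummary s')] combineBody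
      (encSummary (combine s s')) 250 := by
  match s, s' with
  | none, s' =>
    rw [combine]
    exact (Ev.cases_nil (Ev.tfst (.var rfl)) (Ev.tsnd (.var rfl))).mono (by norm_num)
  | some s, none =>
    rw [combine]
    · exact (Ev.cases_pair (Ev.tfst (.var rfl)) (Ev.cases_nil (Ev.tsnd (.var rfl))
        (Ev.tfst (.var rfl)))).mono (by norm_num)
    · simp
  | some (f, l, b), some (f', l', b') =>
    rw [combine]
    exact Ev.mono (Ev.cases_pair (Ev.tfst (.var rfl)) (Ev.cases_pair (Ev.tsnd (.var rfl))
      (Ev.pair (Ev.pair (Ev.tfst (.var rfl)) (Ev.tsnd (.var rfl)))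
      (Ev.call (Ev.pair (Ev.call (Ev.pair (Ev.call (Ev.pair (Ev.tsnd (.var rfl))
        (Ev.tfst (.var rfl))) rfl (ev_cand l f')) (.var rfl)) rfl (ev_better _ b)) (.var rfl)) rfl
        (ev_better _ b'))))) (by norm_num)

theorem exists_encTree (t : Tree) : ∃ v, encTree t = .pair (encSummary t.summary) v := by
  cases t <;> exact ⟨_, rfl⟩

theorem ev_mk (s : ℝ × ℝ) (l r : Tree) :
    Ev greedyProgram [.pair (encKey s) (.pair (encTree l) (encTree r))] mkBody
      (encTree (.node s l r)) 280 := by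
  have h := ev_combine l.summary r.summary
  rw [encTree]
  obtain ⟨v, hv⟩ := exists_encTree l
  obtain ⟨w, hw⟩ := exists_encTree r
  rw [hv, hw]
  exact Ev.mono (Ev.pair (Ev.call (Ev.pair (Ev.tfst (Ev.tfst (Ev.tsnd (.var rfl))))
    (Ev.tfst (Ev.tsnd (Ev.tsnd (.var rfl))))) rfl h) (.var rfl)) (by norm_num)

theorem ev_update (t : Tree) (k : ℝ × ℝ) (o : Option Rec) :
    Ev greedyProgram [.pair (encTree t) (.pair (encKey k) (encSummary (o.bind single)))]
      updateBody (encTree (t.update k o)) (500 * t.height + 20) := by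
  induction t with
  | leaf k' o' =>
    exact Ev.mono (Ev.cases_nil (Ev.tsnd (Ev.tfst (.var rfl)))
      (Ev.pair (Ev.tsnd (Ev.tsnd (.var rfl))) .nil)) (by norm_num)
  | node s l r ihl ihr =>
    have hlex := ev_lex k s
    rw [Tree.update]
    cases hb : lexLt k s with
    | true =>
      rw [hb] at hlex
      simp only [if_true]
      refine Ev.mono (Ev.cases_pair (Ev.tsnd (Ev.tfst (.var rfl))) (Ev.cases_pair
        (Ev.call (Ev.pair (Ev.tfst (Ev.tsnd (.var rfl))) (.var rfl)) rfl hlex)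
        (Ev.call (Ev.pair (.var rfl) (Ev.pair (Ev.call (Ev.pair (Ev.tfst (.var rfl))
          (Ev.tsnd (.var rfl))) rfl ihl) (Ev.tsnd (.var rfl)))) rfl (ev_mk _ _ _)))) ?_
      rw [Tree.height]
      have := le_max_left l.height r.height
      omega
    | false =>
      rw [hb] at hlex
      simp only [Bool.false_eq_true, if_false]
      refine Ev.mono (Ev.cases_pair (Ev.tsnd (Ev.tfst (.var rfl))) (Ev.cases_nil
        (Ev.call (Ev.pair (Ev.tfst (Ev.tsnd (.var rfl))) (.var rfl)) rfl hlex)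
        (Ev.call (Ev.pair (.var rfl) (Ev.pair (Ev.tfst (.var rfl)) (Ev.call (Ev.pair
          (Ev.tsnd (.var rfl)) (Ev.tsnd (.var rfl))) rfl ihr))) rfl (ev_mk _ _ _)))) ?_
      rw [Tree.height]
      have := le_max_right l.height r.height
      omega

theorem ev_build (d : ℕ) (l : List Rec) (hl : l ≠ []) :
    Ev greedyProgram [.pair (encNat d) (encodeList encRec l)] buildBody
      (.pair (encTree (build d l).1) (encodeList encRec (build d l).2))
      (800 * 2 ^ d - 400) := by
  induction d generalizing l with
  | zero =>
    match l, hl with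
    | a :: l, _ =>
      exact Ev.mono (Ev.cases_nil (Ev.tfst (.var rfl)) (Ev.cases_pair (Ev.tsnd (.var rfl))
        (Ev.pair (Ev.pair .nil .nil) (.var rfl)))) (by norm_num)
  | succ d ih =>
    have h1 := ih l hl
    have h6 : 1 ≤ 2 ^ d := Nat.one_le_two_pow
    rw [build]
    cases hr : (build d l).2 with
    | nil =>
      rw [hr] at h1
      refine Ev.mono (Ev.cases_pair (Ev.tfst (.var rfl))
        (Ev.bind (Ev.call (Ev.pair (.var rfl) (Ev.tsnd (.var rfl))) rfl h1)
        (Ev.cases_nil (Ev.tsnd (.var rfl)) (.var rfl)))) ?_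
      omega
    | cons h t =>
      have h2 := ih (h :: t) (by simp)
      rw [hr] at h1
      refine Ev.mono (Ev.cases_pair (Ev.tfst (.var rfl))
        (Ev.bind (Ev.call (Ev.pair (.var rfl) (Ev.tsnd (.var rfl))) rfl h1)
        (Ev.cases_pair (Ev.tsnd (.var rfl))
        (Ev.bind (Ev.call (Ev.pair (.var rfl) (Ev.tsnd (.var rfl))) rfl h2)
        (Ev.pair (Ev.call (Ev.pair (Ev.tfst (.var rfl)) (Ev.pair (Ev.tfst (.var rfl))
          (Ev.tfst (.var rfl)))) rfl (ev_mk _ _ _)) (Ev.tsnd (.var rfl))))))) ?_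
      omega

theorem ev_consArc (a : RawArc) (v : Value) :
    Ev greedyProgram [.pair (.pair (encodePoint a.start) (encodePoint a.finish))
      (.pair (.pair (.real a.s) (.real a.t)) v)] consArcBody (.pair (encRaw a) v) 50 :=
  Ev.mono (Ev.pair (Ev.pair (Ev.tfst (.var rfl)) (Ev.pair (Ev.pair (Ev.pair .one
    (Ev.tfst (Ev.tfst (Ev.tsnd (.var rfl))))) (Ev.pair (Ev.pair .neg_one
    (Ev.tsnd (Ev.tfst (Ev.tsnd (.var rfl))))) .nil)) .nil)) (Ev.tsnd (Ev.tsnd (.var rfl))))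
    (by norm_num)

section Nodes

variable {P : Program} {env : List Value} {e : Term} {r : Rec} {k : ℕ}

theorem Ev.x (h : Ev P env e (encRec r) k) : Ev P env (tX e) (.real r.x) (k + 6) :=
  Ev.tfst (Ev.tfst (Ev.tsnd h))

theorem Ev.y (h : Ev P env e (encRec r) k) : Ev P env (tY e) (.real r.y) (k + 6) :=
  Ev.tsnd (Ev.tfst (Ev.tsnd h))

theorem Ev.z (h : Ev P env e (encRec r) k) : Ev P env (tZ e) (encodePoint r.z) (k + 4) :=
  Ev.tsnd (Ev.tsnd h)

end Nodes

theorem ev_link (κ2 : ℝ) (u p : Rec) (l : List RawArc) :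
    Ev greedyProgram [.pair (.real κ2) (.pair (.pair (encRec u) (encRec p)) (encodeList encRaw l))]
      linkBody (encodeList encRaw (link κ2 u p l)) 400 := by
  have h := ev_consArc ⟨u.z, p.z, (p.x - u.x) / κ2, (u.y - p.y) / κ2⟩ (encodeList encRaw l)
  refine Ev.mono (Ev.bind (Ev.pair (Ev.pair (Ev.z (r := u) (Ev.tfst (Ev.tfst (Ev.tsnd (.var rfl)))))
    (Ev.z (r := p) (Ev.tsnd (Ev.tfst (Ev.tsnd (.var rfl)))))) (Ev.pair (Ev.pair
      (Ev.div (Ev.sub (Ev.x (r := p) (Ev.tsnd (Ev.tfst (Ev.tsnd (.var rfl)))))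
        (Ev.x (r := u) (Ev.tfst (Ev.tfst (Ev.tsnd (.var rfl)))))) (Ev.tfst (.var rfl)))
      (Ev.div (Ev.sub (Ev.y (r := u) (Ev.tfst (Ev.tfst (Ev.tsnd (.var rfl)))))
        (Ev.y (r := p) (Ev.tsnd (Ev.tfst (Ev.tsnd (.var rfl)))))) (Ev.tfst (.var rfl))))
      (Ev.tsnd (Ev.tsnd (.var rfl)))))
    (Ev.ifLt (x := u.x) (y := p.x) (Ev.x (r := u) (Ev.tfst (Ev.tfst (Ev.tsnd (.var rfl)))))
      (Ev.x (r := p) (Ev.tsnd (Ev.tfst (Ev.tsnd (.var rfl))))) (m := 52) (n := 100)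
      (fun h1 => ?_) (fun h1 => ?_))) (by norm_num)
  · rw [link, if_pos (Or.inl h1)]
    exact Ev.call (.var rfl) rfl h
  · refine Ev.mono (Ev.ifLt (x := p.y) (y := u.y)
      (Ev.y (r := p) (Ev.tsnd (Ev.tfst (Ev.tsnd (.var rfl)))))
      (Ev.y (r := u) (Ev.tfst (Ev.tfst (Ev.tsnd (.var rfl))))) (m := 52) (n := 5)
      (fun h2 => ?_) (fun h2 => ?_)) (by norm_num)
    · rw [link, if_pos (Or.inr h2)]
      exact Ev.call (.var rfl) rfl h
    · rw [link, if_neg (by rintro (h | h); exacts [h1 h, h2 h])]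
      exact Ev.tsnd (Ev.tsnd (.var rfl))

theorem ev_tip (κ2 : ℝ) (a b : Rec) (h : |(b.x - a.x) / 2| ≤ Real.pi) :
    Ev greedyProgram [.pair (.real κ2) (.pair (encRec a) (encRec b))] tipBody
      (encRec (tip κ2 a b)) 300 := by
  refine Ev.mono (Ev.ifLt (x := a.y) (y := b.y) (Ev.y (r := a) (Ev.tfst (Ev.tsnd (.var rfl))))
    (Ev.y (r := b) (Ev.tsnd (Ev.tsnd (.var rfl)))) (m := 200) (n := 5) (fun h1 => ?_)
    (fun h1 => ?_)) (by norm_num)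
  · rw [tip, if_pos h1]
    exact Ev.mono (Ev.bind (Ev.sub (Ev.x (r := b) (Ev.tsnd (Ev.tsnd (.var rfl))))
      (Ev.x (r := a) (Ev.tfst (Ev.tsnd (.var rfl)))))
      (Ev.bind (Ev.exp (Ev.sub .zero (Ev.div (.var rfl) (Ev.tfst (.var rfl)))))
      (Ev.bind (Ev.mul (.var rfl) (Ev.cos h (Ev.div (.var rfl) .two)))
      (Ev.bind (Ev.mul (.var rfl) (Ev.sin h (Ev.div (.var rfl) .two)))
      (Ev.bind (Ev.z (r := a) (Ev.tfst (Ev.tsnd (.var rfl))))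
      (Ev.pair (Ev.tfst (Ev.tsnd (Ev.tsnd (.var rfl))))
      (Ev.pair (Ev.pair (Ev.x (r := b) (Ev.tsnd (Ev.tsnd (.var rfl))))
        (Ev.y (r := a) (Ev.tfst (Ev.tsnd (.var rfl)))))
      (Ev.pair (Ev.sub (Ev.mul (Ev.tfst (.var rfl)) (.var rfl)) (Ev.mul (Ev.tsnd (.var rfl)) (.var rfl)))
        (Ev.add (Ev.mul (Ev.tfst (.var rfl)) (.var rfl))
          (Ev.mul (Ev.tsnd (.var rfl)) (.var rfl))))))))))) (by norm_num)
  · rw [tip, if_neg h1]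
    exact Ev.tsnd (Ev.tsnd (.var rfl))

variable {κ2 tp : ℝ} {st : State} {v : Value} {K : ℕ}

theorem Tree.height_update (t : Tree) (k : ℝ × ℝ) (o : Option Rec) :
    (t.update k o).height = t.height := by
  induction t with
  | leaf k' o' => rfl
  | node s l r ihl ihr => rw [Tree.update]; split_ifs <;> simp [Tree.height, ihl, ihr]

theorem ev_insert {t : Rec} {ts : List Rec}
    (h : Ev greedyProgram [encState κ2 tp (st.insert t ts)] loopBody v K) :
    Ev greedyProgram [.pair (encRec t) (.pair (encodeList encRec ts) (encState κ2 tp st))]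
      insertBody v (K + 500 * st.tree.height + 150) :=
  Ev.mono (Ev.call (Ev.pair (Ev.tfst (Ev.tsnd (Ev.tsnd (.var rfl)))) (Ev.pair
    (Ev.call (Ev.pair (Ev.tfst (Ev.tsnd (Ev.tsnd (Ev.tsnd (.var rfl)))))
      (Ev.pair (Ev.tfst (Ev.tfst (.var rfl))) (Ev.pair (Ev.pair (Ev.tfst (.var rfl))
        (Ev.tfst (.var rfl))) .nil))) rfl (ev_update st.tree t.key (some t)))
    (Ev.pair (Ev.tfst (Ev.tsnd (.var rfl)))
      (Ev.tsnd (Ev.tsnd (Ev.tsnd (Ev.tsnd (Ev.tsnd (.var rfl))))))))) rfl h) (by omega)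

theorem ev_join {a b : Rec} (hx : |(b.x - a.x) / 2| ≤ Real.pi)
    (h : Ev greedyProgram [encState κ2 tp (st.join κ2 a b)] loopBody v K) :
    Ev greedyProgram [.pair (.pair (encRec a) (encRec b)) (encState κ2 tp st)]
      joinBody v (K + 1000 * st.tree.height + 1500) := by
  have h1 := ev_update st.tree a.key none
  have h2 := ev_update (st.tree.update a.key none) b.key (some (tip κ2 a b))
  rw [Tree.height_update] at h2
  have h3 := ev_link κ2 b (tip κ2 a b) st.arcs
  have h4 := ev_link κ2 a (tip κ2 a b) (link κ2 b (tip κ2 a b) st.arcs)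
  exact Ev.mono (Ev.bind (Ev.call (Ev.pair (Ev.tfst (Ev.tfst (Ev.tsnd (.var rfl))))
      (Ev.tfst (.var rfl))) rfl (ev_tip κ2 a b hx))
    (Ev.call (Ev.pair (Ev.tfst (Ev.tsnd (.var rfl))) (Ev.pair
      (Ev.call (Ev.pair (Ev.call (Ev.pair (Ev.tfst (Ev.tsnd (Ev.tsnd (.var rfl))))
        (Ev.pair (Ev.tfst (Ev.tfst (Ev.tfst (.var rfl)))) .nil)) rfl h1)
        (Ev.pair (Ev.tfst (Ev.tsnd (Ev.tfst (.var rfl))))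
          (Ev.pair (Ev.pair (.var rfl) (.var rfl)) .nil))) rfl h2)
      (Ev.pair (Ev.tfst (Ev.tsnd (Ev.tsnd (Ev.tsnd (.var rfl)))))
      (Ev.call (Ev.pair (Ev.tfst (Ev.tfst (Ev.tsnd (.var rfl))))
        (Ev.pair (Ev.pair (Ev.tfst (Ev.tfst (.var rfl))) (.var rfl))
        (Ev.call (Ev.pair (Ev.tfst (Ev.tfst (Ev.tsnd (.var rfl))))
          (Ev.pair (Ev.pair (Ev.tsnd (Ev.tfst (.var rfl))) (.var rfl))
          (Ev.tsnd (Ev.tsnd (Ev.tsnd (Ev.tsnd (.var rfl))))))) rfl h3))) rfl h4)))) rfl h))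
    (by omega)

theorem ev_jump {f t : Rec} {ts : List Rec}
    (h : Ev greedyProgram [encState κ2 tp (st.jump κ2 f t ts)] loopBody v K) :
    Ev greedyProgram [.pair (encRec t) (.pair (encRec f)
      (.pair (encodeList encRec ts) (encState κ2 tp st)))]
      jumpBody v (K + 1000 * st.tree.height + 600) := by
  have h1 := ev_update st.tree f.key none
  have h2 := ev_insert (κ2 := κ2) (tp := tp)
    (st := ⟨st.tree.update f.key none, [], jumpArc κ2 f t :: st.arcs⟩) h
  simp only [Tree.height_update] at h2
  have h3 := ev_consArc (jumpArc κ2 f t) (encodeList encRaw st.arcs)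
  exact Ev.mono (Ev.bind (Ev.tfst (.var rfl)) (Ev.bind (Ev.tfst (Ev.tsnd (.var rfl)))
    (Ev.bind (Ev.tsnd (Ev.tsnd (Ev.tsnd (.var rfl))))
    (Ev.bind (Ev.div (Ev.sub (Ev.sub (Ev.x (r := t) (.var rfl)) (Ev.y (r := t) (.var rfl)))
      (Ev.sub (Ev.x (r := f) (.var rfl)) (Ev.y (r := f) (.var rfl)))) .two)
    (Ev.bind (Ev.sub (Ev.arg (Ev.tfst (Ev.z (r := t) (.var rfl))) (Ev.tsnd (Ev.z (r := t) (.var rfl))))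
      (Ev.arg (Ev.tfst (Ev.z (r := f) (.var rfl))) (Ev.tsnd (Ev.z (r := f) (.var rfl)))))
    (Ev.call (Ev.pair (.var rfl) (Ev.pair (Ev.tfst (Ev.tsnd (Ev.tsnd (.var rfl))))
      (Ev.pair (Ev.tfst (.var rfl)) (Ev.pair
        (Ev.call (Ev.pair (Ev.tfst (Ev.tsnd (.var rfl))) (Ev.pair (Ev.tfst (.var rfl)) .nil)) rfl h1)
        (Ev.pair .nil (Ev.call (Ev.pair (Ev.pair (Ev.z (r := f) (.var rfl)) (Ev.z (r := t) (.var rfl)))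
          (Ev.pair (Ev.pair (Ev.div (Ev.add (.var rfl) (.var rfl)) (Ev.tfst (Ev.tfst (.var rfl))))
            (Ev.div (Ev.sub (.var rfl) (.var rfl)) (Ev.tfst (Ev.tfst (.var rfl)))))
          (Ev.tsnd (Ev.tsnd (Ev.tsnd (.var rfl)))))) rfl h3)))))) rfl h2)))))) (by omega)

/-- The encoding of the last arc, a right spiral all the way to the root. -/
def encLast (z : ℂ) : Value :=
  .pair (.pair (encodePoint z) (.pair (.real 0) (.real 0))) (.pair .nil (.pair (.real 1) .nil))

theorem ev_loop_done {f l : Rec} (hs : st.tree.summary = some (f, l, none)) (hp : st.pending = []) :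
    Ev greedyProgram [encState κ2 tp st] loopBody
      (.pair (encLast f.z) (encodeList encRaw st.arcs)) 100 := by
  obtain ⟨tree, pending, arcs⟩ := st
  obtain rfl : pending = [] := hp
  obtain ⟨w, hw⟩ := exists_encTree tree
  simp only at hs
  rw [encState, hw, hs]
  exact Ev.mono (Ev.cases_pair (Ev.tfst (Ev.tfst (Ev.tsnd (.var rfl)))) (Ev.cases_nil (.var rfl)
    (Ev.cases_nil (Ev.tfst (Ev.tsnd (Ev.tsnd (.var rfl))))
    (Ev.pair (Ev.pair (Ev.pair (Ev.z (r := f) (Ev.tfst (.var rfl))) (Ev.pair .zero .zero))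
      (Ev.pair .nil (Ev.pair .one .nil))) (Ev.tsnd (Ev.tsnd (Ev.tsnd (.var rfl)))))))) (by norm_num)

theorem ev_loop_step {st' : State} (hstep : st.step κ2 tp = some st')
    (hx : ∀ f l b, st.tree.summary = some (f, l, some b) →
      |((better (cand (l.back tp) f) (some b)).2.1.x -
        (better (cand (l.back tp) f) (some b)).1.x) / 2| ≤ Real.pi)
    (h : Ev greedyProgram [encState κ2 tp st'] loopBody v K) :
    Ev greedyProgram [encState κ2 tp st] loopBody v (K + 1000 * st.tree.height + 3000) := by
  obtain ⟨tree, pending, arcs⟩ := st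
  obtain ⟨w, hw⟩ := exists_encTree tree
  have henc : encState κ2 tp ⟨tree, pending, arcs⟩ = .pair (.pair (.real κ2) (.real tp))
    (.pair (.pair (encSummary tree.summary) w)
      (.pair (encodeList encRec pending) (encodeList encRaw arcs))) := by rw [encState, hw]
  rw [State.step] at hstep
  simp only at hstep hx ⊢
  match hs : tree.summary, hstep, hx with
  | some (f, l, none), hstep, hx =>
    match pending, hstep, henc with
    | t :: ts, hstep, henc =>
      simp only at hstep
      rw [hs] at henc
      by_cases hlt : t.lev - f.lev < tp + tp
      · rw [if_pos hlt, Option.some_inj] at hstep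
        subst hstep
        have h1 := ev_insert h
        rw [henc] at h1 ⊢
        refine Ev.mono (Ev.cases_pair (Ev.tfst (Ev.tfst (Ev.tsnd (.var rfl)))) (Ev.cases_nil (.var rfl)
          (Ev.cases_pair (Ev.tfst (Ev.tsnd (Ev.tsnd (.var rfl)))) (Ev.ifLt
            (Ev.sub (Ev.sub (Ev.x (r := t) (.var rfl)) (Ev.y (r := t) (.var rfl)))
              (Ev.sub (Ev.x (r := f) (Ev.tfst (.var rfl))) (Ev.y (r := f) (Ev.tfst (.var rfl)))))
            (Ev.add (Ev.tsnd (Ev.tfst (.var rfl))) (Ev.tsnd (Ev.tfst (.var rfl))))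
            (n := 0) (fun _ => Ev.call (Ev.pair (.var rfl) (Ev.pair (.var rfl) (.var rfl))) rfl h1)
            (fun hn => absurd hlt hn))))) ?_
        simp only
        omega
      · rw [if_neg hlt, Option.some_inj] at hstep
        subst hstep
        have h1 := ev_jump h
        rw [henc] at h1 ⊢
        refine Ev.mono (Ev.cases_pair (Ev.tfst (Ev.tfst (Ev.tsnd (.var rfl)))) (Ev.cases_nil (.var rfl)
          (Ev.cases_pair (Ev.tfst (Ev.tsnd (Ev.tsnd (.var rfl)))) (Ev.ifLt
            (Ev.sub (Ev.sub (Ev.x (r := t) (.var rfl)) (Ev.y (r := t) (.var rfl)))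
              (Ev.sub (Ev.x (r := f) (Ev.tfst (.var rfl))) (Ev.y (r := f) (Ev.tfst (.var rfl)))))
            (Ev.add (Ev.tsnd (Ev.tfst (.var rfl))) (Ev.tsnd (Ev.tfst (.var rfl))))
            (m := 0) (fun hy => absurd hy hlt)
            (fun _ => Ev.call (Ev.pair (.var rfl) (Ev.pair (Ev.tfst (.var rfl))
              (Ev.pair (.var rfl) (.var rfl)))) rfl h1))))) ?_
        simp only
        omega
  | some (f, l, some b), hstep, hx =>
    have hx' := hx f l b rfl
    have hc : Ev greedyProgram [.pair (encRec (l.back tp)) (encRec f)] candBody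
      (encCand (cand (l.back tp) f)) 80 := ev_cand _ _
    have hb : Ev greedyProgram [.pair (encCand (cand (l.back tp) f)) (encBest (some b))] betterBody
      (encCand (better (cand (l.back tp) f) (some b))) 30 := ev_better _ _
    simp only at hstep
    rw [hs] at henc
    match pending, hstep, henc with
    | [], hstep, henc =>
      simp only [Option.some_inj] at hstep
      subst hstep
      have h1 := ev_join hx' h
      rw [henc] at h1 ⊢
      refine Ev.mono (Ev.cases_pair (Ev.tfst (Ev.tfst (Ev.tsnd (.var rfl)))) (Ev.cases_pair (.var rfl)
        (Ev.bind (Ev.call (Ev.pair (Ev.call (Ev.pair (Ev.pair (Ev.tfst (Ev.tsnd (.var rfl)))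
          (Ev.pair (Ev.pair (Ev.sub (Ev.x (r := l) (Ev.tsnd (.var rfl))) (Ev.tsnd (Ev.tfst (.var rfl))))
            (Ev.sub (Ev.y (r := l) (Ev.tsnd (.var rfl))) (Ev.tsnd (Ev.tfst (.var rfl)))))
            (Ev.z (r := l) (Ev.tsnd (.var rfl))))) (Ev.tfst (.var rfl))) rfl hc) (.var rfl)) rfl hb)
        (Ev.cases_nil (Ev.tfst (Ev.tsnd (Ev.tsnd (.var rfl))))
          (Ev.call (Ev.pair (Ev.tfst (.var rfl)) (.var rfl)) rfl h1))))) ?_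
      simp only
      omega
    | t :: ts, hstep, henc =>
      simp only at hstep
      by_cases hlt : t.lev < (better (cand (l.back tp) f) (some b)).2.2
      · rw [if_pos hlt, Option.some_inj] at hstep
        subst hstep
        have h1 := ev_insert h
        rw [henc] at h1 ⊢
        refine Ev.mono (Ev.cases_pair (Ev.tfst (Ev.tfst (Ev.tsnd (.var rfl)))) (Ev.cases_pair (.var rfl)
          (Ev.bind (Ev.call (Ev.pair (Ev.call (Ev.pair (Ev.pair (Ev.tfst (Ev.tsnd (.var rfl)))
            (Ev.pair (Ev.pair (Ev.sub (Ev.x (r := l) (Ev.tsnd (.var rfl))) (Ev.tsnd (Ev.tfst (.var rfl))))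
              (Ev.sub (Ev.y (r := l) (Ev.tsnd (.var rfl))) (Ev.tsnd (Ev.tfst (.var rfl)))))
              (Ev.z (r := l) (Ev.tsnd (.var rfl))))) (Ev.tfst (.var rfl))) rfl hc) (.var rfl)) rfl hb)
          (Ev.cases_pair (Ev.tfst (Ev.tsnd (Ev.tsnd (.var rfl)))) (Ev.ifLt
            (Ev.sub (Ev.x (r := t) (.var rfl)) (Ev.y (r := t) (.var rfl))) (Ev.tsnd (.var rfl))
            (n := 0) (fun _ => Ev.call (Ev.pair (.var rfl) (Ev.pair (.var rfl) (.var rfl))) rfl h1)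
            (fun hn => absurd hlt hn)))))) ?_
        simp only
        omega
      · rw [if_neg hlt, Option.some_inj] at hstep
        subst hstep
        have h1 := ev_join hx' h
        rw [henc] at h1 ⊢
        refine Ev.mono (Ev.cases_pair (Ev.tfst (Ev.tfst (Ev.tsnd (.var rfl)))) (Ev.cases_pair (.var rfl)
          (Ev.bind (Ev.call (Ev.pair (Ev.call (Ev.pair (Ev.pair (Ev.tfst (Ev.tsnd (.var rfl)))
            (Ev.pair (Ev.pair (Ev.sub (Ev.x (r := l) (Ev.tsnd (.var rfl))) (Ev.tsnd (Ev.tfst (.var rfl))))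
              (Ev.sub (Ev.y (r := l) (Ev.tsnd (.var rfl))) (Ev.tsnd (Ev.tfst (.var rfl)))))
              (Ev.z (r := l) (Ev.tsnd (.var rfl))))) (Ev.tfst (.var rfl))) rfl hc) (.var rfl)) rfl hb)
          (Ev.cases_pair (Ev.tfst (Ev.tsnd (Ev.tsnd (.var rfl)))) (Ev.ifLt
            (Ev.sub (Ev.x (r := t) (.var rfl)) (Ev.y (r := t) (.var rfl))) (Ev.tsnd (.var rfl))
            (m := 0) (fun hy => absurd hy hlt)
            (fun _ => Ev.call (Ev.pair (Ev.tfst (.var rfl)) (.var rfl)) rfl h1)))))) ?_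
        simp only
        omega

end

/-! ### Sorting -/

theorem lexLt_iff_toLex {p q : ℝ × ℝ} : LexLt p q ↔ toLex p < toLex q := by
  rw [Prod.Lex.toLex_lt_toLex]
  rfl

theorem LexLt.trans {p q r : ℝ × ℝ} (h : LexLt p q) (h' : LexLt q r) : LexLt p r := by
  rw [lexLt_iff_toLex] at *
  exact h.trans h'

theorem LexLt.ne {p q : ℝ × ℝ} (h : LexLt p q) : p ≠ q := by
  rintro rfl
  rw [lexLt_iff_toLex] at h
  exact lt_irrefl _ h

theorem LexLt.asymm {p q : ℝ × ℝ} (h : LexLt p q) : ¬ LexLt q p := by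
  rw [lexLt_iff_toLex] at *
  exact h.asymm

theorem lexLt_of_lt_of_not_lt {p q r : ℝ × ℝ} (h : LexLt p q) (h' : ¬ LexLt r q) : LexLt p r := by
  rw [lexLt_iff_toLex] at *
  exact h.trans_le (not_lt.1 h')

theorem lexLt_of_not_lt_of_ne {p q : ℝ × ℝ} (h : ¬ LexLt q p) (h' : p ≠ q) : LexLt p q := by
  rw [lexLt_iff_toLex] at *
  exact lt_of_le_of_ne (not_lt.1 h) (by simpa using h')

theorem lexLt_or_lexLt {p q : ℝ × ℝ} (h : p ≠ q) : LexLt p q ∨ LexLt q p := by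
  by_cases h' : LexLt q p
  · exact Or.inr h'
  · exact Or.inl (lexLt_of_not_lt_of_ne h' h)

theorem mergeBy_perm {β : Type} (key : β → ℝ × ℝ) (l l' : List β) :
    (mergeBy key l l').Perm (l ++ l') := by
  fun_induction mergeBy key l l' with
  | case1 l => exact .refl _
  | case2 l => simp
  | case3 a l b l' h ih => exact (ih.cons b).trans List.perm_middle.symm
  | case4 a l b l' h ih => exact ih.cons a

theorem mergeBy_sorted {β : Type} (key : β → ℝ × ℝ) (l l' : List β)
    (hl : l.Pairwise fun a b => ¬ LexLt (key b) (key a))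
    (hl' : l'.Pairwise fun a b => ¬ LexLt (key b) (key a)) :
    (mergeBy key l l').Pairwise fun a b => ¬ LexLt (key b) (key a) := by
  fun_induction mergeBy key l l' with
  | case1 l => exact hl'
  | case2 l => exact hl
  | case3 a l b l' h ih =>
    rw [lexLt_iff] at h
    rw [List.pairwise_cons] at hl' ⊢
    refine ⟨fun c hc => ?_, ih hl hl'.2⟩
    rcases List.mem_append.1 ((mergeBy_perm key _ _).subset hc) with hc | hc
    · rcases List.mem_cons.1 hc with rfl | hc
      · exact h.asymm
      · exact fun h' => (List.pairwise_cons.1 hl).1 c hc (h'.trans h)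
    · exact hl'.1 c hc
  | case4 a l b l' h ih =>
    rw [lexLt_iff] at h
    rw [List.pairwise_cons] at hl ⊢
    refine ⟨fun c hc => ?_, ih hl.2 hl'⟩
    rcases List.mem_append.1 ((mergeBy_perm key _ _).subset hc) with hc | hc
    · exact hl.1 c hc
    · rcases List.mem_cons.1 hc with rfl | hc
      · exact h
      · exact fun h' => (List.pairwise_cons.1 hl').1 c hc (lexLt_of_lt_of_not_lt h' h)

theorem sortBy_perm {β : Type} (key : β → ℝ × ℝ) (d : ℕ) (l : List β) :
    (sortBy key d l).1.Perm (l.take (2 ^ d)) ∧ (sortBy key d l).2 = l.drop (2 ^ d) := by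
  induction d generalizing l with
  | zero => cases l <;> simp [sortBy, List.take]
  | succ d ih =>
    simp only [sortBy]
    obtain ⟨h1, h2⟩ := ih l
    obtain ⟨h3, h4⟩ := ih (sortBy key d l).2
    rw [pow_succ, mul_two, h4, h2, List.drop_drop, List.take_add]
    rw [h2] at h3
    exact ⟨(mergeBy_perm key _ _).trans (h1.append h3), rfl⟩

theorem sortBy_sorted {β : Type} (key : β → ℝ × ℝ) (d : ℕ) (l : List β) :
    (sortBy key d l).1.Pairwise fun a b => ¬ LexLt (key b) (key a) := by
  induction d generalizing l with
  | zero => cases l <;> simp [sortBy]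
  | succ d ih => exact mergeBy_sorted key _ _ (ih _) (ih _)

theorem sortBy_perm_of_le {β : Type} (key : β → ℝ × ℝ) {d : ℕ} {l : List β} (h : l.length ≤ 2 ^ d) :
    (sortBy key d l).1.Perm l := by
  have := (sortBy_perm key d l).1
  rwa [List.take_of_length_le h] at this

theorem length_le_two_pow_depth {β : Type} (l : List β) : l.length ≤ 2 ^ depth l := by
  induction h : l.length using Nat.strong_induction_on generalizing l with
  | _ n ih =>
    match l, h with
    | [], h => simp only [List.length_nil] at h; rw [← h]; exact Nat.zero_le _
    | [a], h => rw [← h]; exact Nat.one_le_two_pow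
    | a :: b :: l, h =>
      have h2 : 2 ≤ n := by rw [← h]; simp
      have hlen := length_halve (a :: b :: l)
      rw [h] at hlen
      have := ih _ (by omega) _ hlen
      rw [depth, pow_succ]
      omega

theorem two_pow_depth_lt {β : Type} (l : List β) (hl : l ≠ []) : 2 ^ depth l < 2 * l.length := by
  induction h : l.length using Nat.strong_induction_on generalizing l with
  | _ n ih =>
    match l, h with
    | [], h => exact absurd rfl hl
    | [a], h => rw [← h, depth]; simp
    | a :: b :: l, h =>
      have h2 : 2 ≤ n := by rw [← h]; simp
      have hlen := length_halve (a :: b :: l)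
      rw [h] at hlen
      have := ih _ (by omega) (halve (a :: b :: l)) (by simp [halve]) hlen
      rw [depth, pow_succ]
      rcases hd : depth (halve (a :: b :: l)) with _ | m
      · omega
      · rw [hd, pow_succ] at this
        rw [pow_succ]
        omega

/-! ### Search trees -/

/-- The nodes in a search tree, from left to right. -/
def Tree.toList : Tree → List Rec
  | .leaf _ o => o.toList
  | .node _ l r => l.toList ++ r.toList

/-- The keys of the slots of a search tree, from left to right. -/
def Tree.keys : Tree → List (ℝ × ℝ)
  | .leaf k _ => [k]
  | .node _ l r => l.keys ++ r.keys

/-- The nodes are in the slots of their keys, and the splits separate the keys. -/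
def Tree.Valid : Tree → Prop
  | .leaf k o => ∀ r ∈ o, r.key = k
  | .node s l r => l.Valid ∧ r.Valid ∧ (∀ k ∈ l.keys, LexLt k s) ∧ ∀ k ∈ r.keys, ¬ LexLt k s

theorem Tree.keys_update (t : Tree) (k : ℝ × ℝ) (o : Option Rec) : (t.update k o).keys = t.keys := by
  induction t with
  | leaf k' o' => rfl
  | node s l r ihl ihr => rw [Tree.update]; split_ifs <;> simp [Tree.keys, ihl, ihr]

theorem Tree.Valid.key_mem {t : Tree} (h : t.Valid) {r : Rec} (hr : r ∈ t.toList) :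
    r.key ∈ t.keys := by
  induction t with
  | leaf k o =>
    simp only [Tree.toList, Option.mem_toList] at hr
    simp [Tree.keys, h r hr]
  | node s l r ihl ihr =>
    rcases List.mem_append.1 hr with hr | hr
    · exact List.mem_append_left _ (ihl h.1 hr)
    · exact List.mem_append_right _ (ihr h.2.1 hr)

theorem Tree.Valid.pairwise {t : Tree} (h : t.Valid) :
    t.toList.Pairwise fun a b => LexLt a.key b.key := by
  induction t with
  | leaf k o => cases o <;> simp [Tree.toList]
  | node s l r ihl ihr =>
    refine List.pairwise_append.2 ⟨ihl h.1, ihr h.2.1, fun a ha b hb => ?_⟩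
    exact lexLt_of_lt_of_not_lt (h.2.2.1 _ (h.1.key_mem ha)) (h.2.2.2 _ (h.2.1.key_mem hb))

theorem Tree.Valid.update {t : Tree} (h : t.Valid) {k : ℝ × ℝ} (hk : k ∈ t.keys) {o : Option Rec}
    (ho : ∀ r ∈ o, r.key = k) : (t.update k o).Valid ∧
      ∀ r, r ∈ (t.update k o).toList ↔ r ∈ o ∨ (r ∈ t.toList ∧ r.key ≠ k) := by
  induction t with
  | leaf k' o' =>
    obtain rfl : k = k' := by simpa [Tree.keys] using hk
    refine ⟨ho, fun r => ?_⟩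
    simp only [Tree.update, Tree.toList, Option.mem_toList]
    exact ⟨Or.inl, fun hr => hr.resolve_right fun hr => hr.2 (h r hr.1)⟩
  | node s l r ihl ihr =>
    obtain ⟨hl, hr, h1, h2⟩ := h
    rw [Tree.update]
    by_cases hs : LexLt k s
    · have hkl : k ∈ l.keys := (List.mem_append.1 hk).resolve_right fun hk => h2 k hk hs
      obtain ⟨h3, h4⟩ := ihl hl hkl
      rw [if_pos (lexLt_iff.2 hs)]
      refine ⟨⟨h3, hr, by rwa [Tree.keys_update], h2⟩, fun q => ?_⟩
      have : q ∈ r.toList → q.key ≠ k := fun hq he => h2 _ (hr.key_mem hq) (he ▸ hs)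
      simp only [Tree.toList, List.mem_append, h4]
      tauto
    · have hkr : k ∈ r.keys := (List.mem_append.1 hk).resolve_left fun hk => hs (h1 k hk)
      obtain ⟨h3, h4⟩ := ihr hr hkr
      rw [if_neg (by rwa [lexLt_iff])]
      refine ⟨⟨hl, h3, h1, by rwa [Tree.keys_update]⟩, fun q => ?_⟩
      have : q ∈ l.toList → q.key ≠ k := fun hq he => hs (he ▸ h1 _ (hl.key_mem hq))
      simp only [Tree.toList, List.mem_append, h4]
      tauto

theorem build_spec (d : ℕ) (l : List Rec) (hl : l ≠ [])
    (hs : l.Pairwise fun a b => LexLt a.key b.key) :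
    (build d l).1.keys = (l.take (2 ^ d)).map Rec.key ∧ (build d l).2 = l.drop (2 ^ d) ∧
      (build d l).1.Valid ∧ (build d l).1.toList = [] ∧ (build d l).1.height ≤ d := by
  induction d generalizing l with
  | zero =>
    match l, hl with
    | a :: l, _ => simp [build, Tree.keys, Tree.Valid, Tree.toList, Tree.height, List.take]
  | succ d ih =>
    obtain ⟨h1, h2, h3, h4, h5⟩ := ih l hl hs
    rw [build, pow_succ, mul_two, ← List.drop_drop, List.take_add, ← h2]
    cases hr : (build d l).2 with
    | nil => simpa [h1] using ⟨h3, h4, by omega⟩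
    | cons a t =>
      have hsub : (a :: t).Pairwise fun a b => LexLt a.key b.key := by
        rw [← hr, h2]
        exact hs.sublist (List.drop_sublist _ _)
      obtain ⟨h6, h7, h8, h9, h10⟩ := ih (a :: t) (by simp) hsub
      have hap : l.take (2 ^ d) ++ a :: t = l := by
        rw [← hr, h2, List.take_append_drop]
      rw [← hap] at hs
      have hs' := (List.pairwise_append.1 hs).2.2
      refine ⟨?_, h7, ⟨h3, h8, fun k hk => ?_, fun k hk => ?_⟩, ?_, ?_⟩
      · simp [Tree.keys, h1, h6]
      · rw [h1] at hk
        obtain ⟨b, hb, rfl⟩ := List.mem_map.1 hk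
        exact hs' b hb a (by simp)
      · rw [h6] at hk
        obtain ⟨b, hb, rfl⟩ := List.mem_map.1 hk
        rcases List.mem_cons.1 (List.mem_of_mem_take hb) with rfl | hb
        · exact fun h => h.ne rfl
        · exact ((List.pairwise_cons.1 hsub).1 b hb).asymm
      · simp [Tree.toList, h4, h9]
      · rw [Tree.height]
        omega

/-! ### Summaries -/

/-- What a summary says about the sequence of the nodes. -/
def IsSummary : Summary → List Rec → Prop
  | none, F => F = []
  | some (f, l, b), F => F.head? = some f ∧ F.getLast? = some l ∧ (b = none → F = [f]) ∧
      (∀ c ∈ b, ∃ p q, [p, q] <:+: F ∧ c = cand p q) ∧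
      ∀ p q, [p, q] <:+: F → ∃ c ∈ b, c.2.2 ≤ joinLev p q

theorem better_cases (c : Cand) (o : Option Cand) :
    (better c o = c ∨ better c o ∈ o) ∧ (better c o).2.2 ≤ c.2.2 ∧
      ∀ d ∈ o, (better c o).2.2 ≤ d.2.2 := by
  cases o with
  | none => simp [better]
  | some d =>
    rw [better]
    split_ifs with h
    · simpa using h.le
    · simpa using h

theorem pair_infix_append {β : Type} {p q : β} {F G : List β} (h : [p, q] <:+: F ++ G) :
    [p, q] <:+: F ∨ [p, q] <:+: G ∨ (F.getLast? = some p ∧ G.head? = some q) := by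
  obtain ⟨s, t, h⟩ := h
  rw [List.append_assoc, List.append_eq_append_iff] at h
  rcases h with ⟨a, rfl, h⟩ | ⟨a, rfl, h⟩
  · match a, h with
    | [], h => exact Or.inr (Or.inl ⟨[], t, by simpa using h⟩)
    | [x], h =>
      simp only [List.cons_append, List.nil_append, List.cons.injEq] at h
      obtain ⟨rfl, rfl⟩ := h
      exact Or.inr (Or.inr (by simp))
    | x :: y :: a, h =>
      simp only [List.cons_append, List.nil_append, List.cons.injEq] at h
      obtain ⟨rfl, rfl, rfl⟩ := h
      exact Or.inl ⟨s, a, by simp⟩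
  · exact Or.inr (Or.inl ⟨a, t, by simp [h]⟩)

theorem Tree.isSummary (t : Tree) : IsSummary t.summary t.toList := by
  induction t with
  | leaf k o =>
    cases o with
    | none => rfl
    | some r =>
      refine ⟨rfl, rfl, fun _ => rfl, by simp, fun p q h => ?_⟩
      have := h.length_le
      simp [Tree.toList] at this
  | node s l r ihl ihr =>
    rw [Tree.summary, Tree.toList]
    match l.summary, r.summary, ihl, ihr with
    | none, s, ihl, ihr =>
      rw [combine, show l.toList = [] from ihl]
      exact ihr
    | some s, none, ihl, ihr =>
      rw [combine, show r.toList = [] from ihr, List.append_nil]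
      · exact ihl
      · simp
    | some (f, m, b), some (f', m', b'), ihl, ihr =>
      obtain ⟨h1, h2, h3, h4, h5⟩ := ihl
      obtain ⟨h1', h2', h3', h4', h5'⟩ := ihr
      have hb := better_cases (cand m f') b
      have hb' := better_cases (better (cand m f') b) b'
      rw [combine]
      refine ⟨?_, ?_, by simp, fun c hc => ?_, fun p q hpq => ?_⟩
      · simp [List.head?_append, h1]
      · simp [List.getLast?_append, h2']
      · obtain rfl := Option.some_inj.1 hc
        rcases hb'.1 with h | h
        · rw [h]
          rcases hb.1 with h | h
          · rw [h]
            obtain ⟨F, hF⟩ := List.getLast?_eq_some_iff.1 h2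
            obtain ⟨G, hG⟩ := List.head?_eq_some_iff.1 h1'
            exact ⟨m, f', ⟨F, G, by simp [hF, hG]⟩, rfl⟩
          · obtain ⟨p, q, hpq, h⟩ := h4 _ h
            exact ⟨p, q, hpq.trans (List.infix_append' [] _ _), h⟩
        · obtain ⟨p, q, hpq, h⟩ := h4' _ h
          exact ⟨p, q, hpq.trans (List.suffix_append _ _).isInfix, h⟩
      · refine ⟨_, rfl, ?_⟩
        rcases pair_infix_append hpq with h | h | ⟨h, h'⟩
        · obtain ⟨c, hc, h⟩ := h5 p q h
          exact hb'.2.1.trans ((hb.2.2 c hc).trans h)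
        · obtain ⟨c, hc, h⟩ := h5' p q h
          exact (hb'.2.2 c hc).trans h
        · rw [h2] at h
          rw [h1'] at h'
          obtain rfl := Option.some_inj.1 h
          obtain rfl := Option.some_inj.1 h'
          exact hb'.2.1.trans hb.2.1

variable {α κ β β' H τ : ℝ} {S : Finset ℂ} {st : State}

/-! ### Nodes and their locations -/

/-- The null coordinates of the node `r` are those of its location in the plane that is rotated
by `-β`. -/
def Rec.At (κ β : ℝ) (r : Rec) : Prop := r.z = pt κ (r.x + β) (r.y + β)

theorem Rec.At.ne_zero {r : Rec} (h : r.At κ β) : r.z ≠ 0 := by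
  rw [h]
  exact pt_ne_zero _ _ _

theorem Rec.At.norm_le_iff (hκ : 0 < κ) {r s : Rec} (h : r.At κ β) (h' : s.At κ β') :
    ‖r.z‖ ≤ ‖s.z‖ ↔ s.lev ≤ r.lev := by
  rw [h, h', norm_pt_le_norm_pt hκ, add_sub_add_right_eq_sub, add_sub_add_right_eq_sub]
  rfl

theorem Rec.At.lev_eq (hκ : 0 < κ) {r : Rec} (h : r.At κ β) :
    r.lev = -(2 * κ * Real.log ‖r.z‖) := by
  rw [h, norm_pt, Real.log_exp, Rec.lev]
  field_simp
  ring

theorem Rec.At.lev_eq_of_z_eq (hκ : 0 < κ) {r s : Rec} (h : r.At κ β) (h' : s.At κ β')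
    (hz : r.z = s.z) : r.lev = s.lev := by
  rw [h.lev_eq hκ, h'.lev_eq hκ, hz]

theorem Rec.At.back (hκ : 0 < κ) {r : Rec} (h : r.At κ β) : (r.back (2 * Real.pi)).At κ β := by
  have := pt_add_int_mul hκ (r.x + β) (r.y + β) (-1)
  rw [Rec.At, Rec.back]
  simp only
  rw [h, ← this]
  congr 1 <;> push_cast <;> ring

theorem tip_spec {a b : Rec} (ha : a.At κ β) (hb : b.At κ β) :
    (tip (2 * κ) a b).key = b.key ∧ (tip (2 * κ) a b).x = b.x ∧
      (tip (2 * κ) a b).y = min a.y b.y ∧ (tip (2 * κ) a b).At κ β := by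
  rw [tip]
  split_ifs with h
  · refine ⟨rfl, rfl, (min_eq_left h.le).symm, ?_⟩
    have hz : pt κ (b.x + β) (a.y + β) = a.z *
        Complex.exp ((0 - (b.x - a.x) / (2 * κ) : ℝ) + ((b.x - a.x) / 2 : ℝ) * Complex.I) := by
      rw [ha, pt, pt, ← Complex.exp_add]
      congr 1
      push_cast
      ring
    rw [Rec.At]
    simp only
    rw [hz, Complex.exp_add, Complex.exp_mul_I, ← Complex.ofReal_exp, ← Complex.ofReal_cos,
      ← Complex.ofReal_sin]
    generalize Real.exp _ = e, Real.cos _ = c, Real.sin _ = d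
    apply Complex.ext
    · simp
    · simp
  · exact ⟨rfl, rfl, (min_eq_right (not_lt.1 h)).symm, hb⟩

/-- The arc that is output for a raw arc. -/
noncomputable def RawArc.toArc (a : RawArc) : Arc :=
  ⟨a.start, [(.right, a.s.toNNReal), (.left, a.t.toNNReal)], none⟩

/-- The parameters are nonnegative, and they lead to the endpoint. -/
def RawArc.Valid (α : ℝ) (a : RawArc) : Prop :=
  0 ≤ a.s ∧ 0 ≤ a.t ∧ a.toArc.finish α = a.finish

theorem encodeArc_toArc {a : RawArc} (h : a.Valid α) : encodeArc α a.toArc = encRaw a := by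
  obtain ⟨h1, h2, h3⟩ := h
  rw [encodeArc, h3]
  simp [RawArc.toArc, encRaw, encodeList, encodeMove, encodeSide, Side.sign, h1, h2]

theorem link_spec (hα : 0 < Real.tan α) {u p : Rec} (hu : u.At (Real.tan α) β)
    (hp : p.At (Real.tan α) β) (hx : u.x ≤ p.x) (hy : p.y ≤ u.y) (l : List RawArc) :
    ∃ l' : List RawArc, link (2 * Real.tan α) u p l = l' ++ l ∧ (∀ a ∈ l', a.Valid α) ∧
      IsLink α u.z p.z (l'.map RawArc.toArc).toFinset ∧ (u.z = p.z → l' = []) ∧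
      (l'.map RawArc.start).Nodup ∧ ∀ a ∈ l', a.start = u.z := by
  rw [link]
  split_ifs with h
  · have hz : u.z ≠ p.z := fun hz => by
      have := hu.lev_eq_of_z_eq hα hp hz
      rw [Rec.lev, Rec.lev] at this
      rcases h with h | h <;> linarith
    have hv : RawArc.Valid α ⟨u.z, p.z, (p.x - u.x) / (2 * Real.tan α),
        (u.y - p.y) / (2 * Real.tan α)⟩ := by
      refine ⟨div_nonneg (by linarith) (by linarith), div_nonneg (by linarith) (by linarith), ?_⟩
      have := movesEnd_twoMoves hα (X := u.x + β) (Y := u.y + β) (sub_nonneg.2 hx) (sub_nonneg.2 hy)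
      rw [← hu] at this
      refine this.trans ?_
      rw [hp]
      congr 1 <;> ring
    exact ⟨[_], rfl, by simpa using hv, Or.inr ⟨hz, _, rfl, hv.2.2, by simp⟩, fun h => absurd h hz,
      by simp, by simp⟩
  · push Not at h
    have hz : u.z = p.z := by rw [hu, hp, le_antisymm hx h.1, le_antisymm hy h.2]
    exact ⟨[], rfl, by simp, Or.inl ⟨hz, rfl⟩, fun _ => rfl, by simp, by simp⟩

/-- A terminal at least two full turns of level inwards of a node lies in the spiral region of
the node, and it is reached with at most one turn of deviation from the radial direction. -/
theorem jumpArc_valid (hα : 0 < Real.tan α) {f t : Rec} (hf : f.At (Real.tan α) β)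
    (ht : t.At (Real.tan α) β') (h : 2 * Real.pi + 2 * Real.pi ≤ t.lev - f.lev) :
    (jumpArc (2 * Real.tan α) f t).Valid α := by
  have hδ := abs_lt.1 (show |t.z.arg - f.z.arg| < 2 * Real.pi by
    have h1 := Complex.neg_pi_lt_arg t.z
    have h2 := Complex.arg_le_pi t.z
    have h3 := Complex.neg_pi_lt_arg f.z
    have h4 := Complex.arg_le_pi f.z
    rw [abs_lt]
    constructor <;> linarith)
  have hg : 2 * Real.pi ≤ (t.x - t.y - (f.x - f.y)) / 2 := by
    rw [Rec.lev, Rec.lev] at h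
    linarith
  refine ⟨div_nonneg ?_ (by linarith), div_nonneg ?_ (by linarith), ?_⟩
  · change 0 ≤ (t.x - t.y - (f.x - f.y)) / 2 + (t.z.arg - f.z.arg)
    linarith
  · change 0 ≤ (t.x - t.y - (f.x - f.y)) / 2 - (t.z.arg - f.z.arg)
    linarith
  · have h1 := hf.lev_eq hα
    have h2 := ht.lev_eq hα
    have h3 := movesEnd_twoMoves hα (X := f.z.arg - Real.tan α * Real.log ‖f.z‖)
      (Y := f.z.arg + Real.tan α * Real.log ‖f.z‖)
      (a := (t.x - t.y - (f.x - f.y)) / 2 + (t.z.arg - f.z.arg))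
      (b := (t.x - t.y - (f.x - f.y)) / 2 - (t.z.arg - f.z.arg)) (by linarith) (by linarith)
    rw [← eq_pt_arg hα hf.ne_zero] at h3
    refine h3.trans ?_
    change _ = t.z
    conv_rhs => rw [eq_pt_arg hα ht.ne_zero]
    rw [Rec.lev] at h1 h2
    rw [h1, h2]
    congr 1 <;> ring

/-! ### The nodes of the terminals -/

/-- A list of terminals that is sorted by level, after a node of level `lev` whose coordinates are
relative to the rotation `β`: the rotation changes only where the level increases by at least
`20`. -/
def Chain (κ : ℝ) : ℝ → ℝ → List Rec → Prop
  | _, _, [] => True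
  | lev, β, t :: ts => lev ≤ t.lev ∧ 0 ≤ t.x ∧ t.x < 2 * Real.pi ∧ t.key = (t.x, t.y) ∧
      ∃ β', (t.lev - lev < 20 → β' = β) ∧ t.At κ β' ∧ Chain κ t.lev β' ts

theorem Chain.lev_le {lev : ℝ} {ts : List Rec} (h : Chain κ lev β ts) : ∀ t ∈ ts, lev ≤ t.lev := by
  induction ts generalizing lev β with
  | nil => simp
  | cons t ts ih =>
    obtain ⟨h1, -, -, -, β', -, -, h2⟩ := h
    intro s hs
    rcases List.mem_cons.1 hs with rfl | hs
    · exact h1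
    · exact h1.trans (ih h2 s hs)

theorem Chain.exists_at {lev : ℝ} {ts : List Rec} (h : Chain κ lev β ts) :
    ∀ t ∈ ts, ∃ β', t.At κ β' := by
  induction ts generalizing lev β with
  | nil => simp
  | cons t ts ih =>
    obtain ⟨-, -, -, -, β', -, h1, h2⟩ := h
    intro s hs
    rcases List.mem_cons.1 hs with rfl | hs
    · exact ⟨β', h1⟩
    · exact ih h2 s hs

theorem Chain.key_eq {lev : ℝ} {ts : List Rec} (h : Chain κ lev β ts) :
    ∀ t ∈ ts, t.key = (t.x, t.y) := by
  induction ts generalizing lev β with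
  | nil => simp
  | cons t ts ih =>
    obtain ⟨-, -, -, h1, β', -, -, h2⟩ := h
    intro s hs
    rcases List.mem_cons.1 hs with rfl | hs
    · exact h1
    · exact ih h2 s hs

theorem Chain.at_of_lev_eq {lev : ℝ} {ts : List Rec} (h : Chain κ lev β ts) :
    ∀ t ∈ ts, t.lev = lev → t.At κ β := by
  induction ts generalizing lev β with
  | nil => simp
  | cons t ts ih =>
    obtain ⟨h1, -, -, -, β', h3, h4, h2⟩ := h
    intro s hs hlev
    rcases List.mem_cons.1 hs with rfl | hs
    · rwa [h3 (by linarith)] at h4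
    · have h5 := h2.lev_le s hs
      obtain rfl := h3 (by linarith)
      exact ih h2 s hs (by linarith)

/-- Different terminals have different keys: where the keys agree, so do the levels, and then
the rotations. -/
theorem Chain.keys_nodup {lev : ℝ} {ts : List Rec} (h : Chain κ lev β ts)
    (hz : (ts.map Rec.z).Nodup) : ts.Pairwise fun s t => s.key ≠ t.key := by
  induction ts generalizing lev β with
  | nil => simp
  | cons t ts ih =>
    obtain ⟨h1, -, -, h5, β', h3, h4, h2⟩ := h
    rw [List.map_cons, List.nodup_cons] at hz
    refine List.pairwise_cons.2 ⟨fun s hs he => hz.1 (List.mem_map.2 ⟨s, hs, ?_⟩), ih h2 hz.2⟩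
    rw [h5, h2.key_eq s hs, Prod.mk.injEq] at he
    rw [h2.at_of_lev_eq s hs (by rw [Rec.lev, Rec.lev, he.1, he.2]), h4, he.1, he.2]

theorem map_z_nodes (tp : ℝ) (l : List ((ℝ × ℝ) × ℂ)) (lev ρ : ℝ) :
    (nodes tp l lev ρ).map Rec.z = l.map Prod.snd := by
  induction l generalizing lev ρ with
  | nil => rfl
  | cons i l ih => simp [nodes, ih]

theorem item_lev (κ : ℝ) (z : ℂ) : (item κ z).1.1 = -(2 * κ * Real.log ‖z‖) := by
  have : z.re * z.re + z.im * z.im = ‖z‖ ^ 2 := by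
    rw [← Complex.normSq_apply, Complex.normSq_eq_norm_sq]
  rw [item, this, Real.log_pow]
  push_cast
  ring

theorem reduce_spec (p u : ℝ) : ∃ k : ℤ, reduce p u = u + k * p := by
  rw [reduce]
  split_ifs
  · exact ⟨0, by simp⟩
  · exact ⟨-1, by push_cast; ring⟩

theorem reduce_nonneg {p u : ℝ} (h : 0 ≤ u) : 0 ≤ reduce p u := by
  rw [reduce]
  split_ifs <;> linarith

theorem nextRot_spec {lev ρ lev' : ℝ} (h : lev ≤ lev') (h0 : 0 ≤ ρ) (h1 : ρ < 2 * Real.pi) :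
    0 ≤ nextRot (2 * Real.pi) lev ρ lev' ∧ nextRot (2 * Real.pi) lev ρ lev' < 2 * Real.pi ∧
      (lev' - lev < 20 → ∃ k : ℤ,
        nextRot (2 * Real.pi) lev ρ lev' = ρ + (lev' - lev) / 2 + k * (2 * Real.pi)) ∧
      (¬ lev' - lev < 20 → nextRot (2 * Real.pi) lev ρ lev' = 0) := by
  have hpi := Real.pi_gt_three
  rw [nextRot]
  split_ifs with h20
  · refine ⟨reduce_nonneg (reduce_nonneg (by linarith)), ?_, fun _ => ?_, fun h => absurd h20 h⟩
    · -- the argument is less than `2 * π + 10`, which is less than three turns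
      have : reduce (2 * Real.pi) (ρ + (lev' - lev) / 2) < 2 * (2 * Real.pi) := by
        rw [reduce]
        split_ifs <;> linarith
      rw [reduce]
      split_ifs <;> linarith
    · obtain ⟨k, hk⟩ := reduce_spec (2 * Real.pi) (ρ + (lev' - lev) / 2)
      obtain ⟨j, hj⟩ := reduce_spec (2 * Real.pi) (reduce (2 * Real.pi) (ρ + (lev' - lev) / 2))
      exact ⟨k + j, by rw [hj, hk]; push_cast; ring⟩
  · exact ⟨le_rfl, by linarith, fun h => absurd h h20, fun _ => rfl⟩

theorem coordX_spec {φ ρ : ℝ} (h1 : -Real.pi < φ) (h2 : φ ≤ Real.pi) (h3 : 0 ≤ ρ)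
    (h4 : ρ < 2 * Real.pi) : 0 ≤ coordX (2 * Real.pi) φ ρ ∧
      coordX (2 * Real.pi) φ ρ < 2 * Real.pi ∧
      ∃ k : ℤ, coordX (2 * Real.pi) φ ρ = φ + ρ + k * (2 * Real.pi) := by
  have hpi := Real.pi_pos
  rw [coordX]
  split_ifs with h
  · exact ⟨by linarith, by linarith, 1, by push_cast; ring⟩
  · refine ⟨reduce_nonneg (by linarith), ?_, reduce_spec _ _⟩
    rw [reduce]
    split_ifs <;> linarith

theorem nodes_chain (hκ : 0 < κ) (l : List ((ℝ × ℝ) × ℂ)) {lev ρ : ℝ}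
    (hitem : ∀ i ∈ l, i.2 ≠ 0 ∧ i = item κ i.2)
    (hlev : ∀ i ∈ l, lev ≤ i.1.1) (hsort : l.Pairwise fun i j => i.1.1 ≤ j.1.1)
    (h0 : 0 ≤ ρ) (h1 : ρ < 2 * Real.pi) (hβ : ∃ k : ℤ, ρ = lev / 2 - β + k * (2 * Real.pi)) :
    Chain κ lev β (nodes (2 * Real.pi) l lev ρ) := by
  induction l generalizing lev ρ β with
  | nil => trivial
  | cons i l ih =>
    obtain ⟨hi0, hi⟩ := hitem i (by simp)
    rw [List.pairwise_cons] at hsort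
    obtain ⟨hr0, hr1, hr2, hr3⟩ := nextRot_spec (hlev i (by simp)) h0 h1
    set ρ' := nextRot (2 * Real.pi) lev ρ i.1.1 with hρ'
    have hφ : i.1.2 = i.2.arg := by rw [hi]; rfl
    have hL : i.1.1 = -(2 * κ * Real.log ‖i.2‖) := by rw [← item_lev, ← hi]
    obtain ⟨hx0, hx1, j, hj⟩ := coordX_spec (φ := i.1.2) (by rw [hφ]; exact Complex.neg_pi_lt_arg _)
      (by rw [hφ]; exact Complex.arg_le_pi _) hr0 hr1
    obtain ⟨β', hβ'1, hβ'2⟩ : ∃ β', (i.1.1 - lev < 20 → β' = β) ∧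
        ∃ k : ℤ, ρ' = i.1.1 / 2 - β' + k * (2 * Real.pi) := by
      by_cases h20 : i.1.1 - lev < 20
      · obtain ⟨k, hk⟩ := hβ
        obtain ⟨m, hm⟩ := hr2 h20
        exact ⟨β, fun _ => rfl, k + m, by rw [hm, hk]; push_cast; ring⟩
      · exact ⟨i.1.1 / 2, fun h => absurd h h20, 0, by rw [hr3 h20]; simp⟩
    rw [nodes]
    simp only [← hρ']
    refine ⟨?_, hx0, hx1, rfl, β', ?_, ?_, ?_⟩
    · simpa [Rec.lev] using hlev i (by simp)
    · simpa [Rec.lev] using hβ'1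
    · obtain ⟨k, hk⟩ := hβ'2
      rw [Rec.At]
      simp only
      conv_lhs => rw [eq_pt_arg hκ hi0, ← pt_add_int_mul hκ _ _ (k + j)]
      rw [hj, hk, hφ, hL]
      congr 1 <;> push_cast <;> ring
    · simp only [Rec.lev, sub_sub_cancel]
      exact ih (fun i' hi' => hitem i' (by simp [hi'])) hsort.1 hsort.2 hr0 hr1 hβ'2

/-! ### Neighbours in a sorted list -/

section Neighbours

variable {F : List Rec} {p q r s : Rec}

theorem eq_or_lexLt_of_infix (hF : F.Pairwise fun a b => LexLt a.key b.key) (h : [p, q] <:+: F)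
    (hs : s ∈ F) : (LexLt p.key s.key → s = q ∨ LexLt q.key s.key) ∧
      (LexLt s.key q.key → s = p ∨ LexLt s.key p.key) := by
  obtain ⟨P, Q, rfl⟩ := h
  simp only [List.append_assoc, List.cons_append, List.nil_append, List.pairwise_append,
    List.pairwise_cons, List.mem_cons, List.mem_append] at hF hs
  obtain ⟨-, ⟨h1, h2, -⟩, h3⟩ := hF
  rcases hs with hs | rfl | rfl | hs
  · exact ⟨fun h => absurd (h3 s hs p (by simp)) h.asymm, fun _ => Or.inr (h3 s hs p (by simp))⟩
  · exact ⟨fun h => absurd rfl h.ne, fun _ => Or.inl rfl⟩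
  · exact ⟨fun _ => Or.inl rfl, fun h => absurd rfl h.ne⟩
  · exact ⟨fun _ => Or.inr (h2 s hs), fun h => absurd (h2 s hs) h.asymm⟩

theorem infix_lexLt (hF : F.Pairwise fun a b => LexLt a.key b.key) (h : [p, q] <:+: F) :
    p ∈ F ∧ q ∈ F ∧ LexLt p.key q.key := by
  refine ⟨h.subset (by simp), h.subset (by simp), ?_⟩
  have := hF.sublist h.sublist
  simpa using this

theorem eq_or_lexLt_of_head (hF : F.Pairwise fun a b => LexLt a.key b.key) (h : F.head? = some p)
    (hs : s ∈ F) : s = p ∨ LexLt p.key s.key := by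
  obtain ⟨G, rfl⟩ := List.head?_eq_some_iff.1 h
  rcases List.mem_cons.1 hs with rfl | hs
  · exact Or.inl rfl
  · exact Or.inr ((List.pairwise_cons.1 hF).1 s hs)

theorem eq_or_lexLt_of_getLast (hF : F.Pairwise fun a b => LexLt a.key b.key)
    (h : F.getLast? = some p) (hs : s ∈ F) : s = p ∨ LexLt s.key p.key := by
  obtain ⟨G, rfl⟩ := List.getLast?_eq_some_iff.1 h
  rcases List.mem_append.1 hs with hs | hs
  · exact Or.inr ((List.pairwise_append.1 hF).2.2 s hs p (by simp))
  · exact Or.inl (by simpa using hs)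

theorem getLast_or_exists_infix (hr : r ∈ F) : F.getLast? = some r ∨ ∃ q, [r, q] <:+: F := by
  obtain ⟨P, Q, rfl⟩ := List.append_of_mem hr
  cases Q with
  | nil => exact Or.inl (by simp)
  | cons q Q => exact Or.inr ⟨q, P, Q, by simp⟩

theorem eq_of_key_eq (hF : F.Pairwise fun a b => LexLt a.key b.key) (hr : r ∈ F) (hs : s ∈ F)
    (h : r.key = s.key) : r = s := by
  induction F with
  | nil => simp at hr
  | cons a F ih =>
    rw [List.pairwise_cons] at hF
    rcases List.mem_cons.1 hr with rfl | hr'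
    · rcases List.mem_cons.1 hs with rfl | hs'
      · rfl
      · exact absurd h (hF.1 s hs').ne
    · rcases List.mem_cons.1 hs with rfl | hs'
      · exact absurd h.symm (hF.1 r hr').ne
      · exact ih hF.2 hr' hs'

end Neighbours

theorem joinLev_eq (a b : Rec) : joinLev a b = max (b.x - a.y) (b.x - b.y) := by
  rw [joinLev]
  split_ifs with h
  · rw [max_eq_left (by linarith)]
  · rw [max_eq_right (by linarith)]

theorem le_joinLev (a b : Rec) : b.lev ≤ joinLev a b := by
  rw [joinLev_eq]
  exact le_max_right _ _

/-- The level of every common point of the spiral regions of two nodes is at least that of one of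
two joins: the second node is taken either where it is or one turn before. All other lifts of the
second node only lead to larger levels. -/
theorem le_lev_of_mem_region_inter (hα : 0 < Real.tan α) {r s : Rec} (hr : r.At (Real.tan α) β)
    (hs : s.At (Real.tan α) β) {c : ℝ} (h0 : c ≤ joinLev r s)
    (h1 : c ≤ joinLev (s.back (2 * Real.pi)) r) {p : Rec} (hp : p.At (Real.tan α) β)
    (hlev : p.lev ≤ c) {q : ℂ} (hq : q ∈ region α r.z ∩ region α s.z) : ‖q‖ ≤ ‖p.z‖ := by
  have hpi := Real.pi_pos
  rw [hr, hs, mem_region_inter_region_iff hα] at hq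
  rcases hq with rfl | ⟨k, X, Y, h2, h3, rfl⟩
  · simp
  · rw [hp, norm_pt_le_norm_pt hα]
    rw [max_le_iff] at h2
    rw [le_min_iff] at h3
    rw [joinLev_eq] at h0 h1
    simp only [Rec.back] at h1
    simp only [Rec.lev] at hlev
    -- nonnegative shifts are no better than `0`, and negative ones no better than `-1`
    rcases le_or_gt 0 k with hk | hk
    · have : (0 : ℝ) ≤ k * (2 * Real.pi) := mul_nonneg (by exact_mod_cast hk) (by linarith)
      rcases le_max_iff.1 h0 with h | h <;> linarith
    · have hk' : (k : ℝ) ≤ -1 := by exact_mod_cast Int.le_sub_one_of_lt hk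
      have : (k : ℝ) * (2 * Real.pi) ≤ -1 * (2 * Real.pi) :=
        mul_le_mul_of_nonneg_right hk' (by linarith)
      rcases le_max_iff.1 h1 with h | h <;> linarith

/-! ### The invariant of the loop -/

/-- The invariant of the loop. All active nodes in the search tree have coordinates relative to
the same rotation `β`; `H` is the level of the last terminal that was activated, and `τ` is a level
that separates the active nodes from the pending terminals and from all joins. The bounds on the
spread of the coordinates show that every join happens before the level `H + 2 * π`, so that the
rotation cannot change while two nodes in the search tree are still to be joined. -/
structure Invariant (α : ℝ) (S : Finset ℂ) (β H τ : ℝ) (st : State) : Prop where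
  valid : st.tree.Valid
  ne_nil : st.tree.toList ≠ []
  isAt : ∀ r ∈ st.tree.toList, r.At (Real.tan α) β
  range : ∀ r ∈ st.tree.toList, 0 ≤ r.x ∧ r.x < 2 * Real.pi ∧ r.key.1 = r.x
  lev_le : ∀ r ∈ st.tree.toList, r.lev ≤ τ
  le_join : ∀ r ∈ st.tree.toList, ∀ s ∈ st.tree.toList, LexLt r.key s.key →
    τ ≤ joinLev r s ∧ τ ≤ joinLev (s.back (2 * Real.pi)) r
  spread : ∀ r ∈ st.tree.toList, ∀ s ∈ st.tree.toList, r.x - s.y ≤ H + 2 * Real.pi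
  spread_of_lt : ∀ r ∈ st.tree.toList, ∀ s ∈ st.tree.toList, LexLt r.key s.key → r.x - s.y ≤ H
  chain : Chain (Real.tan α) H β st.pending
  le_lev : ∀ t ∈ st.pending, τ ≤ t.lev
  key_mem : ∀ t ∈ st.pending, t.key ∈ st.tree.keys
  key_ne : ∀ t ∈ st.pending, ∀ r ∈ st.tree.toList, r.key ≠ t.key
  keys_ne : st.pending.Pairwise fun s t => s.key ≠ t.key
  arcs_valid : ∀ a ∈ st.arcs, a.Valid α
  starts_nodup : (st.arcs.map RawArc.start).Nodup
  forest : ∃ A : Finset ℂ,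
    (∀ w, w ∈ A ↔ (∃ r ∈ st.tree.toList, r.z = w) ∨ ∃ t ∈ st.pending, t.z = w) ∧
    GreedyForest α S A (st.arcs.map RawArc.toArc).toFinset

theorem Invariant.x_le (h : Invariant α S β H τ st) {r s : Rec} (hr : r ∈ st.tree.toList)
    (hs : s ∈ st.tree.toList) (hrs : LexLt r.key s.key) : r.x ≤ s.x := by
  rw [← (h.range r hr).2.2, ← (h.range s hs).2.2]
  rcases hrs with hrs | hrs
  · exact hrs.le
  · exact hrs.1.le

/-- Two active nodes that may be joined: `b`, and a node `a` that is `a₀` or lies one turn before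
`a₀`. The tip of `a` and `b` may replace `a₀` and `b` in the slot of `b`. -/
structure JoinPair (H : ℝ) (F : List Rec) (a₀ a b : Rec) : Prop where
  mem_left : a₀ ∈ F
  mem_right : b ∈ F
  key_ne : a₀.key ≠ b.key
  eq_or_eq : a = a₀ ∨ a = a₀.back (2 * Real.pi)
  x_le : a.x ≤ b.x
  le_x : b.x - 2 * Real.pi ≤ a.x
  spread_right : b.x - a.y ≤ H + 2 * Real.pi
  spread : ∀ s ∈ F, s.key ≠ a₀.key → s.x - a.y ≤ H + 2 * Real.pi
  spread_of_lt : ∀ s ∈ F, s.key ≠ a₀.key → LexLt s.key b.key → s.x - a.y ≤ H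

/-- The best pair of cyclic neighbours has the lowest join among all pairs of active nodes. If the
join of a node and its successor is lower than that of the node and a later one, it has the level
of the successor, which is at most `τ`. -/
theorem Invariant.exists_joinPair (h : Invariant α S β H τ st) {f l : Rec} {o : Cand}
    (hs : st.tree.summary = some (f, l, some o)) :
    ∃ a₀ a b, better (cand (l.back (2 * Real.pi)) f) (some o) = cand a b ∧
      JoinPair H st.tree.toList a₀ a b ∧ τ ≤ joinLev a b ∧
      ∀ r ∈ st.tree.toList, ∀ s ∈ st.tree.toList, LexLt r.key s.key →
        joinLev a b ≤ joinLev r s ∧ joinLev a b ≤ joinLev (s.back (2 * Real.pi)) r := by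
  have hF := h.valid.pairwise
  have hsum := st.tree.isSummary
  rw [hs] at hsum
  obtain ⟨h1, h2, -, h4, h5⟩ := hsum
  obtain ⟨p, q, hpq, rfl⟩ := h4 o rfl
  have hf : f ∈ st.tree.toList := List.mem_of_head? h1
  have hl : l ∈ st.tree.toList := List.mem_of_getLast? h2
  obtain ⟨hp, hq, hpqlt⟩ := infix_lexLt hF hpq
  have hfl : LexLt f.key l.key := by
    rcases eq_or_lexLt_of_head hF h1 hp with rfl | h6
    · rcases eq_or_lexLt_of_getLast hF h2 hq with rfl | h7
      · exact hpqlt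
      · exact hpqlt.trans h7
    · rcases eq_or_lexLt_of_getLast hF h2 hp with rfl | h7
      · exact h6
      · exact h6.trans h7
  obtain ⟨hb1, hb2, hb3⟩ := better_cases (cand (l.back (2 * Real.pi)) f) (some (cand p q))
  set c := better (cand (l.back (2 * Real.pi)) f) (some (cand p q)) with hc
  -- `c` is at most the level of the join of any two cyclic neighbours
  have hwrap : c.2.2 ≤ joinLev (l.back (2 * Real.pi)) f := hb2
  have hadj : ∀ r s, [r, s] <:+: st.tree.toList → c.2.2 ≤ joinLev r s := fun r s hrs => by
    obtain ⟨d, hd, h6⟩ := h5 r s hrs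
    exact (hb3 d hd).trans h6
  obtain ⟨a₀, a, b, hcab, hjp, hτ⟩ : ∃ a₀ a b, c = cand a b ∧ JoinPair H st.tree.toList a₀ a b ∧
      τ ≤ joinLev a b := by
    have hpi := Real.pi_pos
    rcases hb1 with h6 | h6
    · have hrl := h.range l hl
      have hrf := h.range f hf
      have hx := h.x_le hf hl hfl
      refine ⟨l, _, _, h6, ⟨hl, hf, hfl.ne.symm, Or.inr rfl, ?_, ?_, ?_, fun s hs hsl => ?_,
        fun s hs _ hsf => ?_⟩, (h.le_join f hf l hl hfl).2⟩
      · simp only [Rec.back]; linarith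
      · simp only [Rec.back]; linarith
      · have := h.spread_of_lt f hf l hl hfl
        simp only [Rec.back]; linarith
      · have := h.spread_of_lt s hs l hl
          ((eq_or_lexLt_of_getLast hF h2 hs).resolve_left fun he => hsl (he ▸ rfl))
        simp only [Rec.back]; linarith
      · rcases eq_or_lexLt_of_head hF h1 hs with rfl | h7
        · exact absurd rfl hsf.ne
        · exact absurd hsf h7.asymm
    · have hrp := h.range p hp
      have hrq := h.range q hq
      refine ⟨p, _, _, (Option.some_inj.1 h6).symm, ⟨hp, hq, hpqlt.ne, Or.inl rfl,
        h.x_le hp hq hpqlt, by linarith, h.spread q hq p hp, fun s hs _ => h.spread s hs p hp,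
        fun s hs hsp hsq => ?_⟩, (h.le_join p hp q hq hpqlt).1⟩
      exact h.spread_of_lt s hs p hp
        (((eq_or_lexLt_of_infix hF hpq hs).2 hsq).resolve_left fun he => hsp (he ▸ rfl))
  refine ⟨a₀, a, b, hcab, hjp, hτ, fun r hr s hs hrs => ?_⟩
  have hc2 : c.2.2 = joinLev a b := by rw [hcab]; rfl
  rw [← hc2] at hτ ⊢
  obtain ⟨hj1, hj2⟩ := h.le_join r hr s hs hrs
  constructor
  -- compare with the join of `r` and its successor `r'`
  · obtain h6 | ⟨r', hr'⟩ := getLast_or_exists_infix hr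
    · rcases eq_or_lexLt_of_getLast hF h6 hs with rfl | h7
      · exact absurd rfl hrs.ne
      · exact absurd hrs h7.asymm
    · have h7 := hadj r r' hr'
      have hr'F := (infix_lexLt hF hr').2.1
      have h8 : r'.x ≤ s.x := by
        rcases (eq_or_lexLt_of_infix hF hr' hs).1 hrs with rfl | h9
        · exact le_rfl
        · exact h.x_le hr'F hs h9
      rw [joinLev_eq] at h7
      rcases le_max_iff.1 h7 with h7 | h7
      · rw [joinLev_eq]
        exact le_max_of_le_left (by linarith)
      · have := h.lev_le r' hr'F
        rw [Rec.lev] at this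
        linarith
  -- compare with the join of `s` and its successor, which for the last node is `f`, a turn later
  · have hrr := h.range r hr
    obtain h6 | ⟨s', hs'⟩ := getLast_or_exists_infix hs
    · obtain rfl : l = s := by rw [h2] at h6; exact Option.some_inj.1 h6
      have h8 : f.x ≤ r.x := by
        rcases eq_or_lexLt_of_head hF h1 hr with rfl | h9
        · exact le_rfl
        · exact h.x_le hf hr h9
      rw [joinLev_eq] at hwrap
      rcases le_max_iff.1 hwrap with h7 | h7
      · rw [joinLev_eq]
        exact le_max_of_le_left (by linarith)
      · have := h.lev_le f hf
        rw [Rec.lev] at this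
        linarith
    · have h7 := hadj s s' hs'
      have hs'F := (infix_lexLt hF hs').2.1
      have hrs' := h.range s' hs'F
      rw [joinLev_eq] at h7
      rcases le_max_iff.1 h7 with h7 | h7
      · rw [joinLev_eq]
        refine le_max_of_le_left ?_
        simp only [Rec.back]
        linarith
      · have := h.lev_le s' hs'F
        rw [Rec.lev] at this
        linarith

theorem Invariant.joinLev_le (h : Invariant α S β H τ st) {a₀ a b : Rec}
    (hab : JoinPair H st.tree.toList a₀ a b) : joinLev a b ≤ H + 2 * Real.pi := by
  rw [joinLev_eq]
  exact max_le hab.spread_right (h.spread b hab.mem_right b hab.mem_right)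

/-! ### The invariant is preserved -/

theorem insert_valid {t : Rec} {ts : List Rec} (hv : st.tree.Valid) (hk : t.key ∈ st.tree.keys)
    (hne : ∀ r ∈ st.tree.toList, r.key ≠ t.key) : (st.insert t ts).tree.Valid ∧
      ∀ r, r ∈ (st.insert t ts).tree.toList ↔ r = t ∨ r ∈ st.tree.toList := by
  obtain ⟨h1, h2⟩ := hv.update hk (o := some t) (by simp)
  refine ⟨h1, fun r => (h2 r).trans ?_⟩
  rw [Option.mem_some_iff, and_iff_left_of_imp (hne r), eq_comm]

/-- The invariant holds if the search tree contains a single terminal. -/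
theorem invariant_insert_of_nil {t : Rec} {ts : List Rec} (hv : st.tree.Valid)
    (hnil : st.tree.toList = []) (hat : t.At (Real.tan α) β)
    (hx : 0 ≤ t.x ∧ t.x < 2 * Real.pi) (hkey : t.key = (t.x, t.y))
    (hchain : Chain (Real.tan α) t.lev β ts) (hkeys : ∀ s ∈ t :: ts, s.key ∈ st.tree.keys)
    (hne : (t :: ts).Pairwise fun s t => s.key ≠ t.key) (harcs : ∀ a ∈ st.arcs, a.Valid α)
    (hstarts : (st.arcs.map RawArc.start).Nodup)
    (hforest : ∃ A : Finset ℂ, (∀ w, w ∈ A ↔ ∃ s ∈ t :: ts, s.z = w) ∧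
      GreedyForest α S A (st.arcs.map RawArc.toArc).toFinset) :
    Invariant α S β t.lev t.lev (st.insert t ts) := by
  obtain ⟨h1, h2⟩ := insert_valid (ts := ts) hv (hkeys t (by simp)) (by simp [hnil])
  have h3 : ∀ r, r ∈ (st.insert t ts).tree.toList ↔ r = t := fun r => by rw [h2, hnil]; simp
  have hpi := Real.pi_pos
  rw [List.pairwise_cons] at hne
  refine ⟨h1, List.ne_nil_of_mem ((h3 t).2 rfl), ?_, ?_, ?_, ?_, ?_, ?_, hchain, hchain.lev_le,
    fun s hs => ?_, ?_, hne.2, harcs, hstarts, ?_⟩ <;> try simp only [h3, forall_eq]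
  · exact hat
  · exact ⟨hx.1, hx.2, by rw [hkey]⟩
  · exact le_rfl
  · exact fun h => absurd rfl h.ne
  · rw [Rec.lev]; linarith
  · exact fun h => absurd rfl h.ne
  · rw [State.insert, Tree.keys_update]
    exact hkeys s (by simp [show s ∈ ts from hs])
  · exact hne.1
  · obtain ⟨A, hA, hG⟩ := hforest
    exact ⟨A, fun w => by rw [hA]; simp [State.insert], hG⟩

/-- The next terminal may be activated if its level is at most that of all joins, and if it
belongs to the same rotation. -/
theorem Invariant.insert_pending (h : Invariant α S β H τ st) {t : Rec} {ts : List Rec}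
    (hp : st.pending = t :: ts) (h20 : t.lev - H < 20)
    (hjoin : ∀ r ∈ st.tree.toList, ∀ s ∈ st.tree.toList, LexLt r.key s.key →
      t.lev ≤ joinLev r s ∧ t.lev ≤ joinLev (s.back (2 * Real.pi)) r) :
    Invariant α S β t.lev t.lev (st.insert t ts) := by
  obtain ⟨hv, hne, hat, hrange, hlev, hle_join, hspread, hspread', hchain, hle, hkm, hkn, hkne, hav,
    hsn, A, hA, hG⟩ := h
  rw [hp] at hchain hle hkm hkn hkne hA
  obtain ⟨h1, h2⟩ := insert_valid (ts := ts) hv (hkm t (by simp)) (hkn t (by simp))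
  obtain ⟨hHt, hx0, hx1, hkey, β', hβ, hatt, hchain'⟩ := hchain
  obtain rfl := hβ h20
  have hpi := Real.pi_pos
  rw [List.pairwise_cons] at hkne
  have hτ : τ ≤ t.lev := hle t (by simp)
  have hxt : ∀ r ∈ st.tree.toList, (LexLt r.key t.key → r.x ≤ t.x) ∧
      (LexLt t.key r.key → t.x ≤ r.x) := fun r hr => by
    have h3 := (hrange r hr).2.2
    rw [hkey]
    constructor <;> rintro (h | h)
    · rw [h3] at h; exact h.le
    · rw [h3] at h; exact h.1.le
    · rw [h3] at h; exact h.le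
    · rw [h3] at h; exact h.1.le
  have hlt : t.lev = t.x - t.y := rfl
  refine ⟨h1, List.ne_nil_of_mem ((h2 t).2 (Or.inl rfl)), ?_, ?_, ?_, ?_, ?_, ?_, hchain',
    hchain'.lev_le, fun s hs => ?_, fun s hs => ?_, hkne.2, hav, hsn, A, fun w => ?_, hG⟩ <;>
    try simp only [h2, forall_eq_or_imp]
  · exact ⟨hatt, hat⟩
  · exact ⟨⟨hx0, hx1, by rw [hkey]⟩, hrange⟩
  · exact ⟨le_rfl, fun r hr => (hlev r hr).trans hτ⟩
  · refine ⟨⟨fun h => absurd rfl h.ne, fun r hr htr => ?_⟩, fun r hr => ⟨fun hrt => ?_, hjoin r hr⟩⟩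
    · have h3 := (hxt r hr).2 htr
      have h4 := hrange r hr
      refine ⟨?_, le_joinLev _ _⟩
      rw [joinLev_eq]
      exact le_max_of_le_left (by linarith)
    · have h3 := (hxt r hr).1 hrt
      have h4 := hrange r hr
      refine ⟨le_joinLev _ _, ?_⟩
      rw [joinLev_eq]
      refine le_max_of_le_left ?_
      simp only [Rec.back]
      linarith
  · refine ⟨⟨by linarith, fun r hr => ?_⟩, fun r hr => ⟨?_, fun s hs => ?_⟩⟩
    · have h3 := hlev r hr
      have h4 := hrange r hr
      rw [Rec.lev] at h3
      linarith
    · have h4 := hrange r hr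
      linarith
    · linarith [hspread r hr s hs]
  · refine ⟨⟨fun h => absurd rfl h.ne, fun r hr htr => ?_⟩, fun r hr => ⟨fun hrt => ?_,
      fun s hs hrs => (hspread' r hr s hs hrs).trans hHt⟩⟩
    · have h3 := (hxt r hr).2 htr
      have h4 := hlev r hr
      rw [Rec.lev] at h4
      linarith
    · have h3 := (hxt r hr).1 hrt
      linarith
  · rw [State.insert, Tree.keys_update]
    exact hkm s (by simp [show s ∈ ts from hs])
  · refine ⟨hkne.1 s hs, hkn s (by simp [show s ∈ ts from hs])⟩
  · rw [hA]
    simp only [State.insert, List.mem_cons, exists_eq_or_imp]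
    rw [or_left_comm, or_assoc]

/-- If the only active node is at least two full turns of level outside the next terminal, that
terminal is the join point, and it can be activated whatever the rotation. -/
theorem Invariant.jump_pending (hα : 0 < Real.tan α) (hS : (0 : ℂ) ∉ S) (h : Invariant α S β H τ st)
    {f t : Rec} {ts : List Rec}
    (hf : st.tree.toList = [f]) (hp : st.pending = t :: ts)
    (hlev : 2 * Real.pi + 2 * Real.pi ≤ t.lev - f.lev) :
    ∃ β', Invariant α S β' t.lev t.lev (st.jump (2 * Real.tan α) f t ts) := by
  obtain ⟨hv, hne, hat, hrange, hlevτ, hle_join, hspread, hspread', hchain, hle, hkm, hkn, hkne, hav,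
    hsn, A, hA, hG⟩ := h
  have hexists := hchain.exists_at
  rw [hp] at hchain hle hkm hkn hkne hA hexists
  obtain ⟨hHt, hx0, hx1, hkey, β', hβ, hatt, hchain'⟩ := hchain
  have hpi := Real.pi_pos
  simp only [hf, List.mem_singleton, forall_eq, exists_eq_left] at hat hkn hA
  obtain ⟨h1, h2⟩ := hv.update (k := f.key) (hv.key_mem (by simp [hf])) (o := none) (by simp)
  have hvalid := jumpArc_valid hα hat hatt hlev
  have hfz : f.z ∈ A := (hA _).2 (Or.inl rfl)
  have htz : t.z ∈ A := (hA _).2 (Or.inr ⟨t, by simp, rfl⟩)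
  have hlt : ∀ s ∈ t :: ts, ‖s.z‖ ≤ ‖t.z‖ ∧ s.z ≠ f.z := fun s hs => by
    obtain ⟨γ, hγ⟩ := hexists s hs
    have h3 : t.lev ≤ s.lev := by
      rcases List.mem_cons.1 hs with rfl | hs
      · exact le_rfl
      · exact hchain'.lev_le s hs
    refine ⟨(hγ.norm_le_iff hα hatt).2 h3, fun he => ?_⟩
    have := hγ.lev_eq_of_z_eq hα hat he
    linarith
  refine ⟨β', invariant_insert_of_nil h1 ?_ hatt ⟨hx0, hx1⟩ hkey hchain' (fun s hs => ?_) hkne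
    ?_ ?_ ⟨insert t.z ((A.erase f.z).erase t.z), fun w => ?_, ?_⟩⟩
  · rw [List.eq_nil_iff_forall_not_mem]
    intro r
    rw [h2, hf]
    simp only [Option.mem_def, reduceCtorEq, List.mem_singleton, false_or, not_and, not_not]
    rintro rfl
    rfl
  · rw [Tree.keys_update]
    exact hkm s hs
  · simpa using ⟨hvalid, hav⟩
  · rw [List.map_cons, List.nodup_cons]
    refine ⟨fun hmem => ?_, hsn⟩
    obtain ⟨a, ha, he⟩ := List.mem_map.1 hmem
    refine (hG.inv hα hS).start_notMem a.toArc (by simpa using ⟨a, ha, rfl⟩) ?_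
    change a.start ∈ A
    rw [he]
    exact hfz
  · simp only [Finset.mem_insert, Finset.mem_erase, hA]
    constructor
    · rintro (rfl | ⟨-, h3, h4 | h4⟩)
      · exact ⟨t, by simp, rfl⟩
      · exact absurd h4.symm h3
      · exact h4
    · rintro ⟨s, hs, rfl⟩
      by_cases h3 : s.z = t.z
      · exact Or.inl h3
      · exact Or.inr ⟨h3, (hlt s hs).2, Or.inr ⟨s, hs, rfl⟩⟩
  · have hreg : t.z ∈ region α f.z := ⟨_, rfl, hvalid.2.2⟩
    have hG' := hG.join (u := f.z) (v := t.z) (p := t.z) (F := {(jumpArc (2 * Real.tan α) f t).toArc})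
      (G := ∅) hfz htz (hlt t (by simp)).2.symm
      ⟨⟨hreg, self_mem_region _⟩, fun q hq => norm_le_of_mem_region hα hq.2⟩ ?_
      (Or.inr ⟨(hlt t (by simp)).2.symm, _, rfl, hvalid.2.2, rfl⟩) (Or.inl ⟨rfl, rfl⟩)
    · convert hG' using 1
      ext a
      simp only [List.map_cons, List.toFinset_cons, Finset.mem_insert, Finset.mem_union,
        Finset.mem_singleton, Finset.notMem_empty, or_false]
      tauto
    · intro u hu v hv huv q hq
      rw [hA] at hu hv
      -- one of two different active nodes is a pending terminal
      rcases hv with rfl | ⟨s, hs, rfl⟩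
      · rcases hu with rfl | ⟨s, hs, rfl⟩
        · exact absurd rfl huv
        · exact (norm_le_of_mem_region hα hq.1.1).trans (hlt s hs).1
      · exact (norm_le_of_mem_region hα hq.1.2).trans (hlt s hs).1

/-- If no join of two active nodes is lower than the level of `p`, then the regions of two active
nodes do not meet outside the circle through `p`. -/
theorem Invariant.norm_le_of_mem_region_inter (hα : 0 < Real.tan α) (h : Invariant α S β H τ st)
    {p : Rec} (hp : p.At (Real.tan α) β)
    (hmin : ∀ r ∈ st.tree.toList, ∀ s ∈ st.tree.toList, LexLt r.key s.key →
      p.lev ≤ joinLev r s ∧ p.lev ≤ joinLev (s.back (2 * Real.pi)) r)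
    {r s : Rec} (hr : r ∈ st.tree.toList) (hs : s ∈ st.tree.toList) (hrs : r.key ≠ s.key) {q : ℂ}
    (hq : q ∈ region α r.z ∩ region α s.z) : ‖q‖ ≤ ‖p.z‖ := by
  rcases lexLt_or_lexLt hrs with hlt | hlt
  · obtain ⟨h1, h2⟩ := hmin r hr s hs hlt
    exact le_lev_of_mem_region_inter hα (h.isAt r hr) (h.isAt s hs) h1 h2 hp le_rfl hq
  · obtain ⟨h1, h2⟩ := hmin s hs r hr hlt
    exact le_lev_of_mem_region_inter hα (h.isAt s hs) (h.isAt r hr) h1 h2 hp le_rfl hq.symm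

/-- The forest after a join. Several nodes may have the same location; then the join of any two
of them is that location, and no arc is needed. -/
theorem Invariant.join_forest (hα : 0 < Real.tan α) (hS : (0 : ℂ) ∉ S)
    (h : Invariant α S β H τ st) {a₀ b p : Rec}
    (ha : a₀ ∈ st.tree.toList) (hb : b ∈ st.tree.toList) (hne : a₀.key ≠ b.key)
    (hp : p.At (Real.tan α) β) (hpa : p.z ∈ region α a₀.z) (hpb : p.z ∈ region α b.z)
    (hmin : ∀ r ∈ st.tree.toList, ∀ s ∈ st.tree.toList, LexLt r.key s.key →
      p.lev ≤ joinLev r s ∧ p.lev ≤ joinLev (s.back (2 * Real.pi)) r)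
    (hpend : ∀ t ∈ st.pending, p.lev ≤ t.lev) {F : List Rec}
    (hF : ∀ r, r ∈ F ↔ r = p ∨ (r ∈ st.tree.toList ∧ r.key ≠ a₀.key ∧ r.key ≠ b.key))
    {l₁ l₂ : List RawArc} (h₁ : ∀ a ∈ l₁, a.start = a₀.z) (h₂ : ∀ a ∈ l₂, a.start = b.z)
    (hn₁ : (l₁.map RawArc.start).Nodup) (hn₂ : (l₂.map RawArc.start).Nodup)
    (hl₁ : a₀.z = p.z → l₁ = []) (hl₂ : b.z = p.z → l₂ = [])
    (hF₁ : IsLink α a₀.z p.z (l₁.map RawArc.toArc).toFinset)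
    (hF₂ : IsLink α b.z p.z (l₂.map RawArc.toArc).toFinset) :
    ((l₁ ++ (l₂ ++ st.arcs)).map RawArc.start).Nodup ∧ ∃ A : Finset ℂ,
      (∀ w, w ∈ A ↔ (∃ r ∈ F, r.z = w) ∨ ∃ t ∈ st.pending, t.z = w) ∧
      GreedyForest α S A ((l₁ ++ (l₂ ++ st.arcs)).map RawArc.toArc).toFinset := by
  have hpair := fun {r s} => h.norm_le_of_mem_region_inter hα hp hmin (r := r) (s := s)
  have hF' := h.valid.pairwise
  obtain ⟨A, hA, hG⟩ := h.forest
  have hazA : a₀.z ∈ A := (hA _).2 (Or.inl ⟨_, ha, rfl⟩)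
  have hbzA : b.z ∈ A := (hA _).2 (Or.inl ⟨_, hb, rfl⟩)
  have hpt : ∀ t ∈ st.pending, ‖t.z‖ ≤ ‖p.z‖ := fun t ht => by
    obtain ⟨γ, hγ⟩ := h.chain.exists_at t ht
    exact (hγ.norm_le_iff hα hp).2 (hpend t ht)
  -- a location that is shared with another active node is the join point
  have hdup : ∀ u ∈ st.tree.toList, p.z ∈ region α u.z → ∀ s ∈ st.tree.toList, s.key ≠ u.key →
      s.z = u.z → p.z = u.z := fun u hu hpu s hs hsu hz =>
    eq_of_mem_region_of_norm_le hα hpu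
      (hpair hs hu hsu ⟨by rw [hz]; exact self_mem_region _, self_mem_region _⟩)
  have hdup' : ∀ u ∈ st.tree.toList, p.z ∈ region α u.z → ∀ t ∈ st.pending,
      t.z = u.z → p.z = u.z := fun u hu hpu t ht hz =>
    eq_of_mem_region_of_norm_le hα hpu (hz ▸ hpt t ht)
  by_cases hab : a₀.z = b.z
  · have hpz := hdup b hb hpb a₀ ha hne hab
    rw [hl₁ (hab.trans hpz.symm), hl₂ hpz.symm]
    refine ⟨h.starts_nodup, A, fun w => ?_, hG⟩
    rw [hA]
    refine or_congr_left ⟨?_, ?_⟩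
    · rintro ⟨r, hr, rfl⟩
      by_cases hra : r.key = a₀.key
      · exact ⟨p, (hF p).2 (Or.inl rfl), by rw [eq_of_key_eq hF' hr ha hra, hab, hpz]⟩
      · by_cases hrb : r.key = b.key
        · exact ⟨p, (hF p).2 (Or.inl rfl), by rw [eq_of_key_eq hF' hr hb hrb, hpz]⟩
        · exact ⟨r, (hF r).2 (Or.inr ⟨hr, hra, hrb⟩), rfl⟩
    · rintro ⟨r, hr, rfl⟩
      rcases (hF r).1 hr with rfl | hr
      · exact ⟨b, hb, hpz.symm⟩
      · exact ⟨r, hr.1, rfl⟩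
  · have hstart : ∀ a ∈ st.arcs, a.start ∉ A := fun a ha =>
      (hG.inv hα hS).start_notMem a.toArc (by simpa using ⟨a, ha, rfl⟩)
    constructor
    · simp only [List.map_append, List.nodup_append, List.mem_append, List.mem_map]
      refine ⟨hn₁, ⟨hn₂, h.starts_nodup, ?_⟩, ?_⟩
      · rintro _ ⟨a, ha', rfl⟩ _ ⟨a', ha'', rfl⟩ he
        exact hstart a' ha'' (by rw [← he, h₂ a ha']; exact hbzA)
      · rintro _ ⟨a, ha', rfl⟩ _ (⟨a', ha'', rfl⟩ | ⟨a', ha'', rfl⟩) he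
        · exact hab (by rw [← h₁ a ha', he, h₂ a' ha''])
        · exact hstart a' ha'' (by rw [← he, h₁ a ha']; exact hazA)
    · refine ⟨insert p.z ((A.erase a₀.z).erase b.z), fun w => ?_, ?_⟩
      · simp only [Finset.mem_insert, Finset.mem_erase, hA]
        constructor
        · rintro (rfl | ⟨hwb, hwa, ⟨r, hr, rfl⟩ | hw⟩)
          · exact Or.inl ⟨p, (hF p).2 (Or.inl rfl), rfl⟩
          · refine Or.inl ⟨r, (hF r).2 (Or.inr ⟨hr, fun he => hwa ?_, fun he => hwb ?_⟩), rfl⟩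
            · rw [eq_of_key_eq hF' hr ha he]
            · rw [eq_of_key_eq hF' hr hb he]
          · exact Or.inr hw
        · rintro (⟨r, hr, rfl⟩ | ⟨t, ht, rfl⟩)
          · rcases (hF r).1 hr with rfl | ⟨hr, hra, hrb⟩
            · exact Or.inl rfl
            · by_cases h1 : r.z = a₀.z
              · exact Or.inl (h1.trans (hdup a₀ ha hpa r hr hra h1).symm)
              · by_cases h2 : r.z = b.z
                · exact Or.inl (h2.trans (hdup b hb hpb r hr hrb h2).symm)
                · exact Or.inr ⟨h2, h1, Or.inl ⟨r, hr, rfl⟩⟩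
          · by_cases h1 : t.z = a₀.z
            · exact Or.inl (h1.trans (hdup' a₀ ha hpa t ht h1).symm)
            · by_cases h2 : t.z = b.z
              · exact Or.inl (h2.trans (hdup' b hb hpb t ht h2).symm)
              · exact Or.inr ⟨h2, h1, Or.inr ⟨t, ht, rfl⟩⟩
      · have hG' := hG.join hazA hbzA hab ⟨⟨hpa, hpb⟩, fun q hq => hpair ha hb hne hq⟩ ?_ hF₁ hF₂
        · convert hG' using 1
          ext a
          simp only [List.map_append, List.toFinset_append, Finset.mem_union]
          tauto
        · intro u hu v hv huv q hq
          rw [hA] at hu hv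
          rcases hu with ⟨r, hr, rfl⟩ | ⟨t, ht, rfl⟩
          · rcases hv with ⟨s, hs, rfl⟩ | ⟨t, ht, rfl⟩
            · exact hpair hr hs (fun he => huv (by rw [eq_of_key_eq hF' hr hs he])) hq.1
            · exact (norm_le_of_mem_region hα hq.1.2).trans (hpt t ht)
          · exact (norm_le_of_mem_region hα hq.1.1).trans (hpt t ht)

/-- The pair of nodes with the lowest join may be joined, if no terminal is to be activated
before. -/
theorem Invariant.join_pair (hα : 0 < Real.tan α) (hS : (0 : ℂ) ∉ S) (h : Invariant α S β H τ st)
    {a₀ a b : Rec} (hab : JoinPair H st.tree.toList a₀ a b)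
    (hmin : ∀ r ∈ st.tree.toList, ∀ s ∈ st.tree.toList, LexLt r.key s.key →
      joinLev a b ≤ joinLev r s ∧ joinLev a b ≤ joinLev (s.back (2 * Real.pi)) r)
    (hpend : ∀ t ∈ st.pending, joinLev a b ≤ t.lev) (hτ : τ ≤ joinLev a b) :
    Invariant α S β H (joinLev a b) (st.join (2 * Real.tan α) a b) ∧
      ∀ r, r ∈ (st.join (2 * Real.tan α) a b).tree.toList ↔ r = tip (2 * Real.tan α) a b ∨
        (r ∈ st.tree.toList ∧ r.key ≠ a₀.key ∧ r.key ≠ b.key) := by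
  obtain ⟨ha, hb, hne, horig, hxle, hlex, hsr, hsa, hsb⟩ := hab
  have hpi := Real.pi_pos
  have hkey : a.key = a₀.key := by rcases horig with rfl | rfl <;> rfl
  have hz : a.z = a₀.z := by rcases horig with rfl | rfl <;> rfl
  have hata : a.At (Real.tan α) β := by
    rcases horig with rfl | rfl
    · exact h.isAt a ha
    · exact (h.isAt a₀ ha).back hα
  have hatb := h.isAt b hb
  obtain ⟨hpk, hpx, hpy, hp⟩ := tip_spec hata hatb
  set p := tip (2 * Real.tan α) a b with hpdef
  have hplev : p.lev = joinLev a b := by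
    rw [joinLev_eq, Rec.lev, hpx, hpy]
    rcases min_cases a.y b.y with ⟨h1, h2⟩ | ⟨h1, h2⟩
    · rw [h1, max_eq_left (by linarith)]
    · rw [h1, max_eq_right (by linarith)]
  obtain ⟨hv1, hm1⟩ := h.valid.update (h.valid.key_mem ha) (o := none) (by simp)
  obtain ⟨hv2, hm2⟩ := hv1.update (k := b.key)
    (by rw [Tree.keys_update]; exact h.valid.key_mem hb) (o := some p) (by simpa using hpk)
  have hm : ∀ r, r ∈ (st.join (2 * Real.tan α) a b).tree.toList ↔ r = p ∨
      (r ∈ st.tree.toList ∧ r.key ≠ a₀.key ∧ r.key ≠ b.key) := fun r => by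
    rw [State.join, hkey]
    simp only [← hpdef]
    rw [hm2, hm1, Option.mem_some_iff, eq_comm]
    simp [and_assoc]
  refine ⟨?_, hm⟩
  have hpya : p.y ≤ a.y := hpy ▸ min_le_left _ _
  have hpyb : p.y ≤ b.y := hpy ▸ min_le_right _ _
  have hpa : p.z ∈ region α a₀.z := by
    rw [← hz, hata, mem_region_pt hα]
    exact Or.inr ⟨_, _, by linarith, by linarith, hp⟩
  have hpb : p.z ∈ region α b.z := by
    rw [hatb, mem_region_pt hα]
    exact Or.inr ⟨_, _, by linarith, by linarith, hp⟩
  obtain ⟨l₂, hl₂, hval₂, hlink₂, hnil₂, hnd₂, hst₂⟩ :=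
    link_spec hα hatb hp hpx.ge hpyb st.arcs
  obtain ⟨l₁, hl₁, hval₁, hlink₁, hnil₁, hnd₁, hst₁⟩ :=
    link_spec hα hata hp (by rw [hpx]; exact hxle) hpya (l₂ ++ st.arcs)
  rw [hz] at hlink₁ hnil₁ hst₁
  have harcs : (st.join (2 * Real.tan α) a b).arcs = l₁ ++ (l₂ ++ st.arcs) := by
    rw [State.join, ← hl₁, ← hl₂]
  have hforest := h.join_forest hα hS ha hb hne hp hpa hpb (hplev ▸ hmin) (hplev ▸ hpend) hm hst₁
    hst₂ hnd₁ hnd₂ hnil₁ hnil₂ hlink₁ hlink₂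
  rw [← harcs] at hforest
  refine ⟨by rw [State.join, hkey]; exact hv2, List.ne_nil_of_mem ((hm p).2 (Or.inl rfl)), ?_, ?_,
    ?_, ?_, ?_, ?_, h.chain, hpend,
    fun t ht => ?_, fun t ht => ?_, h.keys_ne, fun r hr => ?_, hforest.1, hforest.2⟩ <;>
    try simp only [hm, forall_eq_or_imp]
  · exact ⟨hp, fun r hr => h.isAt r hr.1⟩
  · refine ⟨?_, fun r hr => h.range r hr.1⟩
    rw [hpx, hpk]
    exact h.range b hb
  · exact ⟨hplev.le, fun r hr => (h.lev_le r hr.1).trans hτ⟩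
  · -- moving a node inwards only increases the levels of its joins
    refine ⟨⟨fun hpp => absurd rfl hpp.ne, fun r hr hpr => ?_⟩,
      fun r hr => ⟨fun hrp => ?_, fun s hs hrs => hmin r hr.1 s hs.1 hrs⟩⟩
    · rw [hpk] at hpr
      obtain ⟨h1, h2⟩ := hmin b hb r hr.1 hpr
      refine ⟨h1.trans ?_, h2.trans ?_⟩
      · rw [joinLev_eq b, joinLev_eq]
        exact max_le_max (by linarith) le_rfl
      · rw [joinLev_eq _ b, joinLev_eq, hpx]
        exact max_le_max le_rfl (by linarith)
    · rw [hpk] at hrp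
      obtain ⟨h1, h2⟩ := hmin r hr.1 b hb hrp
      refine ⟨h1.trans ?_, h2.trans ?_⟩
      · rw [joinLev_eq _ b, joinLev_eq, hpx]
        exact max_le_max le_rfl (by linarith)
      · rw [joinLev_eq _ r, joinLev_eq]
        simp only [Rec.back]
        exact max_le_max (by linarith) le_rfl
  · refine ⟨⟨?_, fun r hr => ?_⟩, fun r hr => ⟨?_, fun s hs => h.spread r hr.1 s hs.1⟩⟩
    · rw [hpx, hpy]
      rcases min_choice a.y b.y with h1 | h1 <;> rw [h1]
      · exact hsr
      · exact h.spread b hb b hb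
    · rw [hpx]
      exact h.spread b hb r hr.1
    · rw [hpy]
      rcases min_choice a.y b.y with h1 | h1 <;> rw [h1]
      · exact hsa r hr.1 hr.2.1
      · exact h.spread r hr.1 b hb
  · refine ⟨⟨fun hpp => absurd rfl hpp.ne, fun r hr hpr => ?_⟩,
      fun r hr => ⟨fun hrp => ?_, fun s hs hrs => h.spread_of_lt r hr.1 s hs.1 hrs⟩⟩
    · rw [hpk] at hpr
      rw [hpx]
      exact h.spread_of_lt b hb r hr.1 hpr
    · rw [hpk] at hrp
      rw [hpy]
      rcases min_choice a.y b.y with h1 | h1 <;> rw [h1]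
      · exact hsb r hr.1 hr.2.1 hrp
      · exact h.spread_of_lt r hr.1 b hb hrp
  · rw [State.join]
    simp only [Tree.keys_update]
    exact h.key_mem t ht
  · refine ⟨?_, fun r hr => h.key_ne t ht r hr.1⟩
    rw [hpk]
    exact h.key_ne t ht b hb
  · rw [harcs] at hr
    rcases List.mem_append.1 hr with hr | hr
    · exact hval₁ r hr
    · rcases List.mem_append.1 hr with hr | hr
      · exact hval₂ r hr
      · exact h.arcs_valid r hr

/-! ### The loop computes a greedy tree -/

theorem Tree.length_toList_update_le (t : Tree) (k : ℝ × ℝ) (o : Option Rec) :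
    (t.update k o).toList.length ≤ t.toList.length + o.toList.length := by
  induction t with
  | leaf k' o' => simp [Tree.update, Tree.toList]
  | node s l r ihl ihr =>
    rw [Tree.update]
    split_ifs <;> simp only [Tree.toList, List.length_append] <;> omega

theorem length_lt_of_forall_mem {F G : List Rec} {a b p : Rec}
    (hG : G.Pairwise fun r s => LexLt r.key s.key) (ha : a ∈ F) (hb : b ∈ F) (hne : a.key ≠ b.key)
    (h : ∀ r ∈ G, r = p ∨ (r ∈ F ∧ r.key ≠ a.key ∧ r.key ≠ b.key)) : G.length < F.length := by
  classical
  have hb' : b ∈ F.erase a := (List.mem_erase_of_ne fun he => hne (by rw [he])).2 hb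
  have hsub : G ⊆ p :: (F.erase a).erase b := fun r hr => by
    rcases h r hr with rfl | ⟨h1, h2, h3⟩
    · exact List.mem_cons_self
    · exact List.mem_cons_of_mem _ ((List.mem_erase_of_ne fun he => h3 (by rw [he])).2
        ((List.mem_erase_of_ne fun he => h2 (by rw [he])).2 h1))
  have hnd : G.Nodup := hG.imp fun hrs he => hrs.ne (by rw [he])
  have h1 := (hnd.subperm hsub).length_le
  have h2 := List.length_pos_of_mem ha
  have h3 := List.length_pos_of_mem hb'
  rw [List.length_erase_of_mem ha] at h3
  rw [List.length_cons, List.length_erase_of_mem hb', List.length_erase_of_mem ha] at h1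
  omega

/-- When a single node is left, the last arc completes the greedy tree. -/
theorem Invariant.isGreedyTree (hα : 0 < Real.tan α) (hS : (0 : ℂ) ∉ S)
    (h : Invariant α S β H τ st) {f : Rec} (hf : st.tree.toList = [f]) (hp : st.pending = []) :
    ((⟨f.z, [], some .right⟩ : Arc) :: st.arcs.map RawArc.toArc).Nodup ∧
      IsGreedyTree α S ((⟨f.z, [], some .right⟩ : Arc) :: st.arcs.map RawArc.toArc).toFinset := by
  obtain ⟨A, hA, hG⟩ := h.forest
  obtain rfl : A = {f.z} := by
    ext w
    rw [hA, hf, hp]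
    simp [eq_comm]
  refine ⟨List.nodup_cons.2 ⟨fun hmem => ?_, ?_⟩, f.z, _, {⟨f.z, [], some .right⟩}, hG,
    Or.inr ⟨(h.isAt f (by simp [hf])).ne_zero, _, rfl, rfl, rfl⟩, ?_⟩
  · exact (hG.inv hα hS).start_notMem _ (List.mem_toFinset.2 hmem) (by simp)
  · refine List.Nodup.of_map Arc.start ?_
    rw [List.map_map]
    exact h.starts_nodup
  · rw [List.toFinset_cons, Finset.union_comm]
    rfl

/-- Every step decreases twice the number of pending terminals plus the number of active nodes in
the search tree, and it takes a number of steps that is linear in the height of the tree. -/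
theorem ev_loop (hα : 0 < Real.tan α) (hS : (0 : ℂ) ∉ S) (m : ℕ) (h : Invariant α S β H τ st)
    (hm : 2 * st.pending.length + st.tree.toList.length ≤ m) :
    ∃ L : List Arc, L.Nodup ∧ IsGreedyTree α S L.toFinset ∧
      Ev greedyProgram [encState (2 * Real.tan α) (2 * Real.pi) st] loopBody
        (encodeList (encodeArc α) L) (m * (1000 * st.tree.height + 3000) + 100) := by
  induction m generalizing β H τ st with
  | zero => exact absurd (List.length_eq_zero_iff.1 (by omega)) h.ne_nil
  | succ m ih =>
    have hpi := Real.pi_lt_d2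
    -- it suffices to make one step
    have key : ∀ st' β' H' τ', st.step (2 * Real.tan α) (2 * Real.pi) = some st' →
        Invariant α S β' H' τ' st' → st'.tree.height = st.tree.height →
        2 * st'.pending.length + st'.tree.toList.length ≤ m →
        (∀ f l b, st.tree.summary = some (f, l, some b) →
          |((better (cand (l.back (2 * Real.pi)) f) (some b)).2.1.x -
            (better (cand (l.back (2 * Real.pi)) f) (some b)).1.x) / 2| ≤ Real.pi) →
        ∃ L : List Arc, L.Nodup ∧ IsGreedyTree α S L.toFinset ∧
          Ev greedyProgram [encState (2 * Real.tan α) (2 * Real.pi) st] loopBody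
            (encodeList (encodeArc α) L)
            ((m + 1) * (1000 * st.tree.height + 3000) + 100) := by
      intro st' β' H' τ' hstep hinv hh hm' hx
      obtain ⟨L, hL, hLG, hev⟩ := ih hinv hm'
      refine ⟨L, hL, hLG, (ev_loop_step hstep hx hev).mono ?_⟩
      rw [hh]
      apply le_of_eq
      ring
    have hsum := st.tree.isSummary
    cases hs : st.tree.summary with
    | none =>
      rw [hs] at hsum
      exact absurd hsum h.ne_nil
    | some s =>
      obtain ⟨f, l, o⟩ := s
      cases o with
      | none =>
        rw [hs] at hsum
        have hf : st.tree.toList = [f] := hsum.2.2.1 rfl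
        cases hp : st.pending with
        | nil =>
          obtain ⟨h1, h2⟩ := h.isGreedyTree hα hS hf hp
          refine ⟨_, h1, h2, ?_⟩
          have hmap : encodeList (encodeArc α) (st.arcs.map RawArc.toArc) =
              encodeList encRaw st.arcs := by
            have := h.arcs_valid
            generalize st.arcs = as at this
            induction as with
            | nil => rfl
            | cons a as ih =>
              rw [List.map_cons, encodeList, encodeList, encodeArc_toArc (this a (by simp)),
                ih fun a ha => this a (by simp [ha])]
          have := ev_loop_done (κ2 := 2 * Real.tan α) (tp := 2 * Real.pi) hs hp
          rw [← hmap] at this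
          refine Ev.mono ?_ (Nat.le_add_left 100 _)
          convert this using 2
          simp [encLast, encodeArc, Arc.finish_some, encodePoint, encodeList, encodeSide, Side.sign]
        | cons t ts =>
          have hlen : st.pending.length = ts.length + 1 := by rw [hp]; rfl
          have hlenF : st.tree.toList.length = 1 := by rw [hf]; rfl
          have hx : ∀ f l b, st.tree.summary = some (f, l, some b) →
              |((better (cand (l.back (2 * Real.pi)) f) (some b)).2.1.x -
                (better (cand (l.back (2 * Real.pi)) f) (some b)).1.x) / 2| ≤ Real.pi := by
            intro f l b hb
            rw [hs] at hb
            simp at hb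
          by_cases hlt : t.lev - f.lev < 2 * Real.pi + 2 * Real.pi
          · refine key _ β t.lev t.lev (by rw [State.step, hs, hp]; exact if_pos hlt)
              (h.insert_pending hp ?_ ?_) (Tree.height_update _ _ _) ?_ hx
            · have := h.spread f (by simp [hf]) f (by simp [hf])
              rw [Rec.lev, Rec.lev] at hlt
              rw [Rec.lev]
              linarith
            · intro r hr s hs' hrs
              rw [hf, List.mem_singleton] at hr hs'
              rw [hr, hs'] at hrs
              exact absurd rfl hrs.ne
            · have := st.tree.length_toList_update_le t.key (some t)
              simp only [Option.toList_some, List.length_singleton] at this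
              simp only [State.insert]
              omega
          · obtain ⟨β', hinv⟩ := h.jump_pending hα hS hf hp (not_lt.1 hlt)
            refine key _ β' t.lev t.lev (by rw [State.step, hs, hp]; exact if_neg hlt) hinv ?_ ?_ hx
            · simp only [State.jump, State.insert, Tree.height_update]
            · have h1 := st.tree.length_toList_update_le f.key none
              have h2 := (st.tree.update f.key none).length_toList_update_le t.key (some t)
              simp only [Option.toList_none, List.length_nil, Option.toList_some,
                List.length_singleton] at h1 h2
              simp only [State.jump, State.insert]
              omega
      | some o =>
        obtain ⟨a₀, a, b, hc, hab, hτ, hmin⟩ := h.exists_joinPair hs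
        have hx : ∀ f l b, st.tree.summary = some (f, l, some b) →
            |((better (cand (l.back (2 * Real.pi)) f) (some b)).2.1.x -
              (better (cand (l.back (2 * Real.pi)) f) (some b)).1.x) / 2| ≤ Real.pi := by
          intro f' l' o' ho
          rw [hs, Option.some_inj, Prod.mk.injEq, Prod.mk.injEq, Option.some_inj] at ho
          obtain ⟨rfl, rfl, rfl⟩ := ho
          rw [hc]
          have h1 := hab.x_le
          have h2 := hab.le_x
          rw [abs_of_nonneg (by simp only [cand]; linarith)]
          simp only [cand]
          linarith
        have hjoin : (∀ t ∈ st.pending, joinLev a b ≤ t.lev) →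
            st.step (2 * Real.tan α) (2 * Real.pi) = some (st.join (2 * Real.tan α) a b) →
            ∃ L : List Arc, L.Nodup ∧ IsGreedyTree α S L.toFinset ∧
              Ev greedyProgram [encState (2 * Real.tan α) (2 * Real.pi) st] loopBody
                (encodeList (encodeArc α) L)
                ((m + 1) * (1000 * st.tree.height + 3000) + 100) := by
          intro hpend hstep
          obtain ⟨hinv, hmem⟩ := h.join_pair hα hS hab hmin hpend hτ
          refine key _ β H _ hstep hinv ?_ ?_ hx
          · simp only [State.join, Tree.height_update]
          · have := length_lt_of_forall_mem hinv.valid.pairwise hab.mem_left hab.mem_right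
              hab.key_ne fun r hr => (hmem r).1 hr
            have hpp : (st.join (2 * Real.tan α) a b).pending = st.pending := rfl
            rw [hpp]
            omega
        cases hp : st.pending with
        | nil =>
          refine hjoin (by simp [hp]) ?_
          rw [State.step, hs, hp]
          simp only [hc]
          rfl
        | cons t ts =>
          have hlen : st.pending.length = ts.length + 1 := by rw [hp]; rfl
          have hchain := h.chain
          rw [hp] at hchain
          by_cases hlt : t.lev < joinLev a b
          · refine key _ β t.lev t.lev ?_ (h.insert_pending hp ?_ fun r hr s hs' hrs => ?_)
              (Tree.height_update _ _ _) ?_ hx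
            · rw [State.step, hs, hp]
              simp only [hc]
              exact if_pos hlt
            · have := h.joinLev_le hab
              linarith
            · obtain ⟨h1, h2⟩ := hmin r hr s hs' hrs
              exact ⟨by linarith, by linarith⟩
            · have := st.tree.length_toList_update_le t.key (some t)
              simp only [Option.toList_some, List.length_singleton] at this
              simp only [State.insert]
              omega
          · refine hjoin ?_ ?_
            · rw [hp]
              intro s hs'
              rcases List.mem_cons.1 hs' with rfl | hs'
              · exact not_lt.1 hlt
              · obtain ⟨-, -, -, -, β', -, -, h2⟩ := hchain
                exact (not_lt.1 hlt).trans (h2.lev_le s hs')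
            · rw [State.step, hs, hp]
              simp only [hc]
              exact if_neg hlt

/-! ### Correctness and running time of the program -/

theorem ev_main (h0 : 0 < α) (h1 : α < Real.pi / 2) {l : List ℂ} (hl : l ≠ []) (hnd : l.Nodup)
    (hS : (0 : ℂ) ∉ l) : ∃ L : List Arc, L.Nodup ∧ IsGreedyTree α l.toFinset L.toFinset ∧
      Ev greedyProgram [encodeInput α l] mainBody (encodeList (encodeArc α) L)
        (5000 * (l.length * depth l) + 20000 * l.length) := by
  have hpi := Real.pi_pos
  have hα : 0 < Real.tan α := Real.tan_pos_of_pos_of_lt_pi_div_two h0 h1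
  have hlen : l.length ≤ 2 ^ depth l := length_le_two_pow_depth l
  set D := depth l with hD
  set items := (sortBy Prod.fst D (l.map (item (Real.tan α)))).1 with hitems
  have hperm : items.Perm (l.map (item (Real.tan α))) := sortBy_perm_of_le _ (by simpa using hlen)
  have hsnd : (items.map Prod.snd).Perm l := by
    have := hperm.map Prod.snd
    rwa [List.map_map, show Prod.snd ∘ item (Real.tan α) = id from rfl, List.map_id] at this
  have hitemlen : items.length = l.length := by simpa using hperm.length_eq
  obtain ⟨i, is, his⟩ : ∃ i is, items = i :: is := List.exists_cons_of_ne_nil fun h => by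
    rw [h] at hitemlen
    exact hl (List.length_eq_zero_iff.1 hitemlen.symm)
  have hsorted : items.Pairwise fun i j => i.1.1 ≤ j.1.1 :=
    (sortBy_sorted Prod.fst D (l.map (item (Real.tan α)))).imp fun h => not_lt.1 fun h' => h (Or.inl h')
  set recs := nodes (2 * Real.pi) items i.1.1 0 with hrecs
  have hchain : Chain (Real.tan α) i.1.1 (i.1.1 / 2) recs := by
    refine nodes_chain hα items (fun j hj => ?_) (fun j hj => ?_) hsorted le_rfl (by linarith)
      ⟨0, by simp⟩
    · obtain ⟨z, hz, rfl⟩ := List.mem_map.1 (hperm.subset hj)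
      exact ⟨fun h => hS (h ▸ hz), rfl⟩
    · rw [his] at hj hsorted
      rcases List.mem_cons.1 hj with rfl | hj
      · exact le_rfl
      · exact (List.pairwise_cons.1 hsorted).1 j hj
  have hz : (recs.map Rec.z).Perm l := by rw [hrecs, map_z_nodes]; exact hsnd
  have hreclen : recs.length = l.length := by simpa using hz.length_eq
  obtain ⟨t, ts, hts⟩ : ∃ t ts, recs = t :: ts := List.exists_cons_of_ne_nil fun h => by
    rw [h] at hreclen
    exact hl (List.length_eq_zero_iff.1 hreclen.symm)
  have hkeys := hchain.keys_nodup (hz.nodup_iff.2 hnd)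
  set sorted := (sortBy Rec.key D recs).1 with hsort
  have hperm' : sorted.Perm recs := sortBy_perm_of_le _ (by rwa [hreclen])
  have hsorted' : sorted.Pairwise fun a b => LexLt a.key b.key := by
    have h2 : sorted.Pairwise fun a b => a.key ≠ b.key :=
      (hperm'.pairwise_iff fun h => h.symm).2 hkeys
    exact ((sortBy_sorted Rec.key D recs).and h2).imp fun h => lexLt_of_not_lt_of_ne h.1 h.2
  have hne : sorted ≠ [] := fun h => by
    rw [h, hts] at hperm'
    simp at hperm'
  obtain ⟨hb1, hb2, hb3, hb4, hb5⟩ := build_spec D sorted hne hsorted'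
  rw [List.take_of_length_le (by rw [hperm'.length_eq, hreclen]; exact hlen)] at hb1
  have hchain' := hchain
  rw [hts] at hchain' hkeys
  obtain ⟨-, hx0, hx1, hkey, β', -, hat, hchain''⟩ := hchain'
  have hinv : Invariant α l.toFinset β' t.lev t.lev (State.insert ⟨(build D sorted).1, [], []⟩ t ts) := by
    refine invariant_insert_of_nil hb3 hb4 hat ⟨hx0, hx1⟩ hkey hchain'' (fun s hs => ?_) hkeys
      (by simp) (by simp) ⟨l.toFinset, fun w => ?_, .init⟩
    · simp only [hb1]
      exact List.mem_map_of_mem (hperm'.symm.subset (hts ▸ hs))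
    · rw [List.mem_toFinset, ← hz.mem_iff, hts, List.mem_map]
  obtain ⟨L, hL, hLG, hev⟩ := ev_loop hα (by simpa using hS) (2 * l.length) hinv (by
    have := (build D sorted).1.length_toList_update_le t.key (some t)
    rw [hb4] at this
    simp only [List.length_nil, Option.toList_some, List.length_singleton] at this
    rw [hts, List.length_cons] at hreclen
    simp only [State.insert]
    omega)
  refine ⟨L, hL, hLG, ?_⟩
  have hev1 := ev_depth encodePoint l
  have hev2 := ev_items (Real.tan α) l
  have hev3 := ev_sort Prod.fst encItem (fun b => ⟨_, rfl⟩) D (l.map (item (Real.tan α)))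
  have hev4 := ev_nodes (2 * Real.pi) items i.1.1 0
  have hev5 := ev_sort Rec.key encRec (fun b => ⟨_, rfl⟩) D recs
  have hev6 := ev_build D sorted hne
  have hev7 := ev_insert hev
  rw [two_mul (Real.tan α)] at hev7
  rw [← hitems] at hev3
  rw [← hrecs, his] at hev4
  rw [← hsort, hts] at hev5
  rw [hts] at hev4
  rw [his] at hev3
  have hev8 : Ev greedyProgram [encodeInput α l]
      (tDiv (.unary .sin (tFst (.var 0))) (.unary .cos (tFst (.var 0)))) (.real (Real.tan α)) 20 := by
    rw [Real.tan_eq_sin_div_cos]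
    have : |α| ≤ Real.pi := by rw [abs_of_pos h0]; linarith
    exact (Ev.div (Ev.sin this (Ev.tfst (.var rfl))) (Ev.cos this (Ev.tfst (.var rfl)))).mono
      (by norm_num)
  have hev9 : Ev greedyProgram [.real (Real.tan α), encodeInput α l]
      (tAdd (.binary .arg (.const (-1)) (.const 0)) (.binary .arg (.const (-1)) (.const 0)))
      (.real (2 * Real.pi)) 20 := by
    have h2 : Complex.arg ⟨-1, 0⟩ = Real.pi := by
      rw [← Complex.arg_neg_one]
      congr 1
      apply Complex.ext <;> simp
    rw [two_mul]
    nth_rewrite 1 [← h2]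
    nth_rewrite 1 [← h2]
    exact (Ev.add (Ev.arg .neg_one .zero) (Ev.arg .neg_one .zero)).mono (by norm_num)
  refine Ev.mono (Ev.bind hev8 (Ev.bind hev9 (Ev.bind (Ev.call (Ev.tsnd (.var rfl)) rfl hev1)
    (Ev.bind (Ev.tfst (Ev.call (Ev.pair (.var rfl) (Ev.call (Ev.pair (.var rfl)
      (Ev.tsnd (.var rfl))) rfl hev2)) rfl hev3))
    (Ev.bind (Ev.cases_pair (.var rfl) (Ev.call (Ev.pair (.var rfl) (Ev.pair (.var rfl)
      (Ev.pair (Ev.tfst (Ev.tfst (.var rfl))) .zero))) rfl hev4))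
    (Ev.bind (Ev.tfst (Ev.call (Ev.pair (.var rfl) (Ev.tfst (Ev.call (Ev.pair (.var rfl)
      (.var rfl)) rfl hev5))) rfl hev6))
    (Ev.cases_pair (.var rfl) (Ev.call (Ev.pair (.var rfl) (Ev.pair (.var rfl) (Ev.pair
      (Ev.pair (Ev.add (.var rfl) (.var rfl)) (.var rfl)) (Ev.pair (.var rfl)
      (Ev.pair .nil .nil))))) rfl hev7)))))))) ?_
  have hpow : 2 ^ D < 2 * l.length := two_pow_depth_lt l hl
  have hn : 1 ≤ l.length := List.length_pos_of_ne_nil hl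
  have h2 : (300 * D + 100) * 2 ^ D ≤ (300 * D + 100) * (2 * l.length) :=
    Nat.mul_le_mul_left _ hpow.le
  have h3 : (2 * l.length) * (1000 * (State.insert ⟨(build D sorted).1, [], []⟩ t ts).tree.height
      + 3000) ≤ (2 * l.length) * (1000 * D + 3000) := by
    refine Nat.mul_le_mul_left _ ?_
    simp only [State.insert, Tree.height_update]
    omega
  have h4 : D ≤ l.length * D := Nat.le_mul_of_pos_left _ hn
  rw [his] at hitemlen
  have h6 : (300 * D + 100) * (2 * l.length) = 600 * (l.length * D) + 200 * l.length := by ring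
  have h7 : (2 * l.length) * (1000 * D + 3000) = 2000 * (l.length * D) + 6000 * l.length := by
    ring
  simp only
  omega

/-- The depth is at most `1 + log₂ n`, and `1 / log 2` is less than `3 / 2`. -/
theorem length_mul_depth_le {n D : ℕ} (hn : 1 ≤ n) (hD : 2 ^ D < 2 * n) :
    ((5000 * (n * D) + 20000 * n : ℕ) : ℝ) ≤ 50000 * (n * Real.log n + 1) := by
  have hlog2 := Real.log_two_gt_d9
  have hn' : (1 : ℝ) ≤ n := by exact_mod_cast hn
  have hD' : (D : ℝ) * Real.log 2 ≤ Real.log 2 + Real.log n := by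
    rw [← Real.log_pow, ← Real.log_mul (by norm_num) (by linarith)]
    exact Real.log_le_log (by positivity) (by exact_mod_cast hD.le)
  have hlogn : 0 ≤ Real.log n := Real.log_nonneg hn'
  have h1 : (D : ℝ) ≤ 1 + 3 / 2 * Real.log n := by
    by_contra! hlt
    nlinarith
  have h2 : (n : ℝ) * D ≤ n * (1 + 3 / 2 * Real.log n) := by gcongr
  have h3 : (n : ℝ) ≤ 3 / 2 * (n * Real.log n) + 1 := by
    rcases Nat.eq_or_lt_of_le hn with rfl | hn2
    · simp
    · have : Real.log 2 ≤ Real.log n := Real.log_le_log (by norm_num) (by exact_mod_cast hn2)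
      nlinarith
  have h4 : 0 ≤ n * Real.log n := by positivity
  push_cast
  nlinarith

end SpiralTree

theorem mainTheorem2 :
    -- every greedy spiral tree is a spiral tree, it meets every circle about the root at most
    -- twice as often as any (in particular, as an optimal) spiral tree with the same terminals,
    -- and it is at most twice as long
    (∀ α : ℝ, 0 < α → α < Real.pi / 2 → ∀ S : Finset ℂ, (0 : ℂ) ∉ S →
      ∀ T' : Finset SpiralTree.Arc, SpiralTree.IsGreedyTree α S T' →
        SpiralTree.IsSpiralTree α S T' ∧
        ∀ T : Finset SpiralTree.Arc, SpiralTree.IsSpiralTree α S T →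
          (∀ R : ℝ, 0 < R →
            (Metric.sphere (0 : ℂ) R ∩ SpiralTree.treePoints α T').encard ≤
              2 * (Metric.sphere (0 : ℂ) R ∩ SpiralTree.treePoints α T).encard) ∧
          SpiralTree.treeLength α T' ≤ 2 * SpiralTree.treeLength α T) ∧
    -- one program computes a greedy spiral tree of `n` terminals in `O(n log n)` steps
    (∃ (P : SpiralTree.Program) (c : ℝ),
      ∀ α : ℝ, 0 < α → α < Real.pi / 2 → ∀ l : List ℂ, l ≠ [] → l.Nodup → (0 : ℂ) ∉ l →
        ∃ (L : List SpiralTree.Arc) (k : ℕ),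
          L.Nodup ∧
          SpiralTree.IsGreedyTree α l.toFinset L.toFinset ∧
          P.Computes (SpiralTree.encodeInput α l)
            (SpiralTree.encodeList (SpiralTree.encodeArc α) L) k ∧
          (k : ℝ) ≤ c * (l.length * Real.log l.length + 1)) := by
  refine ⟨fun α h0 h1 S hS T' hT' => ?_, SpiralTree.greedyProgram, 50000,
    fun α h0 h1 l hl hnd hS => ?_⟩
  · exact SpiralTree.greedy_approximation (Real.tan_pos_of_pos_of_lt_pi_div_two h0 h1) hS hT'
  · obtain ⟨L, hL, hLG, k, hk, hev⟩ := SpiralTree.ev_main h0 h1 hl hnd hS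
    refine ⟨L, k, hL, hLG, ⟨_, rfl, hev⟩, le_trans (by exact_mod_cast hk)
      (SpiralTree.length_mul_depth_le (List.length_pos_of_ne_nil hl)
        (SpiralTree.two_pow_depth_lt l hl))⟩
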